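/- Let $d\ge 1$, $\mathbb{T}=\mathbb{R}/2\pi\mathbb{Z}$ and $s>d/2$. Consider the defocusing cubic nonlinear Schrödinger equation $$\left(i\partial_t+\tfrac12\partial_x^2+\tfrac12\Delta_y\right)u=|u|^2u,\qquad u(0)=u_0,\qquad (x,y)\in\mathbb{R}\times\mathbb{T}^d .$$ Here $\|f\|_{L^2_xH^s_y}^2=\sum_{k\in\mathbb{Z}^d}(1+|k|^2)^s\|f(\cdot,k)\|_{L^2_x}^2$ with $f(x,k)=(2\pi)^{-d/2}\int_{\mathbb{T}^d}f(x,y)e^{-i\langle k,y\rangle}\,dy$, and for a compact interval $I\ni 0$ put $\|u\|_{X(I)}=\sup_{t\in I}\|u(t)\|_{L^2_xH^s_y}+\|u\|_{L^4_t(I;L^\infty_{x,y})}$. A solution on $I$ with data $u_0$ is a function $u\in C(I;L^2_xH^s_y)\cap L^4_t(I;L^\infty_{x,y})$ with $$u(t)=U(t)u_0-i\int_0^tU(t-\tau)\left(|u|^2u\right)(\tau)\,d\tau\quad\text{in }L^2(\mathbb{R}\times\mathbb{T}^d)\text{ for all }t\in I,\qquad U(t)=e^{it\Delta_y/2}e^{it\partial_x^2/2}.$$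 Let $L_x=x+it\partial_x$, taken in the sense of distributions. The equation is locally well-posed for data $u_0\in L^2_xH^s_y$, hence also for data with in addition $xu_0\in L^2_{x,y}$ (that is, $u_0\in H^{0,1}_xL^2_y\cap L^2_xH^s_y$), in the following sense. 1. (Uniqueness) On any compact interval $I\ni 0$ two solutions with the same data $u_0 \in L^2$ coincide. 2. (Existence and continuous dependence) For every $R\ge 0$ there is $T=T(R)\in(0,1]$ such that, with $I=[-T,T]$: (a) every $u_0$ with $\|u_0\|_{L^2_xH^s_y}\le R$ has a solution $u\in C(I;L^2_xH^s_y)\cap L^4_t(I;L^\infty_{x,y})$ on $I$; (b) there is $C=C(R)$ such that solutions $u,v$ on $I$ with data $u_0,v_0$ of $L^2_xH^s_y$ norm at most $R$ satisfy $\|u-v\|_{X(I)}\le C\|u_0-v_0\|_{L^2_xH^s_y}$; (c) for every $M\ge 0$ there is $C=C(R,M)$ such that if moreover $\|xu_0\|_{L^2},\|xv_0\|_{L^2}\le M$, then $\|L_xu(t)-L_xv(t)\|_{L^2}\le C\left(\|u_0-v_0\|_{L^2_xH^s_y}+\|x(u_0-v_0)\|_{L^2}\right)$ for all $t\in I$.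 3. (Weighted data) If $u$ is a solution on a compact interval $I\ni 0$ with data $u_0$ and $xu_0\in L^2_{x,y}$, then $L_xu\in C(I;L^2_{x,y})$. (In 1–3, $T$ and the constants may also depend on $d$ and $s$.) -/

import Mathlib

open MeasureTheory Set Filter Topology
open scoped ENNReal NNReal FourierTransform ContDiff

noncomputable section

namespace ProductNLS

instance factTwoPiPos : Fact (0 < 2 * Real.pi) := ⟨Real.two_pi_pos⟩

/-- The torus `𝕋^d`, where `𝕋 = ℝ / 2πℤ`. -/
abbrev Torus (d : ℕ) : Type := Fin d → AddCircle (2 * Real.pi)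

/-- The spatial domain `ℝ × 𝕋^d`; its `volume` is `dx dy`, and `𝕋^d` has volume `(2π)^d`. -/
abbrev Space (d : ℕ) : Type := ℝ × Torus d

/-- The space `L²(ℝ × 𝕋^d)` of complex-valued functions. -/
abbrev L2 (d : ℕ) : Type := Lp ℂ 2 (volume : Measure (Space d))

/-- The character `y ↦ e^{i⟨k, y⟩}` of `𝕋^d`. -/
def char {d : ℕ} (k : Fin d → ℤ) (y : Torus d) : ℂ := ∏ i, fourier (k i) (y i)

/-- The Euclidean square `|k|²` of a frequency. -/
def sqAbs {d : ℕ} (k : Fin d → ℤ) : ℝ := ∑ i, (k i : ℝ) ^ 2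

/-- The factor `(2π)^{-d/2}`. -/
def normConst (d : ℕ) : ℝ := (2 * Real.pi) ^ (-(d : ℝ) / 2)

/-- The Fourier coefficient in `y`:
`f(x, k) = (2π)^{-d/2} ∫_{𝕋^d} f(x, y) e^{-i⟨k, y⟩} dy`. -/
def modeFun {d : ℕ} (f : Space d → ℂ) (k : Fin d → ℤ) (x : ℝ) : ℂ :=
  (normConst d : ℂ) * ∫ y : Torus d, f (x, y) * (starRingEnd ℂ) (char k y)

/-- The function `(x, y) ↦ (2π)^{-d/2} g(x) e^{i⟨k, y⟩}`. -/
def tensorFun {d : ℕ} (k : Fin d → ℤ) (g : ℝ → ℂ) (z : Space d) : ℂ :=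
  (normConst d : ℂ) * (g z.1 * char k z.2)

/-- The symbol `e^{-it(2πξ)²/2}` of `e^{it∂_x²/2}`, for the Fourier transform
`∫ e^{-2πi xξ} f(x) dx`. -/
def symbolX (t ξ : ℝ) : ℂ := Complex.exp (-(Complex.I * t * (2 * Real.pi * ξ) ^ 2 / 2))

theorem continuous_char {d : ℕ} (k : Fin d → ℤ) : Continuous (char k) := by
  unfold char; fun_prop

theorem norm_char {d : ℕ} (k : Fin d → ℤ) (y : Torus d) : ‖char k y‖ = 1 := by
  simp only [char, norm_prod, fourier_apply, Circle.norm_coe, Finset.prod_const_one]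

theorem continuous_symbolX (t : ℝ) : Continuous (symbolX t) := by
  unfold symbolX; fun_prop

theorem norm_symbolX (t ξ : ℝ) : ‖symbolX t ξ‖ = 1 := by
  have : symbolX t ξ = Complex.exp (((-(t * (2 * Real.pi * ξ) ^ 2 / 2) : ℝ) : ℂ) * Complex.I) := by
    unfold symbolX; congr 1; push_cast; ring
  rw [this, Complex.norm_exp_ofReal_mul_I]

theorem memLp_symbolX_mul (t : ℝ) (f : Lp ℂ 2 (volume : Measure ℝ)) :
    MemLp (fun ξ => symbolX t ξ * f ξ) 2 volume := by
  refine (Lp.memLp f).of_le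
    ((continuous_symbolX t).aestronglyMeasurable.mul (Lp.aestronglyMeasurable f)) ?_
  filter_upwards with ξ
  simp [norm_symbolX]

theorem memLp_tensorFun {d : ℕ} (k : Fin d → ℤ) (g : Lp ℂ 2 (volume : Measure ℝ)) :
    MemLp (tensorFun k g) 2 (volume : Measure (Space d)) := by
  have h1 : MemLp (fun z : Space d => g z.1) 2 volume :=
    (Lp.memLp g).comp_fst (volume : Measure (Torus d))
  have h2 : MemLp (fun z : Space d => g z.1 * char k z.2) 2 volume := by
    refine h1.of_le (h1.1.mul
      ((continuous_char k).comp continuous_snd).aestronglyMeasurable) ?_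
    filter_upwards with z
    simp [norm_char]
  exact h2.const_mul _

theorem memLp_modeFun {d : ℕ} (f : L2 d) (k : Fin d → ℤ) :
    MemLp (modeFun f k) 2 (volume : Measure ℝ) := by
  have hF : StronglyMeasurable (fun z : Space d => f z * (starRingEnd ℂ) (char k z.2)) :=
    (Lp.stronglyMeasurable f).mul
      (RCLike.continuous_conj.comp ((continuous_char k).comp continuous_snd)).stronglyMeasurable
  have hN : ∀ (x : ℝ) (y : Torus d),
      ‖f (x, y) * (starRingEnd ℂ) (char k y)‖ₑ = ‖f (x, y)‖ₑ := fun x y => by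
    rw [enorm_mul, RCLike.enorm_conj, ← ofReal_norm (char k y), norm_char]; simp
  refine MemLp.const_mul (f := fun x => ∫ y : Torus d, f (x, y) * (starRingEnd ℂ) (char k y))
    ⟨hF.integral_prod_right'.aestronglyMeasurable, ?_⟩ _
  have hf := (Lp.memLp f).2
  rw [eLpNorm_lt_top_iff_lintegral_rpow_enorm_lt_top two_ne_zero ENNReal.ofNat_ne_top] at hf ⊢
  simp only [ENNReal.toReal_ofNat, ENNReal.rpow_ofNat] at hf ⊢
  have hle : ∀ x : ℝ, ‖∫ y : Torus d, f (x, y) * (starRingEnd ℂ) (char k y)‖ₑ ^ 2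
      ≤ volume (univ : Set (Torus d)) * ∫⁻ y : Torus d, ‖f (x, y)‖ₑ ^ 2 := fun x => by
    have hs : AEStronglyMeasurable (fun y : Torus d => f (x, y)) volume :=
      ((Lp.stronglyMeasurable f).comp_measurable measurable_prodMk_left).aestronglyMeasurable
    have h1 : ‖∫ y : Torus d, f (x, y) * (starRingEnd ℂ) (char k y)‖ₑ
        ≤ eLpNorm (fun y : Torus d => f (x, y)) 1 volume := by
      rw [eLpNorm_one_eq_lintegral_enorm]
      refine (enorm_integral_le_lintegral_enorm _).trans_eq ?_
      simp_rw [hN]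
    have h2 := eLpNorm_le_eLpNorm_mul_rpow_measure_univ (p := 1) (q := 2)
      (by norm_num) hs
    have h3 : eLpNorm (fun y : Torus d => f (x, y)) 2 volume ^ 2
        = ∫⁻ y : Torus d, ‖f (x, y)‖ₑ ^ 2 := by
      have := eLpNorm_nnreal_pow_eq_lintegral (f := fun y : Torus d => f (x, y))
        (μ := volume) (p := 2) two_ne_zero
      simpa using this
    have h4 : (volume (univ : Set (Torus d)) ^
        (1 / (1 : ℝ≥0∞).toReal - 1 / (2 : ℝ≥0∞).toReal)) ^ 2
          = volume (univ : Set (Torus d)) := by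
      rw [← ENNReal.rpow_natCast, ← ENNReal.rpow_mul]; norm_num
    calc _ ≤ (eLpNorm (fun y : Torus d => f (x, y)) 2 volume *
          volume (univ : Set (Torus d)) ^
            (1 / (1 : ℝ≥0∞).toReal - 1 / (2 : ℝ≥0∞).toReal)) ^ 2 := by
          gcongr; exact h1.trans h2
      _ = _ := by rw [mul_pow, h3, h4, mul_comm]
  refine (lintegral_mono hle).trans_lt ?_
  rw [lintegral_const_mul' _ _ (measure_ne_top _ _)]
  refine ENNReal.mul_lt_top (measure_lt_top _ _) ?_
  have hm : AEMeasurable (fun z : Space d => ‖f z‖ₑ ^ 2) volume :=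
    (Lp.stronglyMeasurable f).enorm.aemeasurable.pow_const 2
  exact (lintegral_prod (μ := (volume : Measure ℝ)) (ν := (volume : Measure (Torus d)))
    _ hm).symm.trans_lt hf

/-- The Fourier coefficient `f(·, k)` of `f ∈ L²(ℝ × 𝕋^d)`, as an element of `L²(ℝ)`. -/
def mode {d : ℕ} (k : Fin d → ℤ) (f : L2 d) : Lp ℂ 2 (volume : Measure ℝ) :=
  (memLp_modeFun f k).toLp

/-- The function `(2π)^{-d/2} g(x) e^{i⟨k, y⟩}`, as an element of `L²(ℝ × 𝕋^d)`. -/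
def tensor {d : ℕ} (k : Fin d → ℤ) (g : Lp ℂ 2 (volume : Measure ℝ)) : L2 d :=
  (memLp_tensorFun k g).toLp

/-- The group `e^{it∂_x²/2}` on `L²(ℝ)`, as a Fourier multiplier. -/
def evolX (t : ℝ) (f : Lp ℂ 2 (volume : Measure ℝ)) : Lp ℂ 2 (volume : Measure ℝ) :=
  𝓕⁻ (memLp_symbolX_mul t (𝓕 f)).toLp

/-- The linear Schrödinger evolution `U(t) = e^{itΔ_y/2} e^{it∂_x²/2}` on `L²(ℝ × 𝕋^d)`:
`U(t) f = ∑_k e^{-it|k|²/2} (e^{it∂_x²/2} f(·, k))(x) (2π)^{-d/2} e^{i⟨k, y⟩}`,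
an orthogonal series that converges in `L²`. -/
def U {d : ℕ} (t : ℝ) (f : L2 d) : L2 d :=
  ∑' k : Fin d → ℤ,
    tensor k (Complex.exp (-(Complex.I * t * sqAbs k / 2)) • evolX t (mode k f))

open Classical in
/-- The nonlinearity `|f|² f` as an element of `L²` (set to `0` if it is not in `L²`; for
`f ∈ L² ∩ L^∞` it is). -/
def cubic {d : ℕ} (f : L2 d) : L2 d :=
  if h : MemLp (fun z => ((‖f z‖ ^ 2 : ℝ) : ℂ) * f z) 2 (volume : Measure (Space d))
  then h.toLp else 0

/-- The norm of `L²_x H^s_y`: `(∑_k (1 + |k|²)^s ‖f(·, k)‖²_{L²_x})^{1/2}`, possibly infinite. -/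
def hsNorm {d : ℕ} (s : ℝ) (f : L2 d) : ℝ≥0∞ :=
  (∑' k : Fin d → ℤ,
    ENNReal.ofReal ((1 + sqAbs k) ^ s) * eLpNorm (modeFun f k) 2 volume ^ 2) ^ (1 / 2 : ℝ)

/-- The norm `‖x f‖_{L²}`, possibly infinite. -/
def weightNorm {d : ℕ} (f : L2 d) : ℝ≥0∞ :=
  eLpNorm (fun z : Space d => (z.1 : ℂ) * f z) 2 volume

/-- The norm of `L⁴_t(I; L^∞_{x,y})`, possibly infinite. -/
def l4LinftyNorm {d : ℕ} (I : Set ℝ) (u : ℝ → L2 d) : ℝ≥0∞ :=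
  (∫⁻ t in I, eLpNorm (u t) ⊤ volume ^ 4) ^ (1 / 4 : ℝ)

/-- The norm of `X(I) = L^∞_t(I; L²_x H^s_y) ∩ L⁴_t(I; L^∞_{x,y})`. -/
def xNorm {d : ℕ} (s : ℝ) (I : Set ℝ) (u : ℝ → L2 d) : ℝ≥0∞ :=
  (⨆ t ∈ I, hsNorm s (u t)) + l4LinftyNorm I u

/-- `u` is a solution on the time interval `[a, b] ∋ 0`, in the class
`C([a, b]; L²_x H^s_y) ∩ L⁴([a, b]; L^∞_{x,y})`, of
`(i∂_t + ½∂_x² + ½Δ_y) u = |u|² u`, `u(0) = u₀`, in the sense of Duhamel's formula.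
For `u` in this class, `|u|² u` is in `L¹([a, b]; L²)`, so the Bochner integral converges. -/
structure IsSolution {d : ℕ} (s a b : ℝ) (u₀ : L2 d) (u : ℝ → L2 d) : Prop where
  hs_finite : ∀ t ∈ Icc a b, hsNorm s (u t) < ⊤
  hs_continuous : ∀ t ∈ Icc a b,
    Tendsto (fun τ => hsNorm s (u τ - u t)) (𝓝[Icc a b] t) (𝓝 0)
  l4Linfty_finite : l4LinftyNorm (Icc a b) u < ⊤
  duhamel : ∀ t ∈ Icc a b,
    u t = U t u₀ - Complex.I • ∫ τ in (0 : ℝ)..t, U (t - τ) (cubic (u τ))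

/-- Test functions: `φ ∈ C_c^∞(ℝ × 𝕋^d)`; smoothness is that of the lift to `ℝ × ℝ^d`. -/
def IsTest {d : ℕ} (φ : Space d → ℂ) : Prop :=
  ContDiff ℝ ∞ (fun p : ℝ × (Fin d → ℝ) =>
    φ (p.1, fun i => (p.2 i : AddCircle (2 * Real.pi)))) ∧ HasCompactSupport φ

/-- `g = L_x f` in the sense of distributions, where `L_x = x + it∂_x` at time `t`. -/
def IsLx {d : ℕ} (t : ℝ) (f g : L2 d) : Prop :=
  ∀ φ : Space d → ℂ, IsTest φ →
    ∫ z, g z * φ z =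
      ∫ z, f z * ((z.1 : ℂ) * φ z - Complex.I * t * deriv (fun x : ℝ => φ (x, z.2)) z.1)

end ProductNLS

end

open ProductNLS

open MeasureTheory Set Filter Topology
open scoped ENNReal NNReal FourierTransform ContDiff

noncomputable section

namespace ProductNLS

/-! ### The essential supremum as a countable supremum of pairings -/

section

section SupNorm

variable {α : Type*} [MeasurableSpace α] {μ : Measure α}

/-! Existence is a contraction argument in a space finer than X(I). The Fourier coefficients u_k(t,
x) in y are kept apart, and the norm `zN` is the ℓ² norm with weight (1+|k|²)^s of sup_t
‖u_k(t)‖_{L²_x} + ‖u_k‖_{L⁴_t L^∞_x}. On each mode U(t) is a unimodular phase times the free group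
of the line, so no dispersion on the torus is needed: the one-dimensional endpoint Strichartz
estimate `lintegral_eLpNorm_evolX_le` gives the linear bounds `zN_U_le` and `zN_duh_le`. It is
obtained by the TT* method from the |t|^{-1/2} dispersive bound and the Hardy–Littlewood–Sobolev
inequality, after the supremum in x has been linearised by a measurable choice of test functions.

For s > d/2 the weighted ℓ² space is a convolution algebra (`ell_conv_le`). Placing one factor of
the cubic term in L^∞_t L²_x and two in L⁴_t L^∞_x, Hölder leaves a factor |I|^{1/2}
(`ell_lintegral_triB_le`). The Duhamel map therefore contracts a ball of the `zN` space on a short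
interval whose length depends on R, which gives `exists_sol`; the embedding of this space into X(I)
costs one Cauchy–Schwarz in k.

Uniqueness needs much less: for curves in C(I; L²) ∩ L⁴(I; L^∞) the L² norm of |u|²u − |v|²v is at
most 3 max(‖u‖_∞, ‖v‖_∞)² ‖u − v‖, the coefficient is integrable in time, and `gronwall` applies
(`Sol.eq`). Consequently every solution on the short interval is the Picard solution and inherits
its `zN` bound, so the contraction estimate also gives Lipschitz dependence.

For the weight, i L_x is the generator at h = 0 of the Galilei transformations G_h f = e^{i(hx −
h²t/2)} f(x − ht, y). These commute with the equation (`Sol.gal`), so G_h u is the solution with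
data e^{ihx} u₀, and the L² Gronwall bound controls (G_h u − u)/(ih) by ‖x u₀‖ uniformly in h. Weak
limits along one fixed ultrafilter exist and equal L_x u in the sense of distributions
(`isLx_of_weak_limit`). Norm bounds survive weak limits: the bound for the difference of the
quotients of two solutions gives the weighted Lipschitz estimate, and the bound for time increments
in the interaction picture gives continuity of L_x u. Neither differentiation of the nonlinearity
nor regularisation of the data occurs. -/

theorem enorm_inner_le_eLpNorm (g f : Lp ℂ 2 μ) :
    ‖inner ℂ g f‖ₑ ≤ eLpNorm g 1 μ * eLpNorm f ⊤ μ := by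
  rw [L2.inner_def, eLpNorm_one_eq_lintegral_enorm, eLpNorm_exponent_top]
  refine (enorm_integral_le_lintegral_enorm _).trans ?_
  rw [← lintegral_mul_const'' _ (Lp.aestronglyMeasurable g).enorm]
  refine lintegral_mono_ae ?_
  filter_upwards [ae_le_eLpNormEssSup (f := f) (μ := μ)] with x hx
  rw [RCLike.inner_apply, enorm_mul, RCLike.enorm_conj, mul_comm]
  gcongr

/-- Pair f with its own phase, averaged over a set of positive finite measure on which |f| exceeds a
number larger than c. Sigma-finiteness supplies the finite measure, which keeps the test function in
L². -/
theorem exists_lt_enorm_inner [SigmaFinite μ] (f : Lp ℂ 2 μ) {c : ℝ≥0∞}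
    (hc : c < eLpNorm f ⊤ μ) :
    ∃ g : Lp ℂ 2 μ, eLpNorm g 1 μ ≤ 1 ∧ c < ‖inner ℂ g f‖ₑ := by
  obtain ⟨b, hcb, hb⟩ := exists_between hc
  have hfm := (Lp.stronglyMeasurable f).measurable
  set A : Set α := {x | b < ‖f x‖ₑ} with hA
  have hAm : MeasurableSet A := measurableSet_lt measurable_const hfm.enorm
  have hApos : 0 < μ A := by
    rw [pos_iff_ne_zero]
    intro h0
    have : ∀ᵐ x ∂μ, ‖f x‖ₑ ≤ b := by
      rw [ae_iff]; simpa [hA] using h0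
    exact absurd hb (not_lt.2 (eLpNormEssSup_le_of_ae_enorm_bound this))
  obtain ⟨B, hBm, hBA, hBpos, hBfin⟩ := Measure.exists_subset_measure_lt_top hAm hApos
  have hfB : ∀ x ∈ B, f x ≠ 0 := fun x hx h0 => by
    have := hBA hx
    simp [hA, h0] at this
  set m : ℝ := (μ B).toReal with hm
  have hmpos : 0 < m := ENNReal.toReal_pos hBpos.ne' hBfin.ne
  set g0 : α → ℂ := B.indicator (fun x => f x / ‖f x‖ / m) with hg0
  have hg0n : ∀ x, ‖g0 x‖ₑ = B.indicator (fun _ => (μ B)⁻¹) x := fun x => by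
    by_cases hx : x ∈ B
    · simp only [hg0, indicator_of_mem hx]
      rw [← ofReal_norm, norm_div, norm_div, Complex.norm_real, Complex.norm_real, norm_norm,
        div_self (norm_ne_zero_iff.2 (hfB x hx)), Real.norm_of_nonneg hmpos.le, one_div,
        ENNReal.ofReal_inv_of_pos hmpos, hm, ENNReal.ofReal_toReal hBfin.ne]
    · simp [hg0, indicator_of_notMem hx]
  have hmem : MemLp g0 2 μ := by
    have : IsFiniteMeasure (μ.restrict B) := ⟨by simpa using hBfin⟩
    rw [hg0, memLp_indicator_iff_restrict hBm]
    refine MemLp.of_bound ((hfm.div (Complex.measurable_ofReal.comp hfm.norm)).div_const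
      _).aestronglyMeasurable (1 / m) (Eventually.of_forall fun x => ?_)
    rw [norm_div, norm_div, Complex.norm_real, Complex.norm_real, norm_norm,
      Real.norm_of_nonneg hmpos.le]
    gcongr
    exact div_self_le_one _
  refine ⟨hmem.toLp, ?_, hcb.trans_le ?_⟩
  · rw [eLpNorm_congr_ae hmem.coeFn_toLp, eLpNorm_one_eq_lintegral_enorm]
    simp_rw [hg0n]
    rw [lintegral_indicator hBm, setLIntegral_const, ENNReal.inv_mul_cancel hBpos.ne' hBfin.ne]
  · have h1 : inner ℂ hmem.toLp f = ((∫ x in B, ‖f x‖ / m ∂μ : ℝ) : ℂ) := by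
      rw [L2.inner_def, ← integral_complex_ofReal, ← integral_indicator hBm]
      refine integral_congr_ae ?_
      filter_upwards [hmem.coeFn_toLp] with x hx
      rw [hx, RCLike.inner_apply]
      by_cases hxB : x ∈ B
      · simp only [hg0, indicator_of_mem hxB, map_div₀, Complex.conj_ofReal]
        have h2 : f x * (starRingEnd ℂ) (f x) = (‖f x‖ : ℂ) ^ 2 := Complex.mul_conj' _
        have h3 : (‖f x‖ : ℂ) ≠ 0 := by simpa using hfB x hxB
        rw [Complex.ofReal_div, ← mul_div_assoc, ← mul_div_assoc, h2]
        field_simp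
      · simp [hg0, indicator_of_notMem hxB]
    have hint : IntegrableOn (fun x => ‖f x‖ / m) B μ :=
      by
      have : IsFiniteMeasure (μ.restrict B) := ⟨by simpa using hBfin⟩
      exact ((((Lp.memLp f).restrict B).integrable (by norm_num)).norm).div_const _
    rw [h1, ← ofReal_norm, Complex.norm_real, Real.norm_of_nonneg (by positivity),
      ofReal_integral_eq_lintegral_ofReal hint (Eventually.of_forall fun x => by positivity)]
    calc b = ∫⁻ x in B, b / μ B ∂μ := by
          rw [setLIntegral_const, ENNReal.div_mul_cancel hBpos.ne' hBfin.ne]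
      _ ≤ _ := by
          refine setLIntegral_mono' hBm fun x hx => ?_
          rw [ENNReal.ofReal_div_of_pos hmpos, hm, ENNReal.ofReal_toReal hBfin.ne, ofReal_norm]
          gcongr
          exact (hBA hx).le

/-- A dense sequence in the L¹ unit ball inside L² suffices because the pairing is L²-continuous.
Countability is the point: it makes the sup norm a measurable and lower semicontinuous function on
L², although L^∞ itself is not separable. -/
theorem exists_seq_eLpNorm_top_eq [SigmaFinite μ] [TopologicalSpace.SeparableSpace (Lp ℂ 2 μ)] :
    ∃ g : ℕ → Lp ℂ 2 μ, (∀ n, eLpNorm (g n) 1 μ ≤ 1) ∧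
      ∀ f : Lp ℂ 2 μ, eLpNorm f ⊤ μ = ⨆ n, ‖inner ℂ (g n) f‖ₑ := by
  let S : Set (Lp ℂ 2 μ) := {g | eLpNorm g 1 μ ≤ 1}
  have h0 : (0 : Lp ℂ 2 μ) ∈ S := by
    simp only [S, mem_ofPred_eq]
    rw [eLpNorm_congr_ae (Lp.coeFn_zero ℂ 2 μ)]; simp
  have : Nonempty S := ⟨⟨0, h0⟩⟩
  obtain ⟨e, he⟩ := TopologicalSpace.exists_dense_seq S
  refine ⟨fun n => e n, fun n => (e n).2, fun f => le_antisymm ?_ ?_⟩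
  · refine le_of_forall_lt fun c hc => ?_
    obtain ⟨g, hg, hgc⟩ := exists_lt_enorm_inner f hc
    have hopen : IsOpen {q : S | c < ‖inner ℂ (q : Lp ℂ 2 μ) f‖ₑ} :=
      isOpen_lt continuous_const (by fun_prop)
    obtain ⟨q, hq, n, rfl⟩ := he.inter_open_nonempty _ hopen ⟨⟨g, hg⟩, hgc⟩
    exact lt_of_lt_of_le hq (le_iSup (fun n => ‖inner ℂ (e n : Lp ℂ 2 μ) f‖ₑ) n)
  · refine iSup_le fun n => (enorm_inner_le_eLpNorm _ _).trans ?_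
    calc _ ≤ 1 * eLpNorm f ⊤ μ := by gcongr; exact (e n).2
      _ = _ := one_mul _

end SupNorm

end

/-! ### The Fourier transform on L¹ ∩ L² and the Gaussian-regularised dispersive bound -/

section

theorem integral_fourier_mul_eq {f g : ℝ → ℂ} (hf : Integrable f) (hg : Integrable g) :
    ∫ ξ, 𝓕 f ξ * g ξ = ∫ x, f x * 𝓕 g x := by
  have := VectorFourier.integral_fourierIntegral_smul_eq_flip (L := innerₗ ℝ)
    Real.continuous_fourierChar (continuous_inner (𝕜 := ℝ) (E := ℝ)) hf hg
  simpa only [flip_innerₗ, smul_eq_mul] using! this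

theorem norm_fourier_le {f : ℝ → ℂ} (ξ : ℝ) : ‖𝓕 f ξ‖ ≤ ∫ x, ‖f x‖ := by
  rw [Real.fourier_eq]
  refine (norm_integral_le_integral_norm _).trans ?_
  simp_rw [Circle.norm_smul]
  exact le_rfl

theorem continuous_fourier {f : ℝ → ℂ} (hf : Integrable f) : Continuous (𝓕 f) :=
  VectorFourier.fourierIntegral_continuous Real.continuous_fourierChar
    (continuous_inner (𝕜 := ℝ) (E := ℝ)) hf

/-- On `L¹ ∩ L²` the Fourier transform of `L²` is given by the Fourier integral. -/
theorem fourier_ae_eq_of_integrable (f : Lp ℂ 2 (volume : Measure ℝ)) (hf : Integrable f) :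
    (𝓕 f : Lp ℂ 2 (volume : Measure ℝ)) =ᵐ[volume] 𝓕 (f : ℝ → ℂ) := by
  -- Both sides are tested against C_c^∞ functions. The L² transform moves onto the test function
  -- through tempered distributions, the integral transform through Fubini.
  refine ae_eq_of_integral_contDiff_smul_eq
    ((Lp.memLp _).locallyIntegrable (by norm_num))
    (continuous_fourier hf).locallyIntegrable fun g hg hgs => ?_
  have hg' : ContDiff ℝ ∞ (fun x => (g x : ℂ)) := Complex.ofRealCLM.contDiff.comp hg
  have hgs' : HasCompactSupport (fun x => (g x : ℂ)) :=
    hgs.comp_left (g := fun x : ℝ => (x : ℂ)) Complex.ofReal_zero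
  let G : SchwartzMap ℝ ℂ := hgs'.toSchwartzMap hg'
  have hG : ∀ x, G x = (g x : ℂ) := fun x => rfl
  have h := DFunLike.congr_fun (Lp.fourier_toTemperedDistribution_eq f) G
  rw [TemperedDistribution.fourier_apply, Lp.toTemperedDistribution_apply,
    Lp.toTemperedDistribution_apply] at h
  have h2 := integral_fourier_mul_eq (f := G) G.integrable hf
  simp only [smul_eq_mul, hG] at h h2
  simp only [Complex.real_smul]
  rw [← h, ← h2]
  rfl

theorem norm_exp_gaussian_le {b : ℂ} (hb : 0 < b.re) (x : ℝ) :
    ‖Complex.exp (-Real.pi / b * (x : ℂ) ^ 2)‖ ≤ 1 := by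
  rw [Complex.norm_exp, Real.exp_le_one_iff]
  have : (-Real.pi / b * (x : ℂ) ^ 2).re = -(Real.pi * x ^ 2 * (b⁻¹).re) := by
    rw [div_eq_mul_inv, ← Complex.ofReal_pow, Complex.re_mul_ofReal, ← Complex.ofReal_neg,
      Complex.re_ofReal_mul]; ring
  rw [this, Complex.inv_re]
  have : 0 ≤ b.re / Complex.normSq b := div_nonneg hb.le (Complex.normSq_nonneg _)
  have := Real.pi_pos
  simp only [Left.neg_nonpos_iff]
  positivity

/-- Moving the Fourier transforms off f and g leaves the transform of the Gaussian e^{-πbξ²} as a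
convolution kernel. It is bounded by |b|^{-1/2} as long as Re b > 0, uniformly down to the imaginary
axis. -/
theorem norm_integral_gaussian_mul_le {b : ℂ} (hb : 0 < b.re) {f g : ℝ → ℂ}
    (hf : Integrable f) (hg : Integrable g) :
    ‖∫ ξ : ℝ, (starRingEnd ℂ) (𝓕 g ξ) * (Complex.exp (-Real.pi * b * ξ ^ 2) * 𝓕 f ξ)‖ ≤
      ‖b‖ ^ (-(1 / 2) : ℝ) * (∫ x, ‖f x‖) * ∫ x, ‖g x‖ := by
  have hb0 : b ≠ 0 := by rintro rfl; simp at hb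
  -- Reflection and conjugation turn the conjugate of the transform of g into a genuine Fourier
  -- transform, so that it can be moved as well.
  set g' : ℝ → ℂ := fun y => (starRingEnd ℂ) (g (-y)) with hg'
  have hg'i : Integrable g' := by
    have := hg.comp_neg
    refine (integrable_norm_iff ?_).1 (by simpa [hg'] using this.norm)
    exact RCLike.continuous_conj.comp_aestronglyMeasurable this.aestronglyMeasurable
  have hconj : ∀ ξ, (starRingEnd ℂ) (𝓕 g ξ) = 𝓕 g' ξ := fun ξ => by
    rw [Real.fourier_real_eq_integral_exp_smul, Real.fourier_real_eq_integral_exp_smul,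
      ← integral_conj, ← integral_neg_eq_self]
    refine integral_congr_ae (Eventually.of_forall fun y => ?_)
    simp only [smul_eq_mul, map_mul, hg', ← Complex.exp_conj, Complex.conj_ofReal, Complex.conj_I]
    congr 2
    push_cast; ring
  have hK : ∀ x : ℝ, Integrable fun ξ : ℝ =>
      Complex.exp (-Real.pi * b * ξ ^ 2 + 2 * Real.pi * (-(Complex.I * x)) * ξ) := fun x => by
    have := integrable_cexp_quadratic (b := Real.pi * b)
      (by rw [Complex.re_ofReal_mul]; exact mul_pos Real.pi_pos hb)
      (2 * Real.pi * (-(Complex.I * x))) 0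
    simpa using this
  have hK0 : Integrable fun ξ : ℝ => Complex.exp (-Real.pi * b * ξ ^ 2) := by simpa using hK 0
  have hH : Integrable fun ξ : ℝ => Complex.exp (-Real.pi * b * ξ ^ 2) * 𝓕 g' ξ :=
    hK0.mul_bdd (continuous_fourier hg'i).aestronglyMeasurable
      (Eventually.of_forall fun ξ => norm_fourier_le ξ)
  have hgn : ∫ x, ‖g' x‖ = ∫ x, ‖g x‖ := by
    simp only [hg', RCLike.norm_conj]
    exact integral_neg_eq_self (fun x => ‖g x‖) volume
  have hFH : ∀ x, ‖𝓕 (fun ξ : ℝ => Complex.exp (-Real.pi * b * ξ ^ 2) * 𝓕 g' ξ) x‖ ≤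
      ‖b‖ ^ (-(1 / 2) : ℝ) * ∫ y, ‖g y‖ := fun x => by
    have h1 : 𝓕 (fun ξ : ℝ => Complex.exp (-Real.pi * b * ξ ^ 2) * 𝓕 g' ξ) x =
        ∫ y, g' y * 𝓕 (fun ξ : ℝ =>
          Complex.exp (-Real.pi * b * ξ ^ 2 + 2 * Real.pi * (-(Complex.I * x)) * ξ)) y := by
      rw [← integral_fourier_mul_eq hg'i (hK x), Real.fourier_real_eq_integral_exp_smul]
      refine integral_congr_ae (Eventually.of_forall fun ξ => ?_)
      simp only [smul_eq_mul]
      have h0 : Complex.exp (((-2 * Real.pi * ξ * x : ℝ) : ℂ) * Complex.I) =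
          Complex.exp (2 * Real.pi * (-(Complex.I * x)) * ξ) := by
        congr 1; push_cast; ring
      rw [Complex.exp_add, h0]
      ring
    rw [h1, fourier_gaussian_pi' hb]
    refine (norm_integral_le_integral_norm _).trans ?_
    rw [← hgn, ← integral_const_mul]
    refine integral_mono_of_nonneg (Eventually.of_forall fun _ => norm_nonneg _)
      (hg'i.norm.const_mul _) (Eventually.of_forall fun y => ?_)
    have h2 : (y : ℂ) + Complex.I * -(Complex.I * x) = ((y + x : ℝ) : ℂ) := by
      push_cast; ring_nf; simp
    simp only [norm_mul, h2]
    rw [mul_comm]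
    gcongr
    calc _ ≤ ‖(1 / b ^ (1 / 2 : ℂ))‖ * 1 := by gcongr; exact norm_exp_gaussian_le hb _
      _ = _ := by
        rw [mul_one, norm_div, norm_one, Complex.norm_cpow_of_ne_zero hb0]
        simp [Real.rpow_neg]
  simp_rw [hconj]
  have h3 : ∫ ξ : ℝ, 𝓕 g' ξ * (Complex.exp (-Real.pi * b * ξ ^ 2) * 𝓕 f ξ) =
      ∫ x, f x * 𝓕 (fun ξ : ℝ => Complex.exp (-Real.pi * b * ξ ^ 2) * 𝓕 g' ξ) x := by
    rw [← integral_fourier_mul_eq hf hH]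
    refine integral_congr_ae (Eventually.of_forall fun ξ => ?_)
    simp only; ring
  rw [h3]
  refine (norm_integral_le_integral_norm _).trans ?_
  rw [mul_right_comm, mul_comm (_ * _) (∫ x, ‖f x‖), ← integral_mul_const]
  refine integral_mono_of_nonneg (Eventually.of_forall fun _ => norm_nonneg _)
      (hf.norm.mul_const _) (Eventually.of_forall fun y => ?_)
  simp only [norm_mul]
  gcongr
  exact hFH y

end

/-! ### The free Schrödinger group on the line -/

section

theorem eLpNorm_two_sq {α : Type*} [MeasurableSpace α] {μ : Measure α} (f : α → ℂ) :
    eLpNorm f 2 μ ^ 2 = ∫⁻ x, ‖f x‖ₑ ^ 2 ∂μ := by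
  simpa using eLpNorm_nnreal_pow_eq_lintegral (f := f) (μ := μ) (p := 2) two_ne_zero

theorem tendsto_eLpNorm_mul_sub {α ι : Type*} [MeasurableSpace α] {μ : Measure α} {l : Filter ι}
    [l.IsCountablyGenerated] {m : ι → α → ℂ} {m₀ : α → ℂ} (f : Lp ℂ 2 μ)
    (hm : ∀ i, AEStronglyMeasurable (m i) μ) (hm₀ : AEStronglyMeasurable m₀ μ)
    (hb : ∀ i x, ‖m i x‖ ≤ 1) (hb₀ : ∀ x, ‖m₀ x‖ ≤ 1)
    (hlim : ∀ x, Tendsto (fun i => m i x) l (𝓝 (m₀ x))) :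
    Tendsto (fun i => eLpNorm (fun x => m i x * f x - m₀ x * f x) 2 μ) l (𝓝 0) := by
  have key : Tendsto (fun i => eLpNorm (fun x => m i x * f x - m₀ x * f x) 2 μ ^ 2) l (𝓝 0) := by
    simp_rw [eLpNorm_two_sq]
    rw [← lintegral_zero (μ := μ)]
    refine tendsto_lintegral_filter_of_dominated_convergence' (fun x => 4 * ‖f x‖ₑ ^ 2)
      (Eventually.of_forall fun i => ?_) (Eventually.of_forall fun i =>
        Eventually.of_forall fun x => ?_) ?_ (Eventually.of_forall fun x => ?_)
    · exact (((hm i).mul (Lp.aestronglyMeasurable f)).sub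
        (hm₀.mul (Lp.aestronglyMeasurable f))).enorm.pow_const 2
    · rw [← sub_mul, enorm_mul, mul_pow]
      gcongr
      have : ‖m i x - m₀ x‖ₑ ≤ 2 := by
        rw [← ofReal_norm, ENNReal.ofReal_le_iff_le_toReal (by simp)]
        exact (norm_sub_le _ _).trans (by simpa using! (by linarith [hb i x, hb₀ x]))
      calc _ ≤ (2 : ℝ≥0∞) ^ 2 := by gcongr
        _ = 4 := by norm_num
    · rw [lintegral_const_mul' _ _ (by simp), ← eLpNorm_two_sq]
      exact ENNReal.mul_ne_top (by simp) (ENNReal.pow_ne_top (Lp.memLp f).2.ne)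
    · have h1 : Tendsto (fun i => m i x * f x - m₀ x * f x) l (𝓝 0) := by
        simpa using ((hlim x).mul_const (f x)).sub_const (m₀ x * f x)
      have h2 := (ENNReal.continuous_pow 2).tendsto (0 : ℝ≥0∞) |>.comp
        (by simpa using h1.enorm : Tendsto (fun i => ‖m i x * f x - m₀ x * f x‖ₑ) l (𝓝 0))
      simpa [Function.comp_def] using h2
  have h3 := (ENNReal.continuous_rpow_const (y := 1 / 2)).tendsto 0 |>.comp key
  refine (h3.congr fun i => ?_).trans (by simp)
  rw [Function.comp_apply, ← ENNReal.rpow_natCast, ← ENNReal.rpow_mul]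
  norm_num

/-- The space `L²(ℝ)`. -/
abbrev LX : Type := Lp ℂ 2 (volume : Measure ℝ)

theorem fourier_evolX (t : ℝ) (f : LX) :
    𝓕 (evolX t f) = (memLp_symbolX_mul t (𝓕 f)).toLp :=
  FourierTransform.fourier_fourierInv_eq _

theorem fourier_evolX_ae (t : ℝ) (f : LX) :
    (𝓕 (evolX t f) : LX) =ᵐ[volume] fun ξ => symbolX t ξ * (𝓕 f : LX) ξ := by
  rw [fourier_evolX]
  exact MemLp.coeFn_toLp _

theorem fourier_LX_injective {f g : LX} (h : (𝓕 f : LX) = 𝓕 g) : f = g :=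
  (Lp.fourierTransformₗᵢ ℝ ℂ).injective h

theorem evolX_add (t : ℝ) (f g : LX) : evolX t (f + g) = evolX t f + evolX t g := by
  apply fourier_LX_injective
  rw [FourierTransform.fourier_add]
  refine Lp.ext ?_
  filter_upwards [fourier_evolX_ae t f, fourier_evolX_ae t g, fourier_evolX_ae t (f + g),
    Lp.coeFn_add (𝓕 (evolX t f) : LX) (𝓕 (evolX t g)), Lp.coeFn_add (𝓕 f : LX) (𝓕 g)]
    with ξ h1 h2 h3 h4 h5
  rw [h3, h4, Pi.add_apply, h1, h2, FourierTransform.fourier_add, h5, Pi.add_apply, mul_add]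

theorem evolX_smul (t : ℝ) (c : ℂ) (f : LX) : evolX t (c • f) = c • evolX t f := by
  apply fourier_LX_injective
  rw [FourierTransform.fourier_smul]
  refine Lp.ext ?_
  filter_upwards [fourier_evolX_ae t f, fourier_evolX_ae t (c • f),
    Lp.coeFn_smul c (𝓕 (evolX t f) : LX), Lp.coeFn_smul c (𝓕 f : LX)]
    with ξ h1 h3 h4 h5
  rw [h3, h4, Pi.smul_apply, h1, FourierTransform.fourier_smul, h5, Pi.smul_apply, smul_eq_mul,
    smul_eq_mul, mul_left_comm]

theorem norm_evolX (t : ℝ) (f : LX) : ‖evolX t f‖ = ‖f‖ := by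
  rw [← Lp.norm_fourier_eq (evolX t f), ← Lp.norm_fourier_eq f, Lp.norm_def, Lp.norm_def]
  congr 1
  refine eLpNorm_congr_norm_ae ?_
  filter_upwards [fourier_evolX_ae t f] with ξ h
  rw [h, norm_mul, norm_symbolX, one_mul]

/-- The group `e^{it∂_x²/2}` as a linear isometry. -/
def evolXL (t : ℝ) : LX →ₗᵢ[ℂ] LX where
  toFun := evolX t
  map_add' := evolX_add t
  map_smul' := evolX_smul t
  norm_map' := norm_evolX t

theorem evolXL_apply (t : ℝ) (f : LX) : evolXL t f = evolX t f := rfl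

theorem symbolX_add (s t ξ : ℝ) : symbolX (s + t) ξ = symbolX s ξ * symbolX t ξ := by
  unfold symbolX
  rw [← Complex.exp_add]
  congr 1; push_cast; ring

theorem evolX_evolX (s t : ℝ) (f : LX) : evolX s (evolX t f) = evolX (s + t) f := by
  apply fourier_LX_injective
  refine Lp.ext ?_
  filter_upwards [fourier_evolX_ae t f, fourier_evolX_ae s (evolX t f),
    fourier_evolX_ae (s + t) f] with ξ h1 h2 h3
  rw [h2, h1, h3, symbolX_add, mul_assoc]

theorem evolX_zero (f : LX) : evolX 0 f = f := by
  apply fourier_LX_injective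
  refine Lp.ext ?_
  filter_upwards [fourier_evolX_ae 0 f] with ξ h1
  rw [h1]
  simp [symbolX]

theorem inner_evolX_left (t : ℝ) (f g : LX) :
    inner ℂ (evolX t f) g = inner ℂ f (evolX (-t) g) := by
  have := (evolXL (-t)).inner_map_map (evolX t f) g
  rw [evolXL_apply, evolXL_apply, evolX_evolX, neg_add_cancel, evolX_zero] at this
  exact this.symm

theorem continuous_evolX (f : LX) : Continuous fun t => evolX t f := by
  have h : Continuous fun t => (𝓕 (evolX t f) : LX) := by
    rw [continuous_iff_continuousAt]
    intro t₀
    rw [ContinuousAt, Lp.tendsto_Lp_iff_tendsto_eLpNorm']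
    refine (tendsto_eLpNorm_mul_sub (l := 𝓝 t₀) (m := fun t ξ => symbolX t ξ)
      (m₀ := symbolX t₀) (𝓕 f : LX)
      (fun t => (continuous_symbolX t).aestronglyMeasurable)
      (continuous_symbolX t₀).aestronglyMeasurable
      (fun t ξ => (norm_symbolX t ξ).le) (fun ξ => (norm_symbolX t₀ ξ).le)
      (fun ξ => ?_)).congr fun t => ?_
    · exact Continuous.tendsto (by unfold symbolX; fun_prop) t₀
    · refine eLpNorm_congr_ae ?_
      filter_upwards [fourier_evolX_ae t f, fourier_evolX_ae t₀ f] with ξ h1 h2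
      rw [Pi.sub_apply, h1, h2]
  have := (Lp.fourierTransformₗᵢ ℝ ℂ).symm.continuous.comp h
  refine this.congr fun t => ?_
  exact (Lp.fourierTransformₗᵢ ℝ ℂ).symm_apply_apply _

/-- Strong continuity in t together with the isometry property gives joint continuity, which is what
measurability of Duhamel integrands requires. -/
theorem continuous_evolX_uncurry : Continuous fun p : ℝ × LX => evolX p.1 p.2 := by
  rw [continuous_iff_continuousAt]
  rintro ⟨t₀, f₀⟩
  rw [ContinuousAt, tendsto_iff_norm_sub_tendsto_zero]
  have h1 : Tendsto (fun p : ℝ × LX => ‖p.2 - f₀‖ + ‖evolX p.1 f₀ - evolX t₀ f₀‖)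
      (𝓝 (t₀, f₀)) (𝓝 0) := by
    have : Continuous fun p : ℝ × LX => ‖p.2 - f₀‖ + ‖evolX p.1 f₀ - evolX t₀ f₀‖ := by
      have := (continuous_evolX f₀).comp (continuous_fst (X := ℝ) (Y := LX))
      simp only [Function.comp_def] at this
      fun_prop
    simpa using this.tendsto (t₀, f₀)
  refine squeeze_zero (fun _ => norm_nonneg _) (fun p => ?_) h1
  rw [← norm_evolX p.1 (p.2 - f₀), ← evolXL_apply p.1 (p.2 - f₀), map_sub, evolXL_apply,
    evolXL_apply]
  exact norm_sub_le_norm_sub_add_norm_sub _ _ _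

/-- The dispersive estimate `‖e^{it∂_x²/2}‖_{L¹ → L^∞} ≤ (2π|t|)^{-1/2}`, in bilinear form. -/
theorem norm_inner_evolX_le {t : ℝ} (ht : t ≠ 0) {f g : LX} (hf : Integrable f)
    (hg : Integrable g) :
    ‖inner ℂ g (evolX t f)‖ ≤ (2 * Real.pi * |t|) ^ (-(1 / 2) : ℝ) *
      (∫ x, ‖f x‖) * ∫ x, ‖g x‖ := by
  have h1 : inner ℂ g (evolX t f) =
      ∫ ξ, (starRingEnd ℂ) ((𝓕 (g : ℝ → ℂ)) ξ) * (symbolX t ξ * (𝓕 (f : ℝ → ℂ)) ξ) := by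
    rw [← Lp.inner_fourier_eq, L2.inner_def]
    refine integral_congr_ae ?_
    filter_upwards [fourier_evolX_ae t f, fourier_ae_eq_of_integrable f hf,
      fourier_ae_eq_of_integrable g hg] with ξ h1 h2 h3
    rw [RCLike.inner_apply, h1, h2, h3, mul_comm]
  have hint : Integrable fun ξ => ‖(𝓕 (g : ℝ → ℂ)) ξ‖ * ‖(𝓕 (f : ℝ → ℂ)) ξ‖ := by
    have hF := (memLp_congr_ae (fourier_ae_eq_of_integrable f hf)).1 (Lp.memLp (𝓕 f : LX))
    have hG := (memLp_congr_ae (fourier_ae_eq_of_integrable g hg)).1 (Lp.memLp (𝓕 g : LX))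
    exact hG.norm.integrable_mul hF.norm
  have hpi := Real.pi_pos
  -- With this choice e^{-πbξ²} is the symbol damped by e^{-2π²εξ²}. The modulus of b stays above
  -- 2π|t|, so the Gaussian bound survives the limit ε → 0+.
  let b : ℝ → ℂ := fun ε => 2 * Real.pi * (ε + Complex.I * t)
  have hbre : ∀ ε, (b ε).re = 2 * Real.pi * ε := fun ε => by
    simp [b]
  have hbn : ∀ ε, 2 * Real.pi * |t| ≤ ‖b ε‖ := fun ε => by
    have h2 : (b ε).im = 2 * Real.pi * t := by simp [b]
    calc 2 * Real.pi * |t| = |(b ε).im| := by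
          rw [h2, abs_mul, abs_of_pos (by positivity : 0 < 2 * Real.pi)]
      _ ≤ _ := Complex.abs_im_le_norm _
  have hexp : ∀ ε : ℝ, ∀ ξ : ℝ, Complex.exp (-Real.pi * b ε * ξ ^ 2) =
      Complex.exp ((-(2 * Real.pi ^ 2 * ε * ξ ^ 2) : ℝ)) * symbolX t ξ := fun ε ξ => by
    unfold symbolX
    rw [← Complex.exp_add]
    congr 1
    simp only [b]
    push_cast; ring
  have hlim : Tendsto (fun ε : ℝ => ∫ ξ : ℝ, (starRingEnd ℂ) ((𝓕 (g : ℝ → ℂ)) ξ) *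
      (Complex.exp (-Real.pi * b ε * ξ ^ 2) * (𝓕 (f : ℝ → ℂ)) ξ)) (𝓝[>] 0)
      (𝓝 (∫ ξ, (starRingEnd ℂ) ((𝓕 (g : ℝ → ℂ)) ξ) *
        (symbolX t ξ * (𝓕 (f : ℝ → ℂ)) ξ))) := by
    refine tendsto_integral_filter_of_dominated_convergence _
      (Eventually.of_forall fun ε => ?_) ?_ hint (Eventually.of_forall fun ξ => ?_)
    · have := continuous_fourier hf
      have := continuous_fourier hg
      exact Continuous.aestronglyMeasurable (by fun_prop)
    · filter_upwards [self_mem_nhdsWithin] with ε hε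
      refine Eventually.of_forall fun ξ => ?_
      have hε' : (0 : ℝ) < ε := hε
      rw [norm_mul, norm_mul, RCLike.norm_conj, hexp, norm_mul, norm_symbolX, mul_one,
        Complex.norm_exp_ofReal]
      gcongr
      refine mul_le_of_le_one_left (norm_nonneg _) (Real.exp_le_one_iff.2 ?_)
      simp only [Left.neg_nonpos_iff]
      positivity
    · have hc : Continuous fun ε : ℝ => (starRingEnd ℂ) ((𝓕 (g : ℝ → ℂ)) ξ) *
          (Complex.exp (-Real.pi * b ε * ξ ^ 2) * (𝓕 (f : ℝ → ℂ)) ξ) := by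
        simp only [b]; fun_prop
      have := hc.tendsto 0
      rw [hexp] at this
      simp only [mul_zero, zero_mul, neg_zero, Complex.ofReal_zero, Complex.exp_zero,
        one_mul] at this
      exact this.mono_left nhdsWithin_le_nhds
  rw [h1]
  refine le_of_tendsto hlim.norm ?_
  filter_upwards [self_mem_nhdsWithin] with ε hε
  have hε' : (0 : ℝ) < ε := hε
  refine (norm_integral_gaussian_mul_le (by rw [hbre]; positivity) hf hg).trans ?_
  have : ‖b ε‖ ^ (-(1 / 2) : ℝ) ≤ (2 * Real.pi * |t|) ^ (-(1 / 2) : ℝ) :=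
    Real.rpow_le_rpow_of_nonpos (by have := abs_pos.2 ht; positivity) (hbn ε) (by norm_num)
  gcongr

end

/-! ### The Hardy–Littlewood–Sobolev inequality for |r|^{-1/2} -/

section

theorem lintegral_comp_abs (g : ℝ → ℝ≥0∞) : ∫⁻ r, g |r| = 2 * ∫⁻ r in Ioi 0, g r := by
  have h1 : ∫⁻ r in Ioi 0, g |r| = ∫⁻ r in Ioi 0, g r :=
    setLIntegral_congr_fun measurableSet_Ioi fun r hr => by
      rw [abs_of_pos (by simpa using hr)]
  have h2 : ∫⁻ r in Iic 0, g |r| = ∫⁻ r in Ioi 0, g r := by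
    rw [← h1, setLIntegral_congr Iio_ae_eq_Iic.symm]
    have := (Measure.measurePreserving_neg (volume : Measure ℝ)).setLIntegral_comp_preimage_emb
      (MeasurableEquiv.neg ℝ).measurableEmbedding (fun r => g |r|) (Ioi 0)
    simpa using this
  rw [← lintegral_add_compl _ (measurableSet_Iic (a := (0 : ℝ))), compl_Iic, h1, h2, two_mul]

theorem lintegral_near_rpow {δ : ℝ} (hδ : 0 < δ) :
    ∫⁻ r : ℝ, (Iio δ).indicator (fun r => ENNReal.ofReal (r ^ (-(1 / 2) : ℝ))) |r| =
      4 * ENNReal.ofReal (δ ^ (1 / 2 : ℝ)) := by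
  rw [lintegral_comp_abs, setLIntegral_indicator measurableSet_Iio]
  have hs : Iio δ ∩ Ioi 0 = Ioo 0 δ := by ext; simp [and_comm]
  have hi : IntegrableOn (fun r : ℝ => r ^ (-(1 / 2) : ℝ)) (Ioc 0 δ) := by
    have := intervalIntegral.intervalIntegrable_rpow' (a := 0) (b := δ)
      (by norm_num : (-1 : ℝ) < -(1 / 2))
    rwa [intervalIntegrable_iff_integrableOn_Ioc_of_le hδ.le] at this
  rw [hs, setLIntegral_congr Ioo_ae_eq_Ioc, ← ofReal_integral_eq_lintegral_ofReal hi,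
    ← intervalIntegral.integral_of_le hδ.le, integral_rpow (Or.inl (by norm_num))]
  · rw [Real.zero_rpow (by norm_num)]
    have h4 : (4 : ℝ≥0∞) = 2 * ENNReal.ofReal 2 := by
      rw [ENNReal.ofReal_ofNat]; norm_num
    rw [h4, mul_assoc, ← ENNReal.ofReal_mul (by norm_num)]
    congr 2
    norm_num; ring
  · filter_upwards [ae_restrict_mem measurableSet_Ioc] with r hr
    exact Real.rpow_nonneg hr.1.le _

theorem lintegral_far_rpow {δ : ℝ} (hδ : 0 < δ) :
    ∫⁻ r : ℝ, (Ici δ).indicator (fun r => ENNReal.ofReal (r ^ (-2 : ℝ))) |r| =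
      2 * ENNReal.ofReal δ⁻¹ := by
  rw [lintegral_comp_abs, setLIntegral_indicator measurableSet_Ici]
  have hs : Ici δ ∩ Ioi 0 = Ici δ := by
    ext x; simp only [mem_inter_iff, mem_Ici, mem_Ioi, and_iff_left_iff_imp]
    intro h; linarith
  rw [hs, setLIntegral_congr Ioi_ae_eq_Ici.symm, ← ofReal_integral_eq_lintegral_ofReal
    (integrableOn_Ioi_rpow_of_lt (by norm_num) hδ), integral_Ioi_rpow_of_lt (by norm_num) hδ]
  · congr 2
    norm_num [Real.rpow_neg_one]
  · filter_upwards [ae_restrict_mem measurableSet_Ioi] with r hr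
    exact Real.rpow_nonneg (hδ.trans (by simpa using hr)).le _

/-- The kernel `|r|^{-1/2}`. -/
def hlsKernel (r : ℝ) : ℝ≥0∞ := ENNReal.ofReal (|r| ^ (-(1 / 2) : ℝ))

theorem measurable_hlsKernel : Measurable hlsKernel := by
  unfold hlsKernel; fun_prop

/-- Cut the kernel at distance δ. Near the diagonal use M ≤ α and integrability of |r|^{-1/2}; far
from it use Hölder with exponents 4/3 and 4, where |r|^{-2} is integrable. The truncation M ≤ α is
what makes the weak-type kernel sufficient. -/
theorem lintegral_hlsKernel_inner_le {M : ℝ → ℝ≥0∞} (hM : Measurable M) {α : ℝ≥0∞}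
    (hα : α ≠ 0) (hα' : α ≠ ⊤) (hA : ∫⁻ s, M s ^ 4 ≠ 0) (hA' : ∫⁻ s, M s ^ 4 ≠ ⊤) (t : ℝ) :
    ∫⁻ s, {s | M s ≤ α}.indicator (fun s => M s ^ 3) s * hlsKernel (t - s) ≤
      6 * ((∫⁻ s, M s ^ 4) ^ (1 / 2 : ℝ) * α) := by
  set A := ∫⁻ s, M s ^ 4 with hAdef
  -- This δ balances the two contributions α³ δ^{1/2} and A^{3/4} δ^{-1/4}; both become A^{1/2} α.
  set δ : ℝ := (A / α ^ 4).toReal with hδdef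
  have hδ' : A / α ^ 4 ≠ ⊤ := ENNReal.div_ne_top hA' (pow_ne_zero _ hα)
  have hδ : 0 < δ := ENNReal.toReal_pos (ENNReal.div_ne_zero.2 ⟨hA, ENNReal.pow_ne_top hα'⟩) hδ'
  have hδE : ENNReal.ofReal δ = A / α ^ 4 := ENNReal.ofReal_toReal hδ'
  set k₁ : ℝ → ℝ≥0∞ := fun r =>
    (Iio δ).indicator (fun r => ENNReal.ofReal (r ^ (-(1 / 2) : ℝ))) |r|
  set k₂ : ℝ → ℝ≥0∞ := fun r =>
    (Ici δ).indicator (fun r => ENNReal.ofReal (r ^ (-(1 / 2) : ℝ))) |r|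
  have hk₁ : Measurable k₁ := by
    refine Measurable.comp (g := (Iio δ).indicator _) ?_ (by fun_prop)
    exact Measurable.indicator (by fun_prop) measurableSet_Iio
  have hk₂ : Measurable k₂ := by
    refine Measurable.comp (g := (Ici δ).indicator _) ?_ (by fun_prop)
    exact Measurable.indicator (by fun_prop) measurableSet_Ici
  have hle : ∀ s, {s | M s ≤ α}.indicator (fun s => M s ^ 3) s * hlsKernel (t - s) ≤
      α ^ 3 * k₁ (t - s) + M s ^ 3 * k₂ (t - s) := fun s => by
    by_cases hs : M s ≤ α
    · rw [indicator_of_mem (by exact hs)]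
      by_cases hr : |t - s| < δ
      · refine le_trans ?_ le_self_add
        simp only [k₁, indicator_of_mem (mem_Iio.2 hr), hlsKernel]
        gcongr
      · refine le_trans ?_ le_add_self
        simp only [k₂, indicator_of_mem (mem_Ici.2 (not_lt.1 hr)), hlsKernel]
        exact le_rfl
    · rw [indicator_of_notMem (by exact hs)]; simp
  have h1 : ∫⁻ s, k₁ (t - s) = 4 * ENNReal.ofReal (δ ^ (1 / 2 : ℝ)) := by
    rw [lintegral_sub_left_eq_self k₁ t, lintegral_near_rpow hδ]
  have h2 : ∫⁻ s, k₂ (t - s) ^ (4 : ℝ) = 2 * ENNReal.ofReal δ⁻¹ := by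
    rw [lintegral_sub_left_eq_self (fun r => k₂ r ^ (4 : ℝ)) t, ← lintegral_far_rpow hδ]
    refine lintegral_congr fun r => ?_
    by_cases hr : |r| ∈ Ici δ
    · simp only [k₂, indicator_of_mem hr]
      rw [ENNReal.ofReal_rpow_of_nonneg (by positivity) (by norm_num), ← Real.rpow_mul
        (abs_nonneg _)]
      norm_num
    · simp [k₂, indicator_of_notMem hr]
  have hhol : ∫⁻ s, M s ^ 3 * k₂ (t - s) ≤
      A ^ (3 / 4 : ℝ) * (2 * ENNReal.ofReal δ⁻¹) ^ (1 / 4 : ℝ) := by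
    have := ENNReal.lintegral_mul_le_Lp_mul_Lq (volume : Measure ℝ)
      (p := 4 / 3) (q := 4) ⟨by norm_num, by norm_num, by norm_num⟩
      (f := fun s => M s ^ 3) (g := fun s => k₂ (t - s))
      (hM.pow_const 3).aemeasurable (hk₂.comp (measurable_const.sub measurable_id)).aemeasurable
    refine this.trans (le_of_eq ?_)
    rw [h2, hAdef]
    congr 2
    · refine lintegral_congr fun s => ?_
      rw [← ENNReal.rpow_natCast, ← ENNReal.rpow_mul, ← ENNReal.rpow_natCast]
      norm_num
    · norm_num
  have e1 : α ^ 3 * ENNReal.ofReal (δ ^ (1 / 2 : ℝ)) = A ^ (1 / 2 : ℝ) * α := by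
    rw [← ENNReal.ofReal_rpow_of_pos hδ, hδE, ENNReal.div_rpow_of_nonneg _ _ (by norm_num),
      ← ENNReal.rpow_natCast α 4, ← ENNReal.rpow_mul]
    norm_num
    rw [← mul_div_assoc, mul_comm, mul_div_assoc]
    congr 1
    rw [ENNReal.div_eq_inv_mul, show α ^ 3 = α ^ 2 * α by ring, ← mul_assoc, ENNReal.inv_mul_cancel
      (pow_ne_zero _ hα) (ENNReal.pow_ne_top hα'), one_mul]
  have e2 : A ^ (3 / 4 : ℝ) * (2 * ENNReal.ofReal δ⁻¹) ^ (1 / 4 : ℝ) ≤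
      2 * (A ^ (1 / 2 : ℝ) * α) := by
    rw [ENNReal.mul_rpow_of_nonneg _ _ (by norm_num), ENNReal.ofReal_inv_of_pos hδ, hδE,
      ENNReal.inv_div (Or.inl (ENNReal.pow_ne_top hα')) (Or.inl (pow_ne_zero _ hα)),
      ENNReal.div_rpow_of_nonneg _ _ (by norm_num), ← ENNReal.rpow_natCast α 4,
      ← ENNReal.rpow_mul]
    have h3 : (2 : ℝ≥0∞) ^ (1 / 4 : ℝ) ≤ 2 := by
      calc (2 : ℝ≥0∞) ^ (1 / 4 : ℝ) ≤ 2 ^ (1 : ℝ) :=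
            ENNReal.rpow_le_rpow_of_exponent_le (by norm_num) (by norm_num)
        _ = 2 := ENNReal.rpow_one _
    have h4 : A ^ (3 / 4 : ℝ) = A ^ (1 / 2 : ℝ) * A ^ (1 / 4 : ℝ) := by
      rw [← ENNReal.rpow_add _ _ hA hA']; norm_num
    have h5 : A ^ (1 / 4 : ℝ) * (α / A ^ (1 / 4 : ℝ)) = α :=
      ENNReal.mul_div_cancel (by simp [hA, hA']) (by simp [hA, hA'])
    norm_num only [Nat.cast_ofNat]
    rw [ENNReal.rpow_one]
    norm_num only at h3 h4 h5
    calc _ = 2 ^ (1 / 4 : ℝ) * (A ^ (1 / 2 : ℝ) * (A ^ (1 / 4 : ℝ) * (α / A ^ (1 / 4 : ℝ)))) := by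
          rw [h4]; ring
      _ ≤ _ := by rw [h5]; gcongr
  calc _ ≤ ∫⁻ s, (α ^ 3 * k₁ (t - s) + M s ^ 3 * k₂ (t - s)) := lintegral_mono hle
    _ = α ^ 3 * (∫⁻ s, k₁ (t - s)) + ∫⁻ s, M s ^ 3 * k₂ (t - s) := by
        have hk : Measurable fun s => k₁ (t - s) :=
          hk₁.comp (measurable_const.sub measurable_id)
        rw [lintegral_add_left (hk.const_mul _), lintegral_const_mul _ hk]
    _ ≤ 4 * (A ^ (1 / 2 : ℝ) * α) + 2 * (A ^ (1 / 2 : ℝ) * α) := by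
        refine add_le_add ?_ (hhol.trans e2)
        rw [h1, mul_left_comm, e1]
    _ = _ := by rw [← add_mul]; norm_num

/-- The Hardy–Littlewood–Sobolev inequality for `|r|^{-1/2}` on `L^{4/3}(ℝ)`. -/
theorem lintegral_hlsKernel_le {M : ℝ → ℝ≥0∞} (hM : Measurable M) (hfin : ∀ t, M t ≠ ⊤)
    (hA' : ∫⁻ s, M s ^ 4 ≠ ⊤) :
    ∫⁻ t, ∫⁻ s, M t ^ 3 * (M s ^ 3 * hlsKernel (t - s)) ≤
      12 * (∫⁻ s, M s ^ 4) ^ (3 / 2 : ℝ) := by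
  by_cases hA : ∫⁻ s, M s ^ 4 = 0
  · have h0 : ∀ᵐ t, M t = 0 := by
      rw [lintegral_eq_zero_iff (hM.pow_const 4)] at hA
      filter_upwards [hA] with t ht
      simpa using ht
    rw [lintegral_congr_ae (g := fun _ => 0)]
    · simp
    · filter_upwards [h0] with t ht
      simp [ht]
  set A := ∫⁻ s, M s ^ 4 with hAdef
  let F : ℝ → ℝ → ℝ≥0∞ := fun t s =>
    M t ^ 3 * ({s | M s ≤ M t}.indicator (fun s => M s ^ 3) s * hlsKernel (t - s))
  have hFm : Measurable (Function.uncurry F) := by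
    refine ((hM.comp measurable_fst).pow_const 3).mul (Measurable.mul ?_
      (measurable_hlsKernel.comp (measurable_fst.sub measurable_snd)))
    have : (fun p : ℝ × ℝ => {s | M s ≤ M p.1}.indicator (fun s => M s ^ 3) p.2) =
        {p : ℝ × ℝ | M p.2 ≤ M p.1}.indicator (fun p => M p.2 ^ 3) := by
      ext p; simp [indicator]
    rw [this]
    exact ((hM.comp measurable_snd).pow_const 3).indicator
      (measurableSet_le (hM.comp measurable_snd) (hM.comp measurable_fst))
  have hF : ∀ t, ∫⁻ s, F t s ≤ 6 * A ^ (1 / 2 : ℝ) * M t ^ 4 := fun t => by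
    by_cases hα : M t = 0
    · simp [F, hα]
    · simp only [F]
      rw [lintegral_const_mul' _ _ (ENNReal.pow_ne_top (hfin t))]
      calc _ ≤ M t ^ 3 * (6 * (A ^ (1 / 2 : ℝ) * M t)) := by
            gcongr; exact lintegral_hlsKernel_inner_le hM hα (hfin t) hA hA' t
        _ = _ := by ring
  have hI : ∫⁻ t, ∫⁻ s, F t s ≤ 6 * A ^ (3 / 2 : ℝ) := by
    refine (lintegral_mono hF).trans ?_
    rw [lintegral_const_mul _ (hM.pow_const 4), mul_assoc]
    gcongr
    rw [← hAdef]
    nth_rewrite 2 [← ENNReal.rpow_one A]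
    rw [← ENNReal.rpow_add _ _ hA hA']
    norm_num
  -- The double integral is symmetric, so it suffices to integrate over M(s) ≤ M(t). There the inner
  -- bound with α = M(t) yields M(t)⁴, which integrates to A.
  have hsplit : ∀ t s, M t ^ 3 * (M s ^ 3 * hlsKernel (t - s)) ≤ F t s + F s t := fun t s => by
    have hsym : hlsKernel (s - t) = hlsKernel (t - s) := by
      simp only [hlsKernel, abs_sub_comm]
    rcases le_total (M s) (M t) with h | h
    · refine le_trans (le_of_eq ?_) le_self_add
      simp [F, indicator, h]
    · refine le_trans (le_of_eq ?_) le_add_self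
      simp only [F, indicator, mem_ofPred_eq, h, if_true, hsym]
      ring
  calc _ ≤ ∫⁻ t, ∫⁻ s, (F t s + F s t) :=
        lintegral_mono fun t => lintegral_mono fun s => hsplit t s
    _ = ∫⁻ t, ((∫⁻ s, F t s) + ∫⁻ s, F s t) := by
        refine lintegral_congr fun t => ?_
        exact lintegral_add_left (hFm.comp (measurable_const.prodMk measurable_id)) _
    _ = (∫⁻ t, ∫⁻ s, F t s) + ∫⁻ t, ∫⁻ s, F s t := by
        rw [lintegral_add_left hFm.lintegral_prod_right]
    _ = (∫⁻ t, ∫⁻ s, F t s) + ∫⁻ t, ∫⁻ s, F t s := by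
        congr 1
        rw [lintegral_lintegral_swap]
        exact (hFm.comp measurable_swap).aemeasurable
    _ ≤ 6 * A ^ (3 / 2 : ℝ) + 6 * A ^ (3 / 2 : ℝ) := add_le_add hI hI
    _ = _ := by rw [← add_mul]; norm_num

end

/-! ### The endpoint Strichartz estimate in one dimension -/

section

/-- Expand the square as an inner product and pull both integrals out. This is the TT* step: it
reduces the adjoint Strichartz bound to pairwise inner products, where the dispersive estimate
applies. -/
theorem enorm_integral_sq_le {α E : Type*} [MeasurableSpace α] {μ : Measure α}
    [NormedAddCommGroup E] [InnerProductSpace ℂ E] [CompleteSpace E] {H : α → E}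
    (hH : Integrable H μ) :
    ‖∫ t, H t ∂μ‖ₑ ^ 2 ≤ ∫⁻ t, ∫⁻ s, ‖(inner ℂ (H t) (H s) : ℂ)‖ₑ ∂μ ∂μ := by
  have h1 : ‖∫ t, H t ∂μ‖ₑ ^ 2 = ‖(inner ℂ (∫ t, H t ∂μ) (∫ t, H t ∂μ) : ℂ)‖ₑ := by
    rw [inner_self_eq_norm_sq_to_K, enorm_pow]
    congr 1
    simp [← ofReal_norm]
  have h2 : ∀ c : E, ‖(inner ℂ c (∫ t, H t ∂μ) : ℂ)‖ₑ ≤ ∫⁻ s, ‖(inner ℂ c (H s) : ℂ)‖ₑ ∂μ :=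
    fun c => by
      rw [← integral_inner hH]
      exact enorm_integral_le_lintegral_enorm _
  have hs : ∀ a b : E, ‖(inner ℂ a b : ℂ)‖ₑ = ‖(inner ℂ b a : ℂ)‖ₑ := fun a b => by
    rw [← inner_conj_symm, RCLike.enorm_conj]
  rw [h1]
  refine (h2 _).trans (lintegral_mono fun t => ?_)
  rw [hs]
  exact h2 _

instance factTwoNeTop : Fact ((2 : ℝ≥0∞) ≠ ⊤) := ⟨ENNReal.ofNat_ne_top⟩

theorem integrable_of_eLpNorm_one_le {f : LX} (hf : eLpNorm f 1 volume ≤ 1) : Integrable f :=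
  memLp_one_iff_integrable.1 ⟨Lp.aestronglyMeasurable f, hf.trans_lt ENNReal.one_lt_top⟩

theorem enorm_inner_evolX_le {t : ℝ} (ht : t ≠ 0) {f g : LX} (hf : eLpNorm f 1 volume ≤ 1)
    (hg : eLpNorm g 1 volume ≤ 1) :
    ‖(inner ℂ g (evolX t f) : ℂ)‖ₑ ≤ hlsKernel t := by
  have hn : ∀ {h : LX}, eLpNorm h 1 volume ≤ 1 → ∫ x, ‖h x‖ ≤ 1 := fun {h} hh => by
    rw [integral_norm_eq_lintegral_enorm (Lp.aestronglyMeasurable h),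
      ← eLpNorm_one_eq_lintegral_enorm]
    exact ENNReal.toReal_le_of_le_ofReal zero_le_one (by simpa using hh)
  have hpos : 0 < |t| := abs_pos.2 ht
  rw [← ofReal_norm, hlsKernel]
  refine ENNReal.ofReal_le_ofReal ((norm_inner_evolX_le ht (integrable_of_eLpNorm_one_le hf)
    (integrable_of_eLpNorm_one_le hg)).trans ?_)
  have h1 : (2 * Real.pi * |t|) ^ (-(1 / 2) : ℝ) ≤ |t| ^ (-(1 / 2) : ℝ) := by
    refine Real.rpow_le_rpow_of_nonpos hpos ?_ (by norm_num)
    have := Real.pi_gt_three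
    nlinarith
  calc _ ≤ |t| ^ (-(1 / 2) : ℝ) * 1 * 1 := by
        gcongr
        · exact hn hf
        · exact hn hg
    _ = _ := by ring

theorem stronglyMeasurable_comp_prodMk {X E : Type*} [MeasurableSpace X] [TopologicalSpace E]
    {G : ℝ × E → E} (hG : Continuous G) {τ : X → ℝ} {F : X → E} (hτ : Measurable τ)
    (hF : StronglyMeasurable F) : StronglyMeasurable fun x => G (τ x, F x) :=
  hG.comp_stronglyMeasurable (hτ.stronglyMeasurable.prodMk hF)

theorem stronglyMeasurable_evolX_comp {X : Type*} [MeasurableSpace X] {τ : X → ℝ} {F : X → LX}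
    (hτ : Measurable τ) (hF : StronglyMeasurable F) :
    StronglyMeasurable fun x => evolX (τ x) (F x) :=
  stronglyMeasurable_comp_prodMk continuous_evolX_uncurry hτ hF

section Strichartz

variable {g : ℕ → LX}

/-- TT* for the linearised operator f ↦ z. With A = ∫|z|⁴, duality writes A as a pairing of f with
∫H, while the dispersive bound and Hardy–Littlewood–Sobolev give ‖∫H‖² ≤ 12 A^{3/2}. Hence A² ≤ 12
A^{3/2} ‖f‖², and dividing gives A ≤ 144 ‖f‖⁴. -/
theorem lintegral_Icc_select_le (hg : ∀ n, eLpNorm (g n) 1 volume ≤ 1) (f : LX) {n : ℝ → ℕ} (hn : Measurable n) {N : ℕ}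
    (hN : ∀ t, n t ≤ N) (K : ℝ) :
    ∫⁻ t in Icc (-K) K, ‖(inner ℂ (g (n t)) (evolX t f) : ℂ)‖ₑ ^ 4 ≤ 144 * ‖f‖ₑ ^ 4 := by
  set μ : Measure ℝ := volume.restrict (Icc (-K) K) with hμ
  set z : ℝ → ℂ := fun t => inner ℂ (g (n t)) (evolX t f) with hz
  have hgn : StronglyMeasurable fun t => g (n t) :=
    (StronglyMeasurable.of_discrete (f := g)).comp_measurable hn
  have hzm : StronglyMeasurable z :=
    hgn.inner (continuous_evolX f).stronglyMeasurable
  obtain ⟨B, hB⟩ : ∃ B : ℝ, ∀ t, ‖g (n t)‖ ≤ B := by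
    obtain ⟨B, hB⟩ := ((Finset.range (N + 1)).image fun m => ‖g m‖).exists_le
    exact ⟨B, fun t => hB _ (Finset.mem_image_of_mem _
      (Finset.mem_range.2 (Nat.lt_succ_of_le (hN t))))⟩
  have hB0 : 0 ≤ B := (norm_nonneg _).trans (hB 0)
  have hzB : ∀ t, ‖z t‖ ≤ B * ‖f‖ := fun t => by
    refine (norm_inner_le_norm _ _).trans ?_
    rw [norm_evolX]
    gcongr
    exact hB t
  let M : ℝ → ℝ≥0∞ := (Icc (-K) K).indicator fun t => ‖z t‖ₑ
  have hMm : Measurable M := hzm.measurable.enorm.indicator measurableSet_Icc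
  have hA : ∫⁻ t, M t ^ 4 = ∫⁻ t, ‖z t‖ₑ ^ 4 ∂μ := by
    rw [hμ, ← lintegral_indicator measurableSet_Icc]
    refine lintegral_congr fun t => ?_
    by_cases ht : t ∈ Icc (-K) K <;> simp [M, ht]
  set A := ∫⁻ t, ‖z t‖ₑ ^ 4 ∂μ with hAdef
  -- Finiteness is needed to divide by A^{3/2} at the end; it is the reason for the bounded time
  -- interval and for the finitely many values of n.
  have hAfin : A ≠ ⊤ := by
    refine ((lintegral_mono (g := fun _ => ENNReal.ofReal (B * ‖f‖) ^ 4) fun t => ?_).trans_lt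
      ?_).ne
    · simp only; rw [← ofReal_norm]; gcongr; exact hzB t
    · rw [lintegral_const]
      exact ENNReal.mul_lt_top (by simp) (measure_lt_top _ _)
  -- The coefficient |z|²z is the extremal dual function in L^{4/3}, so that pairing ∫H with f
  -- returns ∫|z|⁴.
  let H : ℝ → LX := fun t => (((‖z t‖ ^ 2 : ℝ) : ℂ) * z t) • evolX (-t) (g (n t))
  have hHm : StronglyMeasurable H := by
    have hc : StronglyMeasurable fun t => ((‖z t‖ ^ 2 : ℝ) : ℂ) * z t :=
      (Complex.continuous_ofReal.comp_stronglyMeasurable (hzm.norm.pow 2)).mul hzm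
    exact hc.smul (stronglyMeasurable_evolX_comp measurable_neg hgn)
  have hHi : Integrable H μ := by
    refine Integrable.of_bound hHm.aestronglyMeasurable ((B * ‖f‖) ^ 2 * (B * ‖f‖) * B)
      (Eventually.of_forall fun t => ?_)
    simp only [H]
    rw [norm_smul, norm_mul, Complex.norm_real, norm_pow, norm_norm, norm_evolX]
    have := hzB t
    have := hB t
    gcongr
  have h1 : ((∫ t, ‖z t‖ ^ 4 ∂μ : ℝ) : ℂ) = inner ℂ (∫ t, H t ∂μ) f := by
    rw [← inner_conj_symm, ← integral_inner hHi, ← integral_conj, ← integral_complex_ofReal]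
    refine integral_congr_ae (Eventually.of_forall fun t => ?_)
    simp only [H]
    rw [inner_conj_symm, inner_smul_left, inner_evolX_left, neg_neg, map_mul, Complex.conj_ofReal,
      mul_assoc]
    change _ = _ * ((starRingEnd ℂ) (z t) * z t)
    rw [Complex.conj_mul']
    push_cast; ring
  have h2 : A = ‖(inner ℂ (∫ t, H t ∂μ) f : ℂ)‖ₑ := by
    rw [← h1, ← ofReal_norm, Complex.norm_real, Real.norm_of_nonneg (by positivity),
      ofReal_integral_eq_lintegral_ofReal _ (Eventually.of_forall fun t => by positivity)]
    · refine lintegral_congr fun t => ?_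
      rw [ENNReal.ofReal_pow (norm_nonneg _), ofReal_norm]
    · refine Integrable.of_bound (hzm.norm.pow 4).aestronglyMeasurable ((B * ‖f‖) ^ 4)
        (Eventually.of_forall fun t => ?_)
      rw [norm_pow, norm_norm]
      gcongr
      exact hzB t
  have h3 : ‖∫ t, H t ∂μ‖ₑ ^ 2 ≤ 12 * A ^ (3 / 2 : ℝ) := by
    refine (enorm_integral_sq_le hHi).trans ?_
    rw [← hA]
    refine le_trans ?_ (lintegral_hlsKernel_le hMm (fun t => ?_) (by rwa [hA]))
    · have hin : ∀ k : ℝ → ℝ → ℝ≥0∞, ∫⁻ t, ∫⁻ s, M t ^ 3 * (M s ^ 3 * k t s) =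
          ∫⁻ t, ∫⁻ s, ‖z t‖ₑ ^ 3 * (‖z s‖ₑ ^ 3 * k t s) ∂μ ∂μ := fun k => by
        rw [hμ, ← lintegral_indicator measurableSet_Icc]
        refine lintegral_congr fun t => ?_
        by_cases ht : t ∈ Icc (-K) K
        · rw [indicator_of_mem ht, ← lintegral_indicator measurableSet_Icc]
          refine lintegral_congr fun s => ?_
          by_cases hs : s ∈ Icc (-K) K <;> simp [M, ht, hs]
        · simp [M, ht]
      rw [hin fun t s => hlsKernel (t - s)]
      refine lintegral_mono fun t => lintegral_mono_ae ?_
      have hne : ∀ᵐ s ∂μ, s ≠ t := by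
        refine ae_restrict_of_ae ?_
        simp [ae_iff]
      filter_upwards [hne] with s hs
      simp only [H]
      rw [inner_smul_left, inner_smul_right, inner_evolX_left, evolX_evolX]
      simp only [enorm_mul, RCLike.enorm_conj]
      have h4 : ∀ r, ‖((‖z r‖ ^ 2 : ℝ) : ℂ)‖ₑ * ‖z r‖ₑ = ‖z r‖ₑ ^ 3 := fun r => by
        rw [← ofReal_norm, Complex.norm_real, Real.norm_of_nonneg (by positivity),
          ENNReal.ofReal_pow (norm_nonneg _), ofReal_norm]
        ring
      rw [h4, h4]
      gcongr
      have := enorm_inner_evolX_le (t := t - s) (sub_ne_zero.2 hs.symm) (hg (n s)) (hg (n t))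
      rwa [show - -t + -s = t - s by ring]
    · by_cases ht : t ∈ Icc (-K) K <;> simp [M, ht]
  have h5 : A ^ 2 ≤ 12 * A ^ (3 / 2 : ℝ) * ‖f‖ₑ ^ 2 := by
    calc A ^ 2 ≤ (‖∫ t, H t ∂μ‖ₑ * ‖f‖ₑ) ^ 2 := by
          gcongr
          rw [h2]
          simp only [← ofReal_norm]
          rw [← ENNReal.ofReal_mul (norm_nonneg _)]
          exact ENNReal.ofReal_le_ofReal (norm_inner_le_norm _ _)
      _ ≤ _ := by rw [mul_pow]; gcongr
  by_cases hA0 : A = 0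
  · rw [hA0]; exact zero_le
  have h6 : A ^ (1 / 2 : ℝ) ≤ 12 * ‖f‖ₑ ^ 2 := by
    have h7 : A ^ (3 / 2 : ℝ) * A ^ (1 / 2 : ℝ) ≤ A ^ (3 / 2 : ℝ) * (12 * ‖f‖ₑ ^ 2) := by
      rw [← ENNReal.rpow_add _ _ hA0 hAfin]
      calc _ = A ^ 2 := by rw [← ENNReal.rpow_natCast]; norm_num
        _ ≤ _ := h5
        _ = _ := by ring
    exact (ENNReal.mul_le_mul_iff_right (by simp [hA0, hAfin]) (by simp [hA0, hAfin])).1 h7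
  calc A = (A ^ (1 / 2 : ℝ)) ^ 2 := by
        rw [← ENNReal.rpow_natCast, ← ENNReal.rpow_mul]; norm_num
    _ ≤ (12 * ‖f‖ₑ ^ 2) ^ 2 := by gcongr
    _ = _ := by ring

theorem lintegral_select_le (hg : ∀ n, eLpNorm (g n) 1 volume ≤ 1) (f : LX) {n : ℝ → ℕ} (hn : Measurable n) {N : ℕ}
    (hN : ∀ t, n t ≤ N) :
    ∫⁻ t, ‖(inner ℂ (g (n t)) (evolX t f) : ℂ)‖ₑ ^ 4 ≤ 144 * ‖f‖ₑ ^ 4 := by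
  have hU : (⋃ K : ℕ, Icc (-(K : ℝ)) K) = univ := by
    refine eq_univ_of_forall fun t => mem_iUnion.2 ?_
    obtain ⟨K, hK⟩ := exists_nat_ge |t|
    exact ⟨K, abs_le.1 hK⟩
  rw [← setLIntegral_univ, ← hU, setLIntegral_iUnion_of_directed]
  · exact iSup_le fun K => lintegral_Icc_select_le hg f hn hN K
  · refine directed_of_isDirected_le fun a b hab => Icc_subset_Icc ?_ ?_
    · exact neg_le_neg (by exact_mod_cast hab)
    · exact_mod_cast hab

/-- A measurable maximising index linearises the supremum over the first N + 1 test functions. It is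
built inductively, switching to the new index on the measurable set where that index is at least as
good. -/
theorem exists_measurable_select (f : LX) (N : ℕ) : ∃ n : ℝ → ℕ, Measurable n ∧ (∀ t, n t ≤ N) ∧
    ∀ t, ∀ m ≤ N, ‖(inner ℂ (g m) (evolX t f) : ℂ)‖ₑ ≤
      ‖(inner ℂ (g (n t)) (evolX t f) : ℂ)‖ₑ := by
  induction N with
  | zero => exact ⟨fun _ => 0, measurable_const, fun _ => le_rfl, fun t m hm => by
      rw [Nat.le_zero.1 hm]⟩
  | succ N ih =>
    obtain ⟨n, hn, hnN, hmax⟩ := ih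
    classical
    have hz : ∀ h : ℝ → LX, StronglyMeasurable h →
        Measurable fun t => ‖(inner ℂ (h t) (evolX t f) : ℂ)‖ₑ := fun h hh =>
      (hh.inner (continuous_evolX f).stronglyMeasurable).measurable.enorm
    let S : Set ℝ := {t | ‖(inner ℂ (g (n t)) (evolX t f) : ℂ)‖ₑ ≤
      ‖(inner ℂ (g (N + 1)) (evolX t f) : ℂ)‖ₑ}
    have hS : MeasurableSet S := measurableSet_le
      (hz _ ((StronglyMeasurable.of_discrete (f := g)).comp_measurable hn))
      (hz (fun _ => g (N + 1)) stronglyMeasurable_const)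
    refine ⟨S.piecewise (fun _ => N + 1) n, measurable_const.piecewise hS hn, fun t => ?_,
      fun t m hm => ?_⟩
    · by_cases ht : t ∈ S
      · simp [ht]
      · simpa [ht] using (hnN t).trans (Nat.le_succ N)
    · by_cases ht : t ∈ S
      · rw [piecewise_eq_of_mem _ _ _ ht]
        rcases Nat.le_succ_iff.1 hm with h | h
        · exact (hmax t m h).trans ht
        · rw [h]
      · rw [piecewise_eq_of_notMem _ _ _ ht]
        rcases Nat.le_succ_iff.1 hm with h | h
        · exact hmax t m h
        · rw [h]; exact (not_le.1 ht).le

end Strichartz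

/-- The sup norm is a countable supremum of continuous functions on L², so every mixed norm L⁴_t L^∞
below is an honest integral. -/
theorem measurable_eLpNorm_top_comp {α X : Type*} [MeasurableSpace α] {μ : Measure α}
    [SigmaFinite μ] [TopologicalSpace.SeparableSpace (Lp ℂ 2 μ)] [MeasurableSpace X]
    {F : X → Lp ℂ 2 μ} (hF : StronglyMeasurable F) :
    Measurable fun x => eLpNorm (F x) ⊤ μ := by
  obtain ⟨g, -, h⟩ := exists_seq_eLpNorm_top_eq (μ := μ)
  simp_rw [h]
  exact Measurable.iSup fun n => (stronglyMeasurable_const.inner hF).measurable.enorm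

/-- The Strichartz estimate `‖e^{it∂_x²/2} f‖_{L⁴_t L^∞_x} ≤ C ‖f‖_{L²_x}`. -/
theorem lintegral_eLpNorm_evolX_le (f : LX) :
    ∫⁻ t, eLpNorm (evolX t f) ⊤ volume ^ 4 ≤ 144 * ‖f‖ₑ ^ 4 := by
  obtain ⟨g, hg, h⟩ := exists_seq_eLpNorm_top_eq (μ := (volume : Measure ℝ))
  choose n hn hnN hmax using exists_measurable_select (g := g) f
  have hle : ∀ N t, ‖(inner ℂ (g (n N t)) (evolX t f) : ℂ)‖ₑ ≤ eLpNorm (evolX t f) ⊤ volume :=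
    fun N t => by
      rw [h]; exact le_iSup (fun m => ‖(inner ℂ (g m) (evolX t f) : ℂ)‖ₑ) _
  have heq : ∀ t, eLpNorm (evolX t f) ⊤ volume ^ 4 =
      ⨆ N, ‖(inner ℂ (g (n N t)) (evolX t f) : ℂ)‖ₑ ^ 4 := fun t => by
    refine le_antisymm ?_ (iSup_le fun N => by gcongr; exact hle N t)
    rw [h, ENNReal.iSup_pow]
    refine iSup_mono fun N => ?_
    gcongr
    exact hmax N t N le_rfl
  simp_rw [heq]
  rw [lintegral_iSup]
  · exact iSup_le fun N => lintegral_select_le hg f (hn N) (hnN N)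
  · intro N
    exact ((((StronglyMeasurable.of_discrete (f := g)).comp_measurable (hn N)).inner
      (continuous_evolX f).stronglyMeasurable).measurable.enorm).pow_const 4
  · intro N N' hNN t
    simp only
    gcongr
    exact hmax N' t _ ((hnN N t).trans hNN)

end

/-! ### Fourier series in the compact variables -/

section

variable {d : ℕ}

theorem char_neg (k : Fin d → ℤ) (y : Torus d) : char (-k) y = (starRingEnd ℂ) (char k y) := by
  simp only [char, Pi.neg_apply, fourier_neg, map_prod]

theorem char_add (k l : Fin d → ℤ) (y : Torus d) : char (k + l) y = char k y * char l y := by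
  simp only [char, Pi.add_apply, fourier_add, ← Finset.prod_mul_distrib]

theorem char_zero (y : Torus d) : char (0 : Fin d → ℤ) y = 1 := by
  simp [char]

/-- The character `e^{i⟨k, y⟩}` as a continuous map. -/
def charC (k : Fin d → ℤ) : C(Torus d, ℂ) := ⟨char k, continuous_char k⟩

theorem charC_single (z : Torus d) (i : Fin d) :
    charC (Pi.single i 1) z = fourier 1 (z i) := by
  change ∏ j, fourier ((Pi.single i (1 : ℤ) : Fin d → ℤ) j) (z j) = _
  rw [Finset.prod_eq_single i]
  · rw [Pi.single_eq_same]
  · intro j _ hj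
    rw [Pi.single_eq_of_ne hj, fourier_zero]
  · simp

/-- Stone–Weierstrass: the characters are closed under products and conjugation, so their span is a
star subalgebra, and the coordinate characters already separate points. -/
theorem span_charC_closure_eq_top :
    (Submodule.span ℂ (range (charC (d := d)))).topologicalClosure = ⊤ := by
  let S : StarSubalgebra ℂ C(Torus d, ℂ) :=
    { toSubalgebra := Algebra.adjoin ℂ (range charC)
      star_mem' := by
        change Algebra.adjoin ℂ (range charC) ≤ star (Algebra.adjoin ℂ (range charC))
        refine Algebra.adjoin_le ?_
        rintro _ ⟨n, rfl⟩
        refine Algebra.subset_adjoin ⟨-n, ?_⟩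
        ext1 x
        exact char_neg n x }
  have hS : S.toSubalgebra.toSubmodule = Submodule.span ℂ (range charC) := by
    apply Algebra.adjoin_eq_span_of_subset
    refine .trans (fun x => Submonoid.closure_induction (fun _ => id) ⟨0, ?_⟩ ?_)
      Submodule.subset_span
    · ext z
      exact char_zero z
    · rintro _ _ _ _ ⟨m, rfl⟩ ⟨n, rfl⟩
      refine ⟨m + n, ?_⟩
      ext z
      exact char_add m n z
  have hsep : S.SeparatesPoints := by
    intro x y hxy
    rw [Ne, funext_iff, not_forall] at hxy
    obtain ⟨i, hi⟩ := hxy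
    refine ⟨_, ⟨charC (Pi.single i 1), Algebra.subset_adjoin ⟨Pi.single i 1, rfl⟩, rfl⟩, ?_⟩
    simp only
    rw [charC_single, charC_single, fourier_one, fourier_one]
    exact fun he => hi (AddCircle.injective_toCircle (by positivity) (Circle.ext he))
  rw [← hS]
  exact congr_arg (Subalgebra.toSubmodule <| StarSubalgebra.toSubalgebra ·)
    (ContinuousMap.starSubalgebra_topologicalClosure_eq_top_of_separatesPoints S hsep)

theorem ae_eq_zero_of_forall_integral_char {h : Torus d → ℂ} (hh : MemLp h 2 volume)
    (hz : ∀ k, ∫ y, h y * (starRingEnd ℂ) (char k y) = 0) : h =ᵐ[volume] 0 := by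
  let V : Submodule ℂ (Lp ℂ 2 (volume : Measure (Torus d))) :=
    Submodule.span ℂ (range fun k => ContinuousMap.toLp (E := ℂ) 2 volume ℂ (charC k))
  have hV : V.topologicalClosure = ⊤ := by
    simpa only [Submodule.map_span, ContinuousLinearMap.coe_coe, ← range_comp, Function.comp_def]
      using (ContinuousMap.toLp_denseRange ℂ (volume : Measure (Torus d)) ℂ
        (p := 2) (by norm_num)).topologicalClosure_map_submodule
        (span_charC_closure_eq_top (d := d))
  have hmem : hh.toLp ∈ Vᗮ := by
    rw [Submodule.mem_orthogonal]
    intro u hu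
    induction hu using Submodule.span_induction with
    | mem u hu =>
      obtain ⟨k, rfl⟩ := hu
      rw [L2.inner_def, ← hz k]
      refine integral_congr_ae ?_
      filter_upwards [ContinuousMap.coeFn_toLp (p := 2) (𝕜 := ℂ) volume (charC k),
        hh.coeFn_toLp] with y h1 h2
      rw [h1, h2, RCLike.inner_apply]
      rfl
    | zero => simp
    | add u v _ _ hu hv => rw [inner_add_left, hu, hv, add_zero]
    | smul c u _ hu => rw [inner_smul_left, hu, mul_zero]
  have h0 : hh.toLp = 0 := by
    rw [(Submodule.topologicalClosure_eq_top_iff).1 hV] at hmem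
    exact (Submodule.mem_bot ℂ).1 hmem
  have := hh.coeFn_toLp
  rw [h0] at this
  exact this.symm.trans (Lp.coeFn_zero _ _ _)

theorem volume_torus : volume (univ : Set (Torus d)) = ENNReal.ofReal (2 * Real.pi) ^ d := by
  rw [← Set.pi_univ, volume_pi_pi]
  simp [AddCircle.measure_univ]

theorem normConst_pos : 0 < normConst d := Real.rpow_pos_of_pos Real.two_pi_pos _

theorem normConst_sq_mul : ENNReal.ofReal (normConst d) ^ 2 * volume (univ : Set (Torus d)) = 1 := by
  rw [volume_torus, ← ENNReal.ofReal_pow normConst_pos.le, ← ENNReal.ofReal_pow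
    Real.two_pi_pos.le, ← ENNReal.ofReal_mul (by positivity), normConst, ← Real.rpow_natCast,
    ← Real.rpow_mul Real.two_pi_pos.le, ← Real.rpow_natCast _ d, ← Real.rpow_add Real.two_pi_pos]
  norm_num

theorem integral_char_eq_zero {k : Fin d → ℤ} (hk : k ≠ 0) : ∫ y : Torus d, char k y = 0 := by
  unfold char
  rw [integral_fintype_prod_volume_eq_prod]
  obtain ⟨i, hi⟩ := Function.ne_iff.mp hk
  refine Finset.prod_eq_zero (Finset.mem_univ i) ?_
  exact integral_eq_zero_of_add_right_eq_neg
    (fourier_add_half_inv_index hi (Fact.out : 0 < 2 * Real.pi))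

theorem integral_space {F : Space d → ℂ} (hF : Integrable F volume) :
    ∫ z, F z = ∫ x : ℝ, ∫ y : Torus d, F (x, y) :=
  integral_prod F hF

theorem tensor_ae (k : Fin d → ℤ) (g : LX) :
    (tensor k g : Space d → ℂ) =ᵐ[volume] tensorFun k g := MemLp.coeFn_toLp _

theorem mode_ae (k : Fin d → ℤ) (f : L2 d) : (mode k f : ℝ → ℂ) =ᵐ[volume] modeFun f k :=
  MemLp.coeFn_toLp _

theorem ae_fst {p : ℝ → Prop} (h : ∀ᵐ x, p x) : ∀ᵐ z : Space d, p z.1 :=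
  Measure.quasiMeasurePreserving_fst.ae h

theorem tensor_add (k : Fin d → ℤ) (g h : LX) : tensor k (g + h) = tensor k g + tensor k h := by
  refine Lp.ext ?_
  filter_upwards [tensor_ae k g, tensor_ae k h, tensor_ae k (g + h),
    Lp.coeFn_add (tensor k g) (tensor k h), ae_fst (Lp.coeFn_add g h)] with z h1 h2 h3 h4 h5
  rw [h3, h4, Pi.add_apply, h1, h2]
  simp only [tensorFun, h5, Pi.add_apply]
  ring

theorem tensor_smul (k : Fin d → ℤ) (c : ℂ) (g : LX) : tensor k (c • g) = c • tensor k g := by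
  refine Lp.ext ?_
  filter_upwards [tensor_ae k g, tensor_ae k (c • g),
    Lp.coeFn_smul c (tensor k g), ae_fst (Lp.coeFn_smul c g)] with z h1 h3 h4 h5
  rw [h3, h4, Pi.smul_apply, h1]
  simp only [tensorFun, h5, Pi.smul_apply, smul_eq_mul]
  ring

theorem eLpNorm_tensor (k : Fin d → ℤ) (g : LX) :
    eLpNorm (tensor k g) 2 volume = eLpNorm g 2 volume := by
  have h : eLpNorm (tensor k g) 2 volume ^ 2 = eLpNorm g 2 volume ^ 2 := by
    rw [eLpNorm_congr_ae (tensor_ae k g), eLpNorm_two_sq, eLpNorm_two_sq, Measure.volume_eq_prod,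
      lintegral_prod _ ((memLp_tensorFun k g).1.enorm.pow_const 2)]
    refine lintegral_congr fun x => ?_
    have : ∀ y : Torus d, ‖tensorFun k g (x, y)‖ₑ ^ 2 =
        ENNReal.ofReal (normConst d) ^ 2 * ‖g x‖ₑ ^ 2 := fun y => by
      simp only [tensorFun]
      rw [enorm_mul, enorm_mul, mul_pow, mul_pow]
      simp only [← ofReal_norm, norm_char, Complex.norm_real, Real.norm_of_nonneg normConst_pos.le]
      simp
    simp_rw [this]
    rw [lintegral_const, mul_right_comm, normConst_sq_mul, one_mul]
  exact (ENNReal.pow_right_strictMono two_ne_zero).injective h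

/-- `tensor k` as a linear isometry. -/
def tensorL (k : Fin d → ℤ) : LX →ₗᵢ[ℂ] L2 d where
  toFun := tensor k
  map_add' := tensor_add k
  map_smul' := tensor_smul k
  norm_map' g := by
    change ‖tensor k g‖ = ‖g‖
    rw [Lp.norm_def, Lp.norm_def, eLpNorm_tensor]

theorem tensorL_apply (k : Fin d → ℤ) (g : LX) : tensorL k g = tensor k g := rfl

theorem inner_tensor_left (k : Fin d → ℤ) (g : LX) (f : L2 d) :
    inner ℂ (tensor k g) f = inner ℂ g (mode k f) := by
  have h1 : (fun z => (inner ℂ (tensor k g z) (f z) : ℂ)) =ᵐ[volume]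
      fun z => (starRingEnd ℂ) (g z.1) *
        ((normConst d : ℂ) * (f z * (starRingEnd ℂ) (char k z.2))) := by
    filter_upwards [tensor_ae k g] with z hz
    rw [hz, RCLike.inner_apply]
    simp only [tensorFun, map_mul, Complex.conj_ofReal]
    ring
  rw [L2.inner_def, L2.inner_def, integral_congr_ae h1, integral_space]
  · refine integral_congr_ae ?_
    filter_upwards [mode_ae k f] with x hx
    rw [RCLike.inner_apply, hx, modeFun, integral_const_mul, integral_const_mul]
    ring
  · exact (integrable_congr h1).1 (L2.integrable_inner _ _)

/-- Identifying the coefficient map with the adjoint of an isometry yields its linearity and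
continuity at once, without estimates on the integral that defines it. -/
theorem mode_eq_adjoint (k : Fin d → ℤ) (f : L2 d) :
    mode k f = ContinuousLinearMap.adjoint (tensorL k).toContinuousLinearMap f := by
  refine ext_inner_left ℂ fun g => ?_
  rw [ContinuousLinearMap.adjoint_inner_right, ← inner_tensor_left]
  rfl

/-- `mode k` as a continuous linear map. -/
def modeL (k : Fin d → ℤ) : L2 d →L[ℂ] LX :=
  ContinuousLinearMap.adjoint (tensorL k).toContinuousLinearMap

theorem modeL_apply (k : Fin d → ℤ) (f : L2 d) : modeL k f = mode k f := (mode_eq_adjoint k f).symm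

theorem mode_add (k : Fin d → ℤ) (f g : L2 d) : mode k (f + g) = mode k f + mode k g := by
  simp only [← modeL_apply, map_add]

theorem mode_sub (k : Fin d → ℤ) (f g : L2 d) : mode k (f - g) = mode k f - mode k g := by
  simp only [← modeL_apply, map_sub]

theorem mode_smul (k : Fin d → ℤ) (c : ℂ) (f : L2 d) : mode k (c • f) = c • mode k f := by
  simp only [← modeL_apply, map_smul]

theorem inner_tensor_tensor {j k : Fin d → ℤ} (hjk : j ≠ k) (g h : LX) :
    inner ℂ (tensor j g) (tensor k h) = 0 := by
  have h1 : (fun z => (inner ℂ (tensor j g z) (tensor k h z) : ℂ)) =ᵐ[volume]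
      fun z => ((normConst d : ℂ) ^ 2 * ((starRingEnd ℂ) (g z.1) * h z.1)) * char (k - j) z.2 := by
    filter_upwards [tensor_ae j g, tensor_ae k h] with z h1 h2
    rw [h1, h2, RCLike.inner_apply, sub_eq_add_neg, char_add, char_neg]
    simp only [tensorFun, map_mul, Complex.conj_ofReal]
    ring
  rw [L2.inner_def, integral_congr_ae h1, integral_space]
  · simp_rw [integral_const_mul, integral_char_eq_zero (sub_ne_zero.2 hjk.symm), mul_zero,
      integral_zero]
  · exact (integrable_congr h1).1 (L2.integrable_inner _ _)

theorem mode_tensor_self (k : Fin d → ℤ) (g : LX) : mode k (tensor k g) = g := by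
  refine ext_inner_left ℂ fun h => ?_
  rw [← inner_tensor_left]
  exact (tensorL k).inner_map_map h g

theorem mode_tensor_of_ne {j k : Fin d → ℤ} (h : j ≠ k) (g : LX) : mode j (tensor k g) = 0 := by
  refine ext_inner_left ℂ fun h' => ?_
  rw [← inner_tensor_left, inner_tensor_tensor h, inner_zero_right]

/-- For almost every x the slice f(x, ·) is in L² of the torus and all its Fourier coefficients
vanish; countability of the frequencies allows one exceptional null set. Completeness of the
characters then applies slicewise. -/
theorem eq_zero_of_forall_mode {f : L2 d} (h : ∀ k, mode k f = 0) : f = 0 := by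
  have h1 : ∀ᵐ x : ℝ, ∀ k, modeFun f k x = 0 := by
    rw [ae_all_iff]
    intro k
    filter_upwards [mode_ae k f, Lp.coeFn_zero ℂ 2 (volume : Measure ℝ)] with x hx hx0
    rw [← hx, h k, hx0, Pi.zero_apply]
  have hfm := Lp.stronglyMeasurable f
  have h2 : ∀ᵐ x : ℝ, ∫⁻ y : Torus d, ‖f (x, y)‖ₑ ^ 2 < ⊤ := by
    have hm : Measurable fun z : Space d => ‖f z‖ₑ ^ 2 := hfm.measurable.enorm.pow_const 2
    refine ae_lt_top hm.lintegral_prod_right' ?_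
    rw [← lintegral_prod _ hm.aemeasurable, ← Measure.volume_eq_prod, ← eLpNorm_two_sq]
    exact ENNReal.pow_ne_top (Lp.memLp f).2.ne
  have h3 : ∀ᵐ x : ℝ, ∀ᵐ y : Torus d, f (x, y) = 0 := by
    filter_upwards [h1, h2] with x hx1 hx2
    have hm : MemLp (fun y : Torus d => f (x, y)) 2 volume := by
      refine ⟨(hfm.comp_measurable measurable_prodMk_left).aestronglyMeasurable, ?_⟩
      rw [← eLpNorm_two_sq (fun y : Torus d => f (x, y))] at hx2
      by_contra hc
      rw [not_lt, top_le_iff] at hc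
      simp [hc] at hx2
    refine ae_eq_zero_of_forall_integral_char hm fun k => ?_
    have := hx1 k
    rw [modeFun, mul_eq_zero] at this
    exact this.resolve_left (by simpa using normConst_pos.ne')
  refine Lp.ext ?_
  have h4 : ∀ᵐ z : Space d, f z = 0 := by
    exact (Measure.ae_prod_iff_ae_ae
      (measurableSet_eq_fun hfm.measurable measurable_const)).2 h3
  filter_upwards [h4, Lp.coeFn_zero ℂ 2 (volume : Measure (Space d))] with z h1 h2
  rw [h1, h2, Pi.zero_apply]

theorem ext_mode {f g : L2 d} (h : ∀ k, mode k f = mode k g) : f = g :=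
  sub_eq_zero.1 (eq_zero_of_forall_mode fun k => by rw [mode_sub, h k, sub_self])

/-- A vector orthogonal to all ranges has vanishing coefficients, hence is zero. The Fourier
expansion, Parseval and the synthesis of functions from square summable coefficients follow from the
abstract theory. -/
theorem isHilbertSum_tensor : IsHilbertSum ℂ (fun _ : Fin d → ℤ => LX) (tensorL (d := d)) := by
  refine IsHilbertSum.mk (fun j k hjk g h => inner_tensor_tensor hjk g h) ?_
  rw [top_le_iff, Submodule.topologicalClosure_eq_top_iff, Submodule.eq_bot_iff]
  intro f hf
  refine eq_zero_of_forall_mode fun k => ext_inner_left ℂ fun g => ?_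
  rw [← inner_tensor_left, inner_zero_right]
  exact (Submodule.mem_orthogonal _ _).1 hf _
    (Submodule.mem_iSup_of_mem k ⟨g, rfl⟩)

theorem exists_lp_of_L2 (f : L2 d) : ∃ w : lp (fun _ : Fin d → ℤ => LX) 2,
    (∀ k, w k = mode k f) ∧ HasSum (fun k => tensor k (w k)) f ∧ ‖w‖ = ‖f‖ := by
  let e := (isHilbertSum_tensor (d := d)).linearIsometryEquiv
  have hs : HasSum (fun k => tensor k (e f k)) f := by
    have := isHilbertSum_tensor.hasSum_linearIsometryEquiv_symm (e f)
    rwa [e.symm_apply_apply] at this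
  refine ⟨e f, fun k => ?_, hs, e.norm_map f⟩
  have h1 := hs.mapL (modeL k)
  have h2 : HasSum (fun j => modeL k (tensor j (e f j))) (e f k) := by
    have := hasSum_single (f := fun j => modeL k (tensor j (e f j))) k fun j hj => by
      rw [modeL_apply, mode_tensor_of_ne hj.symm]
    rwa [modeL_apply, mode_tensor_self] at this
  rw [← modeL_apply]
  exact h2.unique h1

/-- The Fourier expansion in `y`. -/
theorem hasSum_tensor_mode (f : L2 d) : HasSum (fun k => tensor k (mode k f)) f := by
  obtain ⟨w, hw, hs, -⟩ := exists_lp_of_L2 f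
  simpa only [hw] using hs

/-- Parseval's identity in `y`. -/
theorem hasSum_norm_mode_sq (f : L2 d) : HasSum (fun k => ‖mode k f‖ ^ 2) (‖f‖ ^ 2) := by
  obtain ⟨w, hw, -, hn⟩ := exists_lp_of_L2 f
  have := lp.hasSum_norm (p := 2) (by norm_num) w
  rw [hn] at this
  simpa [hw] using this

theorem tsum_enorm_mode_sq (f : L2 d) : ∑' k, ‖mode k f‖ₑ ^ 2 = ‖f‖ₑ ^ 2 := by
  have h := hasSum_norm_mode_sq f
  simp only [← ofReal_norm, ← ENNReal.ofReal_pow (norm_nonneg _)]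
  rw [← h.tsum_eq, ENNReal.ofReal_tsum_of_nonneg (fun _ => by positivity) h.summable]

theorem norm_mode_le (k : Fin d → ℤ) (f : L2 d) : ‖mode k f‖ ≤ ‖f‖ := by
  have h := hasSum_norm_mode_sq f
  have := h.summable.le_tsum k fun _ _ => by positivity
  rw [h.tsum_eq] at this
  exact (pow_le_pow_iff_left₀ (norm_nonneg _) (norm_nonneg _) two_ne_zero).1 this

/-- Every square summable family of functions on `ℝ` is the family of modes of a function. -/
theorem exists_hasSum_tensor {c : (Fin d → ℤ) → LX} (hc : Summable fun k => ‖c k‖ ^ 2) :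
    ∃ f : L2 d, HasSum (fun k => tensor k (c k)) f ∧ ∀ k, mode k f = c k := by
  have hsum : Summable fun k => tensorL k (c k) := by
    rw [isHilbertSum_tensor.OrthogonalFamily.summable_iff_norm_sq_summable]
    exact hc
  obtain ⟨f, hf⟩ := hsum
  refine ⟨f, hf, fun k => ?_⟩
  have h1 := hf.mapL (modeL k)
  have h2 := hasSum_single (f := fun j => modeL k (tensorL j (c j))) k fun j hj => by
    rw [modeL_apply, tensorL_apply, mode_tensor_of_ne hj.symm]
  rw [modeL_apply, tensorL_apply, mode_tensor_self] at h2
  rw [← modeL_apply]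
  exact h1.unique h2

end

/-! ### Weighted sequence spaces -/

section

variable {d : ℕ}

theorem sqAbs_nonneg (k : Fin d → ℤ) : 0 ≤ sqAbs k :=
  Finset.sum_nonneg fun _ _ => sq_nonneg _

/-- The weight `(1 + |k|²)^s`. -/
def wt (s : ℝ) (k : Fin d → ℤ) : ℝ≥0∞ := ENNReal.ofReal ((1 + sqAbs k) ^ s)

theorem wt_ne_top (s : ℝ) (k : Fin d → ℤ) : wt s k ≠ ⊤ := ENNReal.ofReal_ne_top

theorem wt_neg_mul (s : ℝ) (k : Fin d → ℤ) : wt (-s) k * wt s k = 1 := by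
  have := sqAbs_nonneg k
  rw [wt, wt, ← ENNReal.ofReal_mul (by positivity), ← Real.rpow_add (by positivity)]
  simp

theorem one_le_wt {s : ℝ} (hs : 0 ≤ s) (k : Fin d → ℤ) : 1 ≤ wt s k := by
  have := sqAbs_nonneg k
  rw [wt, ENNReal.one_le_ofReal]
  exact Real.one_le_rpow (by linarith) hs

theorem sqAbs_le (k j : Fin d → ℤ) : sqAbs k ≤ 2 * sqAbs (k - j) + 2 * sqAbs j := by
  unfold sqAbs
  rw [Finset.mul_sum, Finset.mul_sum, ← Finset.sum_add_distrib]
  refine Finset.sum_le_sum fun i _ => ?_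
  simp only [Pi.sub_apply]
  push_cast
  nlinarith [sq_nonneg ((k i : ℝ) - 2 * j i)]

theorem sqAbs_neg (k : Fin d → ℤ) : sqAbs (-k) = sqAbs k := by
  simp [sqAbs]

/-- Since |k|² ≤ 2|k−j|² + 2|j|², the larger of the two frequencies carries the weight, with 1 +
|k|² at most four times 1 plus its square. -/
theorem wt_le {s : ℝ} (hs : 0 ≤ s) (k j : Fin d → ℤ) :
    wt s k ≤ ENNReal.ofReal (4 ^ s) * (wt s (k - j) + wt s j) := by
  have h1 := sqAbs_nonneg k
  have h2 := sqAbs_nonneg j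
  have h3 := sqAbs_nonneg (k - j)
  have h := sqAbs_le k j
  have key : ∀ a : ℝ, 0 ≤ a → 1 + sqAbs k ≤ 4 * (1 + a) →
      wt s k ≤ ENNReal.ofReal (4 ^ s) * ENNReal.ofReal ((1 + a) ^ s) := fun a ha hle => by
    rw [← ENNReal.ofReal_mul (by positivity), ← Real.mul_rpow (by norm_num) (by positivity)]
    exact ENNReal.ofReal_le_ofReal (Real.rpow_le_rpow (by positivity) hle hs)
  rw [mul_add]
  rcases le_total (sqAbs (k - j)) (sqAbs j) with hc | hc
  · exact (key _ h2 (by linarith)).trans le_add_self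
  · exact (key _ h3 (by linarith)).trans le_self_add

theorem tsum_prod_pow (a : ℤ → ℝ≥0∞) (d : ℕ) :
    ∑' k : Fin d → ℤ, ∏ i, a (k i) = (∑' n, a n) ^ d := by
  induction d with
  | zero => simp
  | succ d ih =>
    rw [← (Fin.consEquiv fun _ => ℤ).tsum_eq, ENNReal.tsum_prod', pow_succ', ← ih,
      ← ENNReal.tsum_mul_right]
    refine tsum_congr fun n => ?_
    rw [← ENNReal.tsum_mul_left]
    refine tsum_congr fun k => ?_
    rw [Fin.prod_univ_succ]
    simp [Fin.consEquiv]

theorem tsum_one_add_sq_rpow_ne_top {p : ℝ} (hp : 1 / 2 < p) :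
    ∑' n : ℤ, ENNReal.ofReal ((1 + (n : ℝ) ^ 2) ^ (-p)) ≠ ⊤ := by
  have h1 : Summable fun n : ℤ => |(n : ℝ)| ^ (-(2 * p)) :=
    Real.summable_abs_int_rpow (by linarith)
  have h2 : Summable fun n : ℤ => if n = 0 then (1 : ℝ) else 0 :=
    summable_of_ne_finset_zero (s := {0}) fun n hn => by
      rw [if_neg (by simpa using hn)]
  have h3 : Summable fun n : ℤ => (1 + (n : ℝ) ^ 2) ^ (-p) := by
    refine Summable.of_nonneg_of_le (fun n => by positivity) (fun n => ?_) (h1.add h2)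
    by_cases hn : n = 0
    · simp only [hn, if_true]
      norm_num
      positivity
    · have hn' : 0 < |(n : ℝ)| := abs_pos.2 (by exact_mod_cast hn)
      rw [if_neg hn, add_zero, ← mul_neg, Real.rpow_mul hn'.le]
      refine Real.rpow_le_rpow_of_nonpos (by positivity) ?_ (by linarith)
      rw [Real.rpow_ofNat, sq_abs]
      linarith
  exact h3.tsum_ofReal_ne_top

/-- Split (1+|k|²)^{-s} into d equal powers and bound each by (1+k_i²)^{-s/d}. The sum factorises
into one-dimensional sums, which converge because s/d > 1/2. This is where s > d/2 is used. -/
theorem tsum_wt_neg_ne_top (hd : 1 ≤ d) {s : ℝ} (hs : (d : ℝ) / 2 < s) :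
    ∑' k : Fin d → ℤ, wt (-s) k ≠ ⊤ := by
  have hd' : (0 : ℝ) < d := by exact_mod_cast hd
  have hp : 1 / 2 < s / d := by rw [lt_div_iff₀ hd']; linarith
  refine ne_top_of_le_ne_top (b := ∑' k : Fin d → ℤ,
    ∏ i, ENNReal.ofReal ((1 + (k i : ℝ) ^ 2) ^ (-(s / d)))) ?_ (ENNReal.tsum_le_tsum fun k => ?_)
  · rw [tsum_prod_pow (fun n => ENNReal.ofReal ((1 + (n : ℝ) ^ 2) ^ (-(s / d))))]
    exact ENNReal.pow_ne_top (tsum_one_add_sq_rpow_ne_top hp)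
  · have h0 := sqAbs_nonneg k
    have h1 : wt (-s) k = ∏ _i : Fin d, ENNReal.ofReal ((1 + sqAbs k) ^ (-(s / d))) := by
      rw [Finset.prod_const, Finset.card_univ, Fintype.card_fin, ← ENNReal.ofReal_pow
        (by positivity), ← Real.rpow_natCast, ← Real.rpow_mul (by positivity), wt]
      congr 2
      field_simp
    rw [h1]
    refine Finset.prod_le_prod' fun i _ => ENNReal.ofReal_le_ofReal ?_
    refine Real.rpow_le_rpow_of_nonpos (by positivity) ?_ (by linarith)
    have : (k i : ℝ) ^ 2 ≤ sqAbs k :=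
      Finset.single_le_sum (f := fun i => (k i : ℝ) ^ 2) (fun _ _ => sq_nonneg _)
        (Finset.mem_univ i)
    linarith

theorem tsum_mul_sq_le {ι : Type*} (a b : ι → ℝ≥0∞) :
    (∑' i, a i * b i) ^ 2 ≤ (∑' i, a i ^ 2) * ∑' i, b i ^ 2 := by
  let _ : MeasurableSpace ι := ⊤
  have h := ENNReal.lintegral_mul_le_Lp_mul_Lq (Measure.count : Measure ι)
    (p := 2) (q := 2) ⟨by norm_num, by norm_num, by norm_num⟩ (f := a) (g := b)
    measurable_from_top.aemeasurable measurable_from_top.aemeasurable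
  simp only [lintegral_count, Pi.mul_apply, ENNReal.rpow_ofNat] at h
  calc _ ≤ ((∑' i, a i ^ 2) ^ (1 / 2 : ℝ) * (∑' i, b i ^ 2) ^ (1 / 2 : ℝ)) ^ 2 := by gcongr
    _ = _ := by
      rw [mul_pow, ← ENNReal.rpow_natCast, ← ENNReal.rpow_mul, ← ENNReal.rpow_natCast,
        ← ENNReal.rpow_mul]
      norm_num

/-- The norm of `ℓ²` with the weight `(1 + |k|²)^s`. -/
def ell (s : ℝ) (α : (Fin d → ℤ) → ℝ≥0∞) : ℝ≥0∞ := (∑' k, wt s k * α k ^ 2) ^ (1 / 2 : ℝ)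

theorem ell_sq (s : ℝ) (α : (Fin d → ℤ) → ℝ≥0∞) : ell s α ^ 2 = ∑' k, wt s k * α k ^ 2 := by
  rw [ell, ← ENNReal.rpow_natCast, ← ENNReal.rpow_mul]
  norm_num

theorem le_of_sq_le_sq' {a b : ℝ≥0∞} (h : a ^ 2 ≤ b ^ 2) : a ≤ b :=
  (ENNReal.pow_le_pow_left_iff two_ne_zero).1 h

theorem ell_mono {s : ℝ} {α β : (Fin d → ℤ) → ℝ≥0∞} (h : ∀ k, α k ≤ β k) : ell s α ≤ ell s β := by
  unfold ell
  gcongr with k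
  exact h k

theorem ell_const_mul (s : ℝ) (c : ℝ≥0∞) (α : (Fin d → ℤ) → ℝ≥0∞) :
    ell s (fun k => c * α k) = c * ell s α := by
  refine (ENNReal.pow_right_strictMono two_ne_zero).injective ?_
  rw [mul_pow, ell_sq, ell_sq, ← ENNReal.tsum_mul_left]
  refine tsum_congr fun k => ?_
  ring

theorem ell_add_le (s : ℝ) (α β : (Fin d → ℤ) → ℝ≥0∞) :
    ell s (fun k => α k + β k) ≤ ell s α + ell s β := by
  let _ : MeasurableSpace (Fin d → ℤ) := ⊤
  have h := ENNReal.lintegral_Lp_add_le (μ := (Measure.count : Measure (Fin d → ℤ))) (p := 2)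
    (f := fun k => wt s k ^ (1 / 2 : ℝ) * α k) (g := fun k => wt s k ^ (1 / 2 : ℝ) * β k)
    measurable_from_top.aemeasurable measurable_from_top.aemeasurable (by norm_num)
  simp only [lintegral_count, Pi.add_apply, ENNReal.rpow_ofNat, ← mul_add] at h
  have e : ∀ γ : (Fin d → ℤ) → ℝ≥0∞, ∑' k, (wt s k ^ (1 / 2 : ℝ) * γ k) ^ 2 =
      ∑' k, wt s k * γ k ^ 2 := fun γ => tsum_congr fun k => by
    rw [mul_pow, ← ENNReal.rpow_natCast, ← ENNReal.rpow_mul]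
    norm_num
  rwa [e, e, e] at h

theorem tsum_le_ell (s : ℝ) (α : (Fin d → ℤ) → ℝ≥0∞) :
    ∑' k, α k ≤ (∑' k : Fin d → ℤ, wt (-s) k) ^ (1 / 2 : ℝ) * ell s α := by
  refine le_of_sq_le_sq' ?_
  rw [mul_pow, ell_sq, ← ENNReal.rpow_natCast (_ ^ _), ← ENNReal.rpow_mul]
  norm_num only [Nat.cast_ofNat]
  rw [ENNReal.rpow_one]
  have h := tsum_mul_sq_le (fun k => wt (-s) k ^ (1 / 2 : ℝ)) (fun k => wt s k ^ (1 / 2 : ℝ) * α k)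
  have e1 : ∀ k, wt (-s) k ^ (1 / 2 : ℝ) * (wt s k ^ (1 / 2 : ℝ) * α k) = α k := fun k => by
    rw [← mul_assoc, ← ENNReal.mul_rpow_of_nonneg _ _ (by norm_num), wt_neg_mul]
    simp
  have e2 : ∀ (r : ℝ) (k : Fin d → ℤ), (wt r k ^ (1 / 2 : ℝ)) ^ 2 = wt r k := fun r k => by
    rw [← ENNReal.rpow_natCast, ← ENNReal.rpow_mul]
    norm_num
  simpa only [e1, mul_pow, e2] using h

/-- Fatou's lemma for counting measure. -/
theorem ell_liminf_le {s : ℝ} {α : ℕ → (Fin d → ℤ) → ℝ≥0∞} {β : (Fin d → ℤ) → ℝ≥0∞} {C : ℝ≥0∞}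
    (h : ∀ k, β k ≤ liminf (fun n => α n k) atTop) (hC : ∀ᶠ n in atTop, ell s (α n) ≤ C) :
    ell s β ≤ C := by
  refine le_of_sq_le_sq' ?_
  rw [ell_sq]
  let _ : MeasurableSpace (Fin d → ℤ) := ⊤
  have h1 : ∑' k, wt s k * β k ^ 2 ≤ ∑' k, liminf (fun n => wt s k * α n k ^ 2) atTop := by
    refine ENNReal.tsum_le_tsum fun k => ?_
    have hc : Continuous fun x : ℝ≥0∞ => wt s k * x ^ 2 :=
      (ENNReal.continuous_const_mul (wt_ne_top s k)).comp (ENNReal.continuous_pow 2)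
    have hm : Monotone fun x : ℝ≥0∞ => wt s k * x ^ 2 := fun x y hxy => by
      simp only; gcongr
    have := hm.map_liminf_of_continuousAt (F := atTop) (fun n => α n k) hc.continuousAt
    calc _ ≤ wt s k * (liminf (fun n => α n k) atTop) ^ 2 := hm (h k)
      _ = _ := this
  have h2 := lintegral_liminf_le (u := atTop) (μ := (Measure.count : Measure (Fin d → ℤ)))
    (f := fun n k => wt s k * α n k ^ 2) (fun n => measurable_from_top)
  simp only [lintegral_count, ← ell_sq] at h2
  refine h1.trans (h2.trans ?_)
  calc _ ≤ liminf (fun _ : ℕ => C ^ 2) atTop := by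
        refine liminf_le_liminf ?_
        filter_upwards [hC] with n hn
        gcongr
    _ = _ := liminf_const _

/-- Weighted convolution inequality: for `s > d/2` the space `ell s` is a convolution algebra. -/
theorem ell_conv_le {s : ℝ} (hs : 0 ≤ s) (α β : (Fin d → ℤ) → ℝ≥0∞) :
    ell s (fun k => ∑' j, α (k - j) * β j) ≤
      (2 * ENNReal.ofReal (4 ^ s) * ∑' k : Fin d → ℤ, wt (-s) k) ^ (1 / 2 : ℝ) *
        (ell s α * ell s β) := by
  set c := ENNReal.ofReal (4 ^ s)
  set S := ∑' k : Fin d → ℤ, wt (-s) k with hS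
  refine le_of_sq_le_sq' ?_
  rw [mul_pow, mul_pow, ell_sq, ← ENNReal.rpow_natCast (_ ^ _), ← ENNReal.rpow_mul]
  norm_num only [Nat.cast_ofNat]
  rw [ENNReal.rpow_one]
  have hk : ∀ k, wt s k * (∑' j, α (k - j) * β j) ^ 2 ≤
      2 * c * S * ∑' j, (wt s (k - j) * α (k - j) ^ 2) * (wt s j * β j ^ 2) := fun k => by
    -- Cauchy–Schwarz in j with both weights inserted. What remains is that wt(k) Σ_j wt(k−j)^{-1}
    -- wt(j)^{-1} is bounded uniformly in k, which follows by splitting wt(k) between the two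
    -- frequencies.
    have h := tsum_mul_sq_le (fun j => (wt (-s) (k - j) * wt (-s) j) ^ (1 / 2 : ℝ))
      (fun j => (wt s (k - j) * wt s j) ^ (1 / 2 : ℝ) * (α (k - j) * β j))
    have e1 : ∀ j, (wt (-s) (k - j) * wt (-s) j) ^ (1 / 2 : ℝ) *
        ((wt s (k - j) * wt s j) ^ (1 / 2 : ℝ) * (α (k - j) * β j)) = α (k - j) * β j :=
      fun j => by
        rw [← mul_assoc, ← ENNReal.mul_rpow_of_nonneg _ _ (by norm_num), mul_mul_mul_comm,
          wt_neg_mul, wt_neg_mul]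
        simp
    have e2 : ∀ x : ℝ≥0∞, (x ^ (1 / 2 : ℝ)) ^ 2 = x := fun x => by
      rw [← ENNReal.rpow_natCast, ← ENNReal.rpow_mul]
      norm_num
    simp only [e1, mul_pow, e2] at h
    have h2 : wt s k * ∑' j, wt (-s) (k - j) * wt (-s) j ≤ 2 * c * S := by
      rw [← ENNReal.tsum_mul_left]
      calc _ ≤ ∑' j, (c * wt (-s) j + c * wt (-s) (k - j)) := by
            refine ENNReal.tsum_le_tsum fun j => ?_
            calc _ ≤ c * (wt s (k - j) + wt s j) * (wt (-s) (k - j) * wt (-s) j) := by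
                  gcongr; exact wt_le hs k j
              _ = c * (wt (-s) (k - j) * wt s (k - j)) * wt (-s) j +
                  c * (wt (-s) j * wt s j) * wt (-s) (k - j) := by ring
              _ = _ := by rw [wt_neg_mul, wt_neg_mul, mul_one]
        _ = c * S + c * S := by
            rw [ENNReal.tsum_add, ENNReal.tsum_mul_left, ENNReal.tsum_mul_left]
            congr 2
            exact (Equiv.subLeft k).tsum_eq (wt (-s))
        _ = _ := by ring
    calc _ ≤ wt s k * ((∑' j, wt (-s) (k - j) * wt (-s) j) *
          ∑' j, wt s (k - j) * wt s j * (α (k - j) ^ 2 * β j ^ 2)) := by gcongr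
      _ = (wt s k * ∑' j, wt (-s) (k - j) * wt (-s) j) *
          ∑' j, (wt s (k - j) * α (k - j) ^ 2) * (wt s j * β j ^ 2) := by
          rw [← mul_assoc]
          congr 1
          refine tsum_congr fun j => ?_
          ring
      _ ≤ _ := by gcongr
  calc _ ≤ ∑' k, 2 * c * S * ∑' j, (wt s (k - j) * α (k - j) ^ 2) * (wt s j * β j ^ 2) :=
        ENNReal.tsum_le_tsum hk
    _ = 2 * c * S * ∑' j, ∑' k, (wt s (k - j) * α (k - j) ^ 2) * (wt s j * β j ^ 2) := by
        rw [ENNReal.tsum_mul_left, ENNReal.tsum_comm]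
    _ = 2 * c * S * (ell s α ^ 2 * ell s β ^ 2) := by
        congr 1
        simp_rw [ENNReal.tsum_mul_right]
        rw [ell_sq s β, ← ENNReal.tsum_mul_left]
        refine tsum_congr fun j => ?_
        congr 1
        rw [ell_sq]
        exact (Equiv.subRight j).tsum_eq (fun k => wt s k * α k ^ 2)
    _ = _ := by ring

theorem hsNorm_eq_ell (s : ℝ) (f : L2 d) : hsNorm s f = ell s fun k => ‖mode k f‖ₑ := by
  unfold hsNorm ell
  congr 1
  refine tsum_congr fun k => ?_
  simp only [Lp.enorm_def, eLpNorm_congr_ae (mode_ae k f)]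
  rfl

theorem enorm_le_hsNorm {s : ℝ} (hs : 0 ≤ s) (f : L2 d) : ‖f‖ₑ ≤ hsNorm s f := by
  refine le_of_sq_le_sq' ?_
  rw [hsNorm_eq_ell, ell_sq, ← tsum_enorm_mode_sq]
  exact ENNReal.tsum_le_tsum fun k => le_mul_of_one_le_left zero_le (one_le_wt hs k)

end

/-! ### The linear group on the product space and Duhamel integrals -/

section

variable {d : ℕ}

/-- The phase `e^{-it|k|²/2}`. -/
def phase (t : ℝ) (k : Fin d → ℤ) : ℂ := Complex.exp (-(Complex.I * t * sqAbs k / 2))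

theorem norm_phase (t : ℝ) (k : Fin d → ℤ) : ‖phase t k‖ = 1 := by
  have : phase t k = Complex.exp (((-(t * sqAbs k / 2) : ℝ) : ℂ) * Complex.I) := by
    unfold phase; congr 1; push_cast; ring
  rw [this, Complex.norm_exp_ofReal_mul_I]

theorem phase_add (s t : ℝ) (k : Fin d → ℤ) : phase (s + t) k = phase s k * phase t k := by
  unfold phase
  rw [← Complex.exp_add]
  congr 1; push_cast; ring

theorem phase_zero (k : Fin d → ℤ) : phase 0 k = 1 := by simp [phase]

theorem U_eq_tsum (t : ℝ) (f : L2 d) :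
    U t f = ∑' k, tensor k (phase t k • evolX t (mode k f)) := rfl

/-- The evolved coefficients keep their norms, hence are square summable, so the series that defines
U converges and its sum is not the default value 0. From here U is handled mode by mode. -/
theorem mode_U (t : ℝ) (f : L2 d) (k : Fin d → ℤ) :
    mode k (U t f) = phase t k • evolX t (mode k f) := by
  obtain ⟨g, hg, hm⟩ := exists_hasSum_tensor (c := fun k => phase t k • evolX t (mode k f)) (by
    simp_rw [norm_smul, norm_phase, one_mul, norm_evolX]
    exact (hasSum_norm_mode_sq f).summable)
  rw [U_eq_tsum, hg.tsum_eq, hm]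

theorem norm_mode_U (t : ℝ) (f : L2 d) (k : Fin d → ℤ) : ‖mode k (U t f)‖ = ‖mode k f‖ := by
  rw [mode_U, norm_smul, norm_phase, one_mul, norm_evolX]

theorem U_add (t : ℝ) (f g : L2 d) : U t (f + g) = U t f + U t g := by
  refine ext_mode fun k => ?_
  rw [mode_add, mode_U, mode_U, mode_U, mode_add, evolX_add, smul_add]

theorem U_smul (t : ℝ) (c : ℂ) (f : L2 d) : U t (c • f) = c • U t f := by
  refine ext_mode fun k => ?_
  rw [mode_smul, mode_U, mode_U, mode_smul, evolX_smul, smul_comm]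

theorem norm_U (t : ℝ) (f : L2 d) : ‖U t f‖ = ‖f‖ := by
  have h1 := hasSum_norm_mode_sq (U t f)
  simp_rw [norm_mode_U] at h1
  exact (pow_left_inj₀ (norm_nonneg _) (norm_nonneg _) two_ne_zero).1
    (h1.unique (hasSum_norm_mode_sq f))

/-- The group `U(t)` as a linear isometry. -/
def UL (t : ℝ) : L2 d →ₗᵢ[ℂ] L2 d where
  toFun := U t
  map_add' := U_add t
  map_smul' := U_smul t
  norm_map' := norm_U t

theorem UL_apply (t : ℝ) (f : L2 d) : UL t f = U t f := rfl

theorem U_sub (t : ℝ) (f g : L2 d) : U t (f - g) = U t f - U t g := (UL t).map_sub f g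

theorem U_U (s t : ℝ) (f : L2 d) : U s (U t f) = U (s + t) f := by
  refine ext_mode fun k => ?_
  rw [mode_U, mode_U, mode_U, evolX_smul, evolX_evolX, smul_smul, phase_add]

theorem U_zero (f : L2 d) : U 0 f = f := by
  refine ext_mode fun k => ?_
  rw [mode_U, evolX_zero, phase_zero, one_smul]

theorem inner_U_left (t : ℝ) (f g : L2 d) : inner ℂ (U t f) g = inner ℂ f (U (-t) g) := by
  have := (UL (-t)).inner_map_map (U t f) g
  rw [UL_apply, UL_apply, U_U, neg_add_cancel, U_zero] at this
  exact this.symm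

theorem continuous_mode_U (f : L2 d) (k : Fin d → ℤ) : Continuous fun t => mode k (U t f) := by
  simp_rw [mode_U]
  have := continuous_evolX (mode k f)
  unfold phase
  fun_prop

theorem continuous_U (f : L2 d) : Continuous fun t => U t f := by
  rw [continuous_iff_continuousAt]
  intro t₀
  rw [ContinuousAt, tendsto_iff_norm_sub_tendsto_zero]
  have h1 : Tendsto (fun t => ‖U t f - U t₀ f‖ ^ 2) (𝓝 t₀) (𝓝 0) := by
    have h2 : ∀ t, ‖U t f - U t₀ f‖ ^ 2 = ∑' k, ‖mode k (U t f) - mode k (U t₀ f)‖ ^ 2 :=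
      fun t => by
        simp_rw [← mode_sub]
        exact (hasSum_norm_mode_sq _).tsum_eq.symm
    simp_rw [h2]
    rw [← tsum_zero (α := ℝ) (β := Fin d → ℤ)]
    refine tendsto_tsum_of_dominated_convergence (bound := fun k => 4 * ‖mode k f‖ ^ 2)
      ((hasSum_norm_mode_sq f).summable.mul_left 4) (fun k => ?_) (Eventually.of_forall fun t k => ?_)
    · have h3 : Continuous fun t => ‖mode k (U t f) - mode k (U t₀ f)‖ ^ 2 := by
        have := continuous_mode_U f k
        fun_prop
      simpa using h3.tendsto t₀
    · rw [norm_pow, norm_norm]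
      have := norm_sub_le (mode k (U t f)) (mode k (U t₀ f))
      rw [norm_mode_U, norm_mode_U] at this
      calc _ ≤ (‖mode k f‖ + ‖mode k f‖) ^ 2 := by gcongr
        _ = _ := by ring
  have h4 := h1.sqrt
  simpa using h4

theorem continuous_U_uncurry : Continuous fun p : ℝ × L2 d => U p.1 p.2 := by
  rw [continuous_iff_continuousAt]
  rintro ⟨t₀, f₀⟩
  rw [ContinuousAt, tendsto_iff_norm_sub_tendsto_zero]
  have h1 : Tendsto (fun p : ℝ × L2 d => ‖p.2 - f₀‖ + ‖U p.1 f₀ - U t₀ f₀‖)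
      (𝓝 (t₀, f₀)) (𝓝 0) := by
    have : Continuous fun p : ℝ × L2 d => ‖p.2 - f₀‖ + ‖U p.1 f₀ - U t₀ f₀‖ := by
      have := (continuous_U f₀).comp (continuous_fst (X := ℝ) (Y := L2 d))
      simp only [Function.comp_def] at this
      fun_prop
    simpa using this.tendsto (t₀, f₀)
  refine squeeze_zero (fun _ => norm_nonneg _) (fun p => ?_) h1
  rw [← norm_U p.1 (p.2 - f₀), U_sub]
  exact norm_sub_le_norm_sub_add_norm_sub _ _ _

theorem stronglyMeasurable_U_comp {X : Type*} [MeasurableSpace X] {τ : X → ℝ} {F : X → L2 d}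
    (hτ : Measurable τ) (hF : StronglyMeasurable F) :
    StronglyMeasurable fun x => U (τ x) (F x) :=
  stronglyMeasurable_comp_prodMk continuous_U_uncurry hτ hF

theorem aestronglyMeasurable_U_comp {μ : Measure ℝ} {τ : ℝ → ℝ} {F : ℝ → L2 d}
    (hτ : Measurable τ) (hF : AEStronglyMeasurable F μ) :
    AEStronglyMeasurable (fun x => U (τ x) (F x)) μ := by
  refine ⟨fun x => U (τ x) (hF.mk F x), stronglyMeasurable_U_comp hτ hF.stronglyMeasurable_mk, ?_⟩
  filter_upwards [hF.ae_eq_mk] with x hx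
  rw [hx]

theorem enorm_U (t : ℝ) (f : L2 d) : ‖U t f‖ₑ = ‖f‖ₑ := by
  rw [← ofReal_norm, norm_U, ofReal_norm]

theorem enorm_evolX (t : ℝ) (f : LX) : ‖evolX t f‖ₑ = ‖f‖ₑ := by
  rw [← ofReal_norm, norm_evolX, ofReal_norm]

theorem enorm_mode_U (t : ℝ) (f : L2 d) (k : Fin d → ℤ) : ‖mode k (U t f)‖ₑ = ‖mode k f‖ₑ := by
  rw [← ofReal_norm, norm_mode_U, ofReal_norm]

/-- The Duhamel integral `∫₀ᵗ U(t - τ) F(τ) dτ`. -/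
def duh (F : ℝ → L2 d) (t : ℝ) : L2 d := ∫ τ in (0 : ℝ)..t, U (t - τ) (F τ)

theorem intervalIntegrable_U {F : ℝ → L2 d} {a b : ℝ} (hF : IntervalIntegrable F volume a b)
    {τ : ℝ → ℝ} (hτ : Measurable τ) :
    IntervalIntegrable (fun r => U (τ r) (F r)) volume a b := by
  rw [intervalIntegrable_iff] at hF ⊢
  refine hF.norm.mono' (aestronglyMeasurable_U_comp hτ hF.aestronglyMeasurable)
    (Eventually.of_forall fun r => ?_)
  rw [norm_U]

theorem duh_eq_U {F : ℝ → L2 d} {t : ℝ} (hF : IntervalIntegrable F volume 0 t) :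
    duh F t = U t (∫ τ in (0 : ℝ)..t, U (-τ) (F τ)) := by
  have h := (UL (d := d) t).toContinuousLinearMap.intervalIntegral_comp_comm
    (intervalIntegrable_U hF measurable_neg)
  simp only [LinearIsometry.coe_toContinuousLinearMap, UL_apply, U_U] at h
  rw [← h]
  rfl

theorem mode_duh {F : ℝ → L2 d} {t : ℝ} (hF : IntervalIntegrable F volume 0 t) (k : Fin d → ℤ) :
    mode k (duh F t) = ∫ τ in (0 : ℝ)..t, phase (t - τ) k • evolX (t - τ) (mode k (F τ)) := by
  have hm : Measurable fun τ : ℝ => t - τ := measurable_const.sub measurable_id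
  have h := (modeL (d := d) k).intervalIntegral_comp_comm (intervalIntegrable_U hF hm)
  simp only [modeL_apply] at h
  rw [duh, ← h]
  simp_rw [mode_U]

theorem enorm_duh_le {F : ℝ → L2 d} (t : ℝ) :
    ‖duh F t‖ₑ ≤ ∫⁻ τ in uIoc 0 t, ‖F τ‖ₑ := by
  have h : ‖duh F t‖ₑ = ‖∫ τ in uIoc 0 t, U (t - τ) (F τ)‖ₑ := by
    rw [← ofReal_norm, ← ofReal_norm, duh, intervalIntegral.norm_integral_eq_norm_integral_uIoc]
  rw [h]
  refine (enorm_integral_le_lintegral_enorm _).trans_eq ?_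
  simp_rw [enorm_U]

theorem duh_sub {F G : ℝ → L2 d} {t : ℝ} (hF : IntervalIntegrable F volume 0 t)
    (hG : IntervalIntegrable G volume 0 t) : duh F t - duh G t = duh (fun τ => F τ - G τ) t := by
  have hm : Measurable fun τ : ℝ => t - τ := measurable_const.sub measurable_id
  unfold duh
  rw [← intervalIntegral.integral_sub (intervalIntegrable_U hF hm) (intervalIntegrable_U hG hm)]
  simp_rw [U_sub]

theorem continuousOn_comp_prodMk {E : Type*} [TopologicalSpace E] {G : ℝ × E → E}
    (hG : Continuous G) {F : ℝ → E} {s : Set ℝ} (hF : ContinuousOn F s) :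
    ContinuousOn (fun t => G (t, F t)) s :=
  hG.comp_continuousOn (continuousOn_id.prodMk hF)

/-- Factoring U(t) out leaves a primitive of an integrable function, so the dependence on t inside
the integrand disappears; joint continuity of the group does the rest. -/
theorem continuousOn_duh {F : ℝ → L2 d} {a b : ℝ} (ha : a ≤ 0) (hb : 0 ≤ b)
    (hF : IntegrableOn F (Icc a b)) : ContinuousOn (duh F) (Icc a b) := by
  have h0 : IntervalIntegrable F volume a b := by
    rw [intervalIntegrable_iff_integrableOn_Icc_of_le (ha.trans hb)]
    exact hF
  have h1 : ContinuousOn (fun t => ∫ τ in (0 : ℝ)..t, U (-τ) (F τ)) (Icc a b) := by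
    have := intervalIntegral.continuousOn_primitive_interval'
      (intervalIntegrable_U h0 measurable_neg) (a := 0) (by
        rw [uIcc_of_le (ha.trans hb)]; exact ⟨ha, hb⟩)
    rwa [uIcc_of_le (ha.trans hb)] at this
  refine ContinuousOn.congr (f := fun t => U t (∫ τ in (0 : ℝ)..t, U (-τ) (F τ))) ?_
    fun t ht => ?_
  · exact continuousOn_comp_prodMk continuous_U_uncurry h1
  · refine duh_eq_U (h0.mono_set ?_)
    rw [uIcc_of_le (ha.trans hb)]
    exact uIcc_subset_Icc ⟨ha, hb⟩ ht

end

/-! ### Fourier coefficients of products -/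

section

variable {d : ℕ}

theorem modeFun_congr {f g : Space d → ℂ} (h : f =ᵐ[volume] g) (k : Fin d → ℤ) :
    modeFun f k =ᵐ[volume] modeFun g k := by
  filter_upwards [Measure.ae_ae_of_ae_prod h] with x hx
  unfold modeFun
  congr 1
  refine integral_congr_ae ?_
  filter_upwards [hx] with y hy
  rw [hy]

theorem mode_ae_of_ae {f : L2 d} {g : Space d → ℂ} (h : f =ᵐ[volume] g) (k : Fin d → ℤ) :
    mode k f =ᵐ[volume] modeFun g k :=
  (mode_ae k f).trans (modeFun_congr h k)

theorem modeFun_mul_tensorFun (f : Space d → ℂ) (g : ℝ → ℂ) (j k : Fin d → ℤ) (x : ℝ) :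
    modeFun (fun z => f z * tensorFun j g z) k x =
      (normConst d : ℂ) * (g x * modeFun f (k - j) x) := by
  unfold modeFun tensorFun
  rw [← integral_const_mul, ← integral_const_mul, ← integral_const_mul, ← integral_const_mul]
  refine integral_congr_ae (Eventually.of_forall fun y => ?_)
  have h : char j y * (starRingEnd ℂ) (char k y) = (starRingEnd ℂ) (char (k - j) y) := by
    rw [sub_eq_add_neg, char_add, char_neg, map_mul, Complex.conj_conj, mul_comm]
  simp only
  rw [← h]
  ring

theorem modeFun_conj (f : Space d → ℂ) (k : Fin d → ℤ) (x : ℝ) :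
    modeFun (fun z => (starRingEnd ℂ) (f z)) k x = (starRingEnd ℂ) (modeFun f (-k) x) := by
  unfold modeFun
  rw [map_mul, Complex.conj_ofReal, ← integral_conj]
  congr 1
  refine integral_congr_ae (Eventually.of_forall fun y => ?_)
  simp only [char_neg, map_mul, Complex.conj_conj]

theorem star_ae {α : Type*} [MeasurableSpace α] {μ : Measure α} (f : Lp ℂ 2 μ) :
    (star f : Lp ℂ 2 μ) =ᵐ[μ] fun z => (starRingEnd ℂ) (f z) := Lp.coeFn_star f

theorem mode_star_ae (f : L2 d) (k : Fin d → ℤ) :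
    mode k (star f) =ᵐ[volume] fun x => (starRingEnd ℂ) (mode (-k) f x) := by
  filter_upwards [mode_ae_of_ae (star_ae f) k, mode_ae (-k) f] with x h1 h2
  rw [h1, h2, modeFun_conj]

theorem eLpNorm_mode_star (f : L2 d) (k : Fin d → ℤ) (p : ℝ≥0∞) :
    eLpNorm (mode k (star f)) p volume = eLpNorm (mode (-k) f) p volume := by
  refine eLpNorm_congr_norm_ae ?_
  filter_upwards [mode_star_ae f k] with x hx
  rw [hx, RCLike.norm_conj]

/-- The constant `(2π)^{-d/2}` in `[0, ∞]`. -/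
def cst (d : ℕ) : ℝ≥0∞ := ENNReal.ofReal (normConst d)

theorem enorm_normConst : ‖(normConst d : ℂ)‖ₑ = cst d := by
  rw [← ofReal_norm, Complex.norm_real, Real.norm_of_nonneg normConst_pos.le, cst]

theorem cst_ne_top : cst d ≠ ⊤ := ENNReal.ofReal_ne_top

theorem ae_enorm_le_eLpNorm_top {α : Type*} [MeasurableSpace α] {μ : Measure α} (f : α → ℂ) :
    ∀ᵐ x ∂μ, ‖f x‖ₑ ≤ eLpNorm f ⊤ μ := by
  rw [eLpNorm_exponent_top]
  exact ae_le_eLpNormEssSup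

theorem eLpNorm_top_le_of_ae {α : Type*} [MeasurableSpace α] {μ : Measure α} {f : α → ℂ} {C : ℝ≥0∞}
    (h : ∀ᵐ x ∂μ, ‖f x‖ₑ ≤ C) : eLpNorm f ⊤ μ ≤ C := by
  rw [eLpNorm_exponent_top]
  exact eLpNormEssSup_le_of_ae_enorm_bound h

theorem eLpNorm_tensor_top_le (k : Fin d → ℤ) (g : LX) :
    eLpNorm (tensor k g) ⊤ volume ≤ cst d * eLpNorm g ⊤ volume := by
  refine eLpNorm_top_le_of_ae ?_
  filter_upwards [tensor_ae k g, ae_fst (ae_enorm_le_eLpNorm_top g)] with z h1 h2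
  rw [h1, tensorFun, enorm_mul, enorm_mul, enorm_normConst, ← ofReal_norm (char k z.2), norm_char,
    ENNReal.ofReal_one, mul_one]
  gcongr

/-- The Fourier series is only known to converge in L², so the triangle inequality is applied after
pairing with the countable family of L¹-normalised test functions. -/
theorem eLpNorm_top_le_tsum (f : L2 d) :
    eLpNorm f ⊤ volume ≤ cst d * ∑' k, eLpNorm (mode k f) ⊤ volume := by
  obtain ⟨g, hg, h⟩ := exists_seq_eLpNorm_top_eq (μ := (volume : Measure (Space d)))
  rw [h f]
  refine iSup_le fun n => ?_
  have hs := (hasSum_tensor_mode f).mapL (innerSL ℂ (g n))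
  simp only [innerSL_apply_apply] at hs
  rw [← hs.tsum_eq, ← ENNReal.tsum_mul_left]
  refine enorm_tsum_le_tsum_enorm.trans (ENNReal.tsum_le_tsum fun k => ?_)
  calc _ ≤ eLpNorm (g n) 1 volume * eLpNorm (tensor k (mode k f)) ⊤ volume :=
        enorm_inner_le_eLpNorm _ _
    _ ≤ 1 * (cst d * eLpNorm (mode k f) ⊤ volume) := by
        gcongr
        · exact hg n
        · exact eLpNorm_tensor_top_le _ _
    _ = _ := one_mul _

theorem eLpNorm_mul_le_top {α : Type*} [MeasurableSpace α] {μ : Measure α} (f : Lp ℂ 2 μ)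
    (m : α → ℂ) :
    eLpNorm (fun x => f x * m x) 2 μ ≤ ‖f‖ₑ * eLpNorm m ⊤ μ := by
  refine le_of_sq_le_sq' ?_
  rw [mul_pow, Lp.enorm_def, eLpNorm_two_sq, eLpNorm_two_sq,
    ← lintegral_mul_const'' _ ((Lp.aestronglyMeasurable f).enorm.pow_const 2)]
  refine lintegral_mono_ae ?_
  filter_upwards [ae_enorm_le_eLpNorm_top m] with x hx
  rw [enorm_mul, mul_pow]
  gcongr

theorem memLp_mul_top {α : Type*} [MeasurableSpace α] {μ : Measure α} (f : Lp ℂ 2 μ)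
    {m : α → ℂ} (hm : AEStronglyMeasurable m μ) (hm' : eLpNorm m ⊤ μ ≠ ⊤) :
    MemLp (fun x => f x * m x) 2 μ :=
  ⟨(Lp.aestronglyMeasurable f).mul hm, (eLpNorm_mul_le_top f m).trans_lt
    (ENNReal.mul_lt_top enorm_lt_top hm'.lt_top)⟩

theorem enorm_mode_mul_tensor_le {P f : L2 d} {g : LX} {j : Fin d → ℤ}
    (hP : P =ᵐ[volume] fun z => f z * tensorFun j g z) (k : Fin d → ℤ) :
    ‖mode k P‖ₑ ≤ cst d * (‖mode (k - j) f‖ₑ * eLpNorm g ⊤ volume) := by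
  have h1 : mode k P =ᵐ[volume] (normConst d : ℂ) • fun x => mode (k - j) f x * g x := by
    filter_upwards [mode_ae_of_ae hP k, mode_ae (k - j) f] with x h1 h2
    rw [h1, modeFun_mul_tensorFun, Pi.smul_apply, h2, smul_eq_mul, mul_comm (g x)]
  rw [Lp.enorm_def, eLpNorm_congr_ae h1, eLpNorm_const_smul, enorm_normConst]
  gcongr
  exact eLpNorm_mul_le_top _ _

/-- The Fourier coefficients of a product. -/
theorem enorm_mode_mul_le {F f h : L2 d} (hF : F =ᵐ[volume] fun z => f z * h z)
    (hh : ∑' j, eLpNorm (mode j h) ⊤ volume ≠ ⊤) (k : Fin d → ℤ) :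
    ‖mode k F‖ₑ ≤ cst d * ∑' j, ‖mode (k - j) f‖ₑ * eLpNorm (mode j h) ⊤ volume := by
  classical
  have hP : ∀ j, ∃ P : L2 d, P =ᵐ[volume] fun z => f z * tensor j (mode j h) z := fun j => by
    refine ⟨(memLp_mul_top f (Lp.aestronglyMeasurable (tensor j (mode j h))) ?_).toLp,
      MemLp.coeFn_toLp _⟩
    refine ne_top_of_le_ne_top ?_ (eLpNorm_tensor_top_le j _)
    exact ENNReal.mul_ne_top cst_ne_top (ENNReal.ne_top_of_tsum_ne_top hh j)
  choose P hP using hP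
  -- Truncate h to the modes in S. The finite part is an exact finite convolution, and the remainder
  -- is small in sup norm by the tail of Σ_j ‖h_j‖_∞, so its product with f is small in L². Then let
  -- S grow.
  have hfin : ∀ S : Finset (Fin d → ℤ), ‖mode k F‖ₑ ≤
      cst d * (∑' j, ‖mode (k - j) f‖ₑ * eLpNorm (mode j h) ⊤ volume) +
        ‖f‖ₑ * (cst d * ∑' j : {j // j ∉ S}, eLpNorm (mode j h) ⊤ volume) := fun S => by
    set hS : L2 d := h - ∑ j ∈ S, tensor j (mode j h) with hhS
    have hmode : ∀ j, mode j hS = if j ∈ S then 0 else mode j h := fun j => by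
      rw [hhS, mode_sub, ← modeL_apply j (∑ j ∈ S, _), map_sum]
      simp_rw [modeL_apply]
      split_ifs with hj
      · rw [Finset.sum_eq_single j, mode_tensor_self, sub_self]
        · intro i _ hij
          rw [mode_tensor_of_ne hij.symm]
        · exact fun hc => absurd hj hc
      · rw [Finset.sum_eq_zero, sub_zero]
        intro i hi
        rw [mode_tensor_of_ne]
        rintro rfl
        exact hj hi
    have hsup : eLpNorm hS ⊤ volume ≤ cst d * ∑' j : {j // j ∉ S}, eLpNorm (mode j h) ⊤ volume := by
      refine (eLpNorm_top_le_tsum hS).trans_eq ?_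
      congr 1
      refine Eq.trans ?_ (tsum_subtype {j | j ∉ S} fun j => eLpNorm (mode j h) ⊤ volume).symm
      refine tsum_congr fun j => ?_
      rw [hmode]
      by_cases hj : j ∈ S
      · rw [if_pos hj, eLpNorm_congr_ae (Lp.coeFn_zero _ _ _)]
        simp [hj]
      · simp [hj]
    have hR : (F - ∑ j ∈ S, P j : L2 d) =ᵐ[volume] fun z => f z * hS z := by
      have h1 : ∀ᵐ z : Space d, ∀ j, P j z = f z * tensor j (mode j h) z := ae_all_iff.2 hP
      have h2 : ∀ (Q : (Fin d → ℤ) → L2 d), ∀ᵐ z : Space d, (∑ j ∈ S, Q j : L2 d) z = ∑ j ∈ S, Q j z :=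
        fun Q => by
          filter_upwards [Lp.coeFn_finsetSum S Q] with z hz
          rw [hz, Finset.sum_apply]
      filter_upwards [hF, h1, h2 P, h2 fun j => tensor j (mode j h),
        Lp.coeFn_sub F (∑ j ∈ S, P j), Lp.coeFn_sub h (∑ j ∈ S, tensor j (mode j h))]
        with z e1 e2 e3 e4 e5 e6
      rw [e5, Pi.sub_apply, e1, e3, hhS, e6, Pi.sub_apply, e4, mul_sub, Finset.mul_sum]
      simp_rw [e2]
    have hRn : ‖(F - ∑ j ∈ S, P j : L2 d)‖ₑ ≤ ‖f‖ₑ * eLpNorm hS ⊤ volume := by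
      rw [Lp.enorm_def, eLpNorm_congr_ae hR]
      exact eLpNorm_mul_le_top _ _
    have hdecomp : mode k F = ∑ j ∈ S, mode k (P j) + mode k (F - ∑ j ∈ S, P j) := by
      simp only [← modeL_apply, map_sub, map_sum]
      abel
    rw [hdecomp]
    refine (enorm_add_le _ _).trans (add_le_add ?_ ?_)
    · refine (enorm_sum_le _ _).trans ?_
      rw [← ENNReal.tsum_mul_left]
      refine (Finset.sum_le_sum fun j _ => ?_).trans (ENNReal.sum_le_tsum S)
      refine enorm_mode_mul_tensor_le ?_ k
      filter_upwards [hP j, tensor_ae j (mode j h)] with z e1 e2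
      rw [e1, e2]
    · calc _ ≤ ‖(F - ∑ j ∈ S, P j : L2 d)‖ₑ := by
            simp only [← ofReal_norm]
            exact ENNReal.ofReal_le_ofReal (norm_mode_le _ _)
        _ ≤ _ := hRn.trans (by gcongr)
  have hlim : Tendsto (fun S : Finset (Fin d → ℤ) =>
      cst d * (∑' j, ‖mode (k - j) f‖ₑ * eLpNorm (mode j h) ⊤ volume) +
        ‖f‖ₑ * (cst d * ∑' j : {j // j ∉ S}, eLpNorm (mode j h) ⊤ volume)) atTop
      (𝓝 (cst d * ∑' j, ‖mode (k - j) f‖ₑ * eLpNorm (mode j h) ⊤ volume)) := by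
    have h1 := ENNReal.tendsto_tsum_compl_atTop_zero hh
    have h2 := ENNReal.Tendsto.const_mul (a := ‖f‖ₑ)
      (ENNReal.Tendsto.const_mul (a := cst d) h1 (Or.inr cst_ne_top)) (Or.inr enorm_ne_top)
    simp only [mul_zero] at h2
    simpa using h2.const_add (cst d * ∑' j, ‖mode (k - j) f‖ₑ * eLpNorm (mode j h) ⊤ volume)
  exact ge_of_tendsto' hlim hfin

/-- The Fourier coefficients of `f ḡ h`. -/
theorem enorm_mode_trilinear_le {F f g h : L2 d}
    (hF : F =ᵐ[volume] fun z => f z * (starRingEnd ℂ) (g z) * h z)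
    (hg : ∑' j, eLpNorm (mode j g) ⊤ volume ≠ ⊤) (hh : ∑' j, eLpNorm (mode j h) ⊤ volume ≠ ⊤)
    (k : Fin d → ℤ) :
    ‖mode k F‖ₑ ≤ cst d ^ 2 * ∑' j, (∑' l, ‖mode (k - j - l) f‖ₑ *
      eLpNorm (mode (-l) g) ⊤ volume) * eLpNorm (mode j h) ⊤ volume := by
  have hg' : ∑' j, eLpNorm (mode j (star g)) ⊤ volume ≠ ⊤ := by
    simp_rw [eLpNorm_mode_star]
    have e : ∑' j, eLpNorm (mode (-j) g) ⊤ volume = ∑' j, eLpNorm (mode j g) ⊤ volume :=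
      (Equiv.neg (Fin d → ℤ)).tsum_eq fun j => eLpNorm (mode j g) ⊤ volume
    rwa [e]
  have hgtop : eLpNorm (star g : L2 d) ⊤ volume ≠ ⊤ :=
    ne_top_of_le_ne_top (ENNReal.mul_ne_top cst_ne_top hg') (eLpNorm_top_le_tsum _)
  set Q : L2 d := (memLp_mul_top f (Lp.aestronglyMeasurable (star g)) hgtop).toLp with hQ
  have hQae : Q =ᵐ[volume] fun z => f z * (star g : L2 d) z := MemLp.coeFn_toLp _
  have h1 : F =ᵐ[volume] fun z => Q z * h z := by
    filter_upwards [hF, hQae, star_ae g] with z e1 e2 e3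
    rw [e1, e2, e3]
  refine (enorm_mode_mul_le h1 hh k).trans ?_
  rw [sq, mul_assoc, ← ENNReal.tsum_mul_left (a := cst d) (f := fun j => (∑' l, _) * _)]
  refine mul_le_mul_right (ENNReal.tsum_le_tsum fun j => ?_) _
  rw [← mul_assoc]
  refine mul_le_mul_left ((enorm_mode_mul_le hQae hg' (k - j)).trans_eq ?_) _
  simp_rw [eLpNorm_mode_star]

end

/-! ### Minkowski inequalities and the trilinear estimate -/

section

section Minkowski

variable {X Y : Type*} [MeasurableSpace X] [MeasurableSpace Y] {μ : Measure X} {ν : Measure Y}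

theorem lintegral_mul_sq_le {a b : X → ℝ≥0∞} (ha : AEMeasurable a μ) (hb : AEMeasurable b μ) :
    (∫⁻ x, a x * b x ∂μ) ≤ (∫⁻ x, a x ^ 2 ∂μ) ^ (1 / 2 : ℝ) * (∫⁻ x, b x ^ 2 ∂μ) ^ (1 / 2 : ℝ) := by
  have h := ENNReal.lintegral_mul_le_Lp_mul_Lq μ (p := 2) (q := 2)
    ⟨by norm_num, by norm_num, by norm_num⟩ ha hb
  simpa only [Pi.mul_apply, ENNReal.rpow_ofNat] using h

/-- Expand the square, exchange the integrals and use Cauchy–Schwarz in t; the result factorises.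
Neither duality nor finiteness is needed. -/
theorem minkowski_two [SFinite μ] [SFinite ν] {g : X → Y → ℝ≥0∞}
    (hg : Measurable (Function.uncurry g)) :
    ∫⁻ t, (∫⁻ τ, g t τ ∂ν) ^ 2 ∂μ ≤ (∫⁻ τ, (∫⁻ t, g t τ ^ 2 ∂μ) ^ (1 / 2 : ℝ) ∂ν) ^ 2 := by
  have hgt : ∀ t, Measurable fun τ => g t τ := fun t => hg.comp (measurable_const.prodMk measurable_id)
  have hgτ : ∀ τ, Measurable fun t => g t τ := fun τ => hg.comp (measurable_id.prodMk measurable_const)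
  have hI : Measurable fun t => ∫⁻ σ, g t σ ∂ν := hg.lintegral_prod_right
  have hN : Measurable fun τ => (∫⁻ t, g t τ ^ 2 ∂μ) ^ (1 / 2 : ℝ) :=
    (Measurable.lintegral_prod_left (f := fun t τ => g t τ ^ 2) (hg.pow_const 2)).pow_const _
  calc ∫⁻ t, (∫⁻ τ, g t τ ∂ν) ^ 2 ∂μ = ∫⁻ t, ∫⁻ τ, g t τ * (∫⁻ σ, g t σ ∂ν) ∂ν ∂μ := by
        refine lintegral_congr fun t => ?_
        rw [lintegral_mul_const _ (hgt t), sq]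
    _ = ∫⁻ τ, ∫⁻ t, g t τ * (∫⁻ σ, g t σ ∂ν) ∂μ ∂ν := by
        rw [lintegral_lintegral_swap]
        exact (hg.mul (hI.comp measurable_fst)).aemeasurable
    _ = ∫⁻ τ, ∫⁻ σ, ∫⁻ t, g t τ * g t σ ∂μ ∂ν ∂ν := by
        refine lintegral_congr fun τ => ?_
        rw [← lintegral_lintegral_swap]
        · refine lintegral_congr fun t => ?_
          rw [lintegral_const_mul _ (hgt t)]
        · exact (((hgτ τ).comp measurable_fst).mul hg).aemeasurable
    _ ≤ ∫⁻ τ, ∫⁻ σ, (∫⁻ t, g t τ ^ 2 ∂μ) ^ (1 / 2 : ℝ) * (∫⁻ t, g t σ ^ 2 ∂μ) ^ (1 / 2 : ℝ) ∂ν ∂ν :=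
        lintegral_mono fun τ => lintegral_mono fun σ =>
          lintegral_mul_sq_le (hgτ τ).aemeasurable (hgτ σ).aemeasurable
    _ = _ := by
        simp_rw [lintegral_const_mul _ hN]
        rw [lintegral_mul_const _ hN, sq]

theorem rpow_half_sq (x : ℝ≥0∞) : (x ^ (1 / 2 : ℝ)) ^ 2 = x := by
  rw [← ENNReal.rpow_natCast, ← ENNReal.rpow_mul]
  norm_num

theorem rpow_quarter_pow (x : ℝ≥0∞) : (x ^ (1 / 4 : ℝ)) ^ 4 = x := by
  rw [← ENNReal.rpow_natCast, ← ENNReal.rpow_mul]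
  norm_num

theorem rpow_half_half (x : ℝ≥0∞) : (x ^ (1 / 2 : ℝ)) ^ (1 / 2 : ℝ) = x ^ (1 / 4 : ℝ) := by
  rw [← ENNReal.rpow_mul]
  norm_num

theorem lintegral_mul_sq_le_four {a b : X → ℝ≥0∞} (ha : AEMeasurable a μ) (hb : AEMeasurable b μ) :
    (∫⁻ x, (a x * b x) ^ 2 ∂μ) ^ (1 / 2 : ℝ) ≤
      (∫⁻ x, a x ^ 4 ∂μ) ^ (1 / 4 : ℝ) * (∫⁻ x, b x ^ 4 ∂μ) ^ (1 / 4 : ℝ) := by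
  have h := lintegral_mul_sq_le (ha.pow_const 2) (hb.pow_const 2)
  simp only [← mul_pow, ← pow_mul] at h
  calc _ ≤ ((∫⁻ x, a x ^ 4 ∂μ) ^ (1 / 2 : ℝ) * (∫⁻ x, b x ^ 4 ∂μ) ^ (1 / 2 : ℝ)) ^ (1 / 2 : ℝ) := by
        gcongr
    _ = _ := by
        rw [ENNReal.mul_rpow_of_nonneg _ _ (by norm_num), rpow_half_half, rpow_half_half]

/-- Minkowski's integral inequality in `L⁴`. -/
theorem minkowski_four [SFinite μ] [SFinite ν] {g : X → Y → ℝ≥0∞}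
    (hg : Measurable (Function.uncurry g)) :
    (∫⁻ t, (∫⁻ τ, g t τ ∂ν) ^ 4 ∂μ) ^ (1 / 4 : ℝ) ≤
      ∫⁻ τ, (∫⁻ t, g t τ ^ 4 ∂μ) ^ (1 / 4 : ℝ) ∂ν := by
  have hgt : ∀ t, Measurable fun τ => g t τ := fun t => hg.comp (measurable_const.prodMk measurable_id)
  have hgτ : ∀ τ, Measurable fun t => g t τ := fun τ => hg.comp (measurable_id.prodMk measurable_const)
  have hN : Measurable fun τ => (∫⁻ t, g t τ ^ 4 ∂μ) ^ (1 / 4 : ℝ) :=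
    (Measurable.lintegral_prod_left (f := fun t τ => g t τ ^ 4) (hg.pow_const 4)).pow_const _
  -- The L⁴ case is the L² case for the tensor square of g on Y × Y, followed by Cauchy–Schwarz in
  -- t.
  let G : X → Y × Y → ℝ≥0∞ := fun t p => g t p.1 * g t p.2
  have hG : Measurable (Function.uncurry G) :=
    (hg.comp (measurable_fst.prodMk (measurable_fst.comp measurable_snd))).mul
      (hg.comp (measurable_fst.prodMk (measurable_snd.comp measurable_snd)))
  have h1 : ∀ t, ∫⁻ p, G t p ∂(ν.prod ν) = (∫⁻ τ, g t τ ∂ν) ^ 2 := fun t => by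
    rw [sq, ← lintegral_prod_mul (hgt t).aemeasurable (hgt t).aemeasurable]
  have h2 := minkowski_two (μ := μ) (ν := ν.prod ν) hG
  simp_rw [h1, ← pow_mul] at h2
  have h3 : ∫⁻ p, (∫⁻ t, G t p ^ 2 ∂μ) ^ (1 / 2 : ℝ) ∂(ν.prod ν) ≤
      (∫⁻ τ, (∫⁻ t, g t τ ^ 4 ∂μ) ^ (1 / 4 : ℝ) ∂ν) ^ 2 := by
    calc _ ≤ ∫⁻ p, (∫⁻ t, g t p.1 ^ 4 ∂μ) ^ (1 / 4 : ℝ) * (∫⁻ t, g t p.2 ^ 4 ∂μ) ^ (1 / 4 : ℝ)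
          ∂(ν.prod ν) := lintegral_mono fun p =>
            lintegral_mul_sq_le_four (hgτ p.1).aemeasurable (hgτ p.2).aemeasurable
      _ = _ := by
          rw [sq, ← lintegral_prod_mul hN.aemeasurable hN.aemeasurable]
  refine (ENNReal.pow_le_pow_left_iff (n := 4) (by norm_num)).1 ?_
  rw [rpow_quarter_pow]
  calc _ ≤ _ := h2
    _ ≤ ((∫⁻ τ, (∫⁻ t, g t τ ^ 4 ∂μ) ^ (1 / 4 : ℝ) ∂ν) ^ 2) ^ 2 := by gcongr
    _ = _ := by ring

theorem minkowski_four_tsum [SFinite μ] {ι : Type*} [Countable ι] {g : X → ι → ℝ≥0∞}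
    (hg : ∀ i, AEMeasurable (fun t => g t i) μ) :
    (∫⁻ t, (∑' i, g t i) ^ 4 ∂μ) ^ (1 / 4 : ℝ) ≤ ∑' i, (∫⁻ t, g t i ^ 4 ∂μ) ^ (1 / 4 : ℝ) := by
  let _ : MeasurableSpace ι := ⊤
  have : MeasurableSingletonClass ι := ⟨fun _ => trivial⟩
  have hm : Measurable (Function.uncurry fun t i => (hg i).mk _ t) :=
    measurable_from_prod_countable_left fun i => (hg i).measurable_mk
  have h := minkowski_four (μ := μ) (ν := (Measure.count : Measure ι)) hm
  simp only [lintegral_count] at h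
  have hae : ∀ᵐ t ∂μ, ∀ i, g t i = (hg i).mk _ t := ae_all_iff.2 fun i => (hg i).ae_eq_mk
  have e1 : ∫⁻ t, (∑' i, g t i) ^ 4 ∂μ = ∫⁻ t, (∑' i, (hg i).mk _ t) ^ 4 ∂μ := by
    refine lintegral_congr_ae ?_
    filter_upwards [hae] with t ht
    simp only [ht]
  have e2 : ∀ i, ∫⁻ t, g t i ^ 4 ∂μ = ∫⁻ t, (hg i).mk _ t ^ 4 ∂μ := fun i => by
    refine lintegral_congr_ae ?_
    filter_upwards [hae] with t ht
    rw [ht]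
  simp_rw [e1, e2]
  exact h

end Minkowski

theorem eLpNorm_top_integral_le {α X : Type*} [MeasurableSpace α] {μ : Measure α} [SigmaFinite μ]
    [TopologicalSpace.SeparableSpace (Lp ℂ 2 μ)] [MeasurableSpace X] {ν : Measure X}
    {H : X → Lp ℂ 2 μ} (hH : Integrable H ν) :
    eLpNorm (∫ x, H x ∂ν : Lp ℂ 2 μ) ⊤ μ ≤ ∫⁻ x, eLpNorm (H x) ⊤ μ ∂ν := by
  obtain ⟨g, hg, h⟩ := exists_seq_eLpNorm_top_eq (μ := μ)
  rw [h]
  refine iSup_le fun n => ?_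
  rw [← integral_inner hH]
  refine (enorm_integral_le_lintegral_enorm _).trans (lintegral_mono fun x => ?_)
  rw [h]
  exact le_iSup (fun n => ‖inner ℂ (g n) (H x)‖ₑ) n

theorem eLpNorm_neg_coe {α : Type*} [MeasurableSpace α] {μ : Measure α} (f : Lp ℂ 2 μ)
    (p : ℝ≥0∞) : eLpNorm (-f : Lp ℂ 2 μ) p μ = eLpNorm f p μ := by
  rw [eLpNorm_congr_ae (Lp.coeFn_neg f), eLpNorm_neg]

theorem eLpNorm_top_smul_phase {d : ℕ} (t : ℝ) (k : Fin d → ℤ) (f : LX) :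
    eLpNorm (phase t k • f : LX) ⊤ volume = eLpNorm f ⊤ volume := by
  rw [eLpNorm_congr_ae (Lp.coeFn_smul _ f), eLpNorm_const_smul, ← ofReal_norm, norm_phase]
  simp

theorem eLpNorm_top_intervalIntegral_le {H : ℝ → LX} {a b : ℝ}
    (hH : IntervalIntegrable H volume a b) :
    eLpNorm (∫ τ in a..b, H τ : LX) ⊤ volume ≤ ∫⁻ τ in uIoc a b, eLpNorm (H τ) ⊤ volume := by
  rw [intervalIntegrable_iff] at hH
  refine le_trans (le_of_eq ?_) (eLpNorm_top_integral_le hH)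
  rw [intervalIntegral.intervalIntegral_eq_integral_uIoc]
  split_ifs
  · rw [one_smul]
  · rw [neg_smul, one_smul, eLpNorm_neg_coe]

/-- Fiberwise norms: `sup_{t ∈ I} ‖u(t, ·, k)‖_{L²}`. -/
def supN {d : ℕ} (I : Set ℝ) (u : ℝ → L2 d) (k : Fin d → ℤ) : ℝ≥0∞ := ⨆ t ∈ I, ‖mode k (u t)‖ₑ

/-- Fiberwise norms: `‖u(·, ·, k)‖_{L⁴_t(I; L^∞_x)}`. -/
def l4N {d : ℕ} (I : Set ℝ) (u : ℝ → L2 d) (k : Fin d → ℤ) : ℝ≥0∞ :=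
  (∫⁻ t in I, eLpNorm (mode k (u t)) ⊤ volume ^ 4) ^ (1 / 4 : ℝ)

/-- The norm of the space in which the equation is solved. -/
def zN {d : ℕ} (s : ℝ) (I : Set ℝ) (u : ℝ → L2 d) : ℝ≥0∞ :=
  ell s fun k => supN I u k + l4N I u k

variable {d : ℕ} {s : ℝ} {I : Set ℝ}

theorem aemeasurable_eLpNorm_mode {u : ℝ → L2 d} (hu : AEStronglyMeasurable u (volume.restrict I))
    (k : Fin d → ℤ) :
    AEMeasurable (fun t => eLpNorm (mode k (u t)) ⊤ volume) (volume.restrict I) := by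
  refine ⟨fun t => eLpNorm (mode k (hu.mk u t)) ⊤ volume, ?_, ?_⟩
  · refine measurable_eLpNorm_top_comp (μ := (volume : Measure ℝ)) (F := fun t => mode k (hu.mk u t)) ?_
    have := (modeL (d := d) k).continuous.comp_stronglyMeasurable hu.stronglyMeasurable_mk
    simpa only [modeL_apply] using this
  · filter_upwards [hu.ae_eq_mk] with t ht
    rw [ht]

theorem lintegral_tsum_mode_le {u : ℝ → L2 d} (hu : AEStronglyMeasurable u (volume.restrict I)) :
    (∫⁻ t in I, (∑' k, eLpNorm (mode k (u t)) ⊤ volume) ^ 4) ^ (1 / 4 : ℝ) ≤ ∑' k, l4N I u k :=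
  minkowski_four_tsum fun k => aemeasurable_eLpNorm_mode hu k

theorem l4LinftyNorm_le {u : ℝ → L2 d} (hu : AEStronglyMeasurable u (volume.restrict I)) :
    l4LinftyNorm I u ≤ cst d * ∑' k, l4N I u k := by
  refine le_trans ?_ (mul_le_mul_right (lintegral_tsum_mode_le hu) _)
  refine (ENNReal.pow_le_pow_left_iff (n := 4) (by norm_num)).1 ?_
  rw [mul_pow, l4LinftyNorm, rpow_quarter_pow, rpow_quarter_pow,
    ← lintegral_const_mul' _ _ (ENNReal.pow_ne_top cst_ne_top)]
  refine lintegral_mono fun t => ?_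
  rw [← mul_pow]
  gcongr
  exact eLpNorm_top_le_tsum _

/-- At almost every time the sup norms of the modes are summable, which is the hypothesis under
which the product formula for Fourier coefficients is valid. -/
theorem ae_tsum_mode_ne_top {u : ℝ → L2 d} (hu : AEStronglyMeasurable u (volume.restrict I))
    (h : ∑' k, l4N I u k ≠ ⊤) :
    ∀ᵐ t ∂volume.restrict I, ∑' k, eLpNorm (mode k (u t)) ⊤ volume ≠ ⊤ := by
  have h1 : ∫⁻ t in I, (∑' k, eLpNorm (mode k (u t)) ⊤ volume) ^ 4 ≠ ⊤ := by
    have := ne_top_of_le_ne_top h (lintegral_tsum_mode_le hu)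
    intro hc
    rw [hc] at this
    simp at this
  have hm : AEMeasurable (fun t => (∑' k, eLpNorm (mode k (u t)) ⊤ volume) ^ 4)
      (volume.restrict I) :=
    (AEMeasurable.tsum fun k => aemeasurable_eLpNorm_mode hu k).pow_const 4
  filter_upwards [ae_lt_top' hm h1] with t ht hc
  rw [hc] at ht
  simp at ht

theorem lintegral_mul_le_four {a b : ℝ → ℝ≥0∞} (ha : AEMeasurable a (volume.restrict I))
    (hb : AEMeasurable b (volume.restrict I)) :
    ∫⁻ t in I, a t * b t ≤ volume I ^ (1 / 2 : ℝ) *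
      ((∫⁻ t in I, a t ^ 4) ^ (1 / 4 : ℝ) * (∫⁻ t in I, b t ^ 4) ^ (1 / 4 : ℝ)) := by
  have h := lintegral_mul_sq_le (μ := volume.restrict I) (a := fun _ => 1)
    (b := fun t => a t * b t) aemeasurable_const (ha.mul hb)
  simp only [one_mul, one_pow, lintegral_one, Measure.restrict_apply_univ] at h
  exact h.trans (mul_le_mul_right (lintegral_mul_sq_le_four ha hb) _)

/-- The bound for one Fourier mode of the product `f ḡ h`, with the first factor replaced by its
supremum in time. -/
def triB (I : Set ℝ) (f g h : ℝ → L2 d) (k : Fin d → ℤ) (t : ℝ) : ℝ≥0∞ :=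
  cst d ^ 2 * ∑' j, ∑' l, supN I f (k - j - l) * (eLpNorm (mode (-l) (g t)) ⊤ volume *
    eLpNorm (mode j (h t)) ⊤ volume)

theorem enorm_mode_le_triB {f g h : ℝ → L2 d} {t : ℝ} {F : L2 d} (ht : t ∈ I)
    (hF : F =ᵐ[volume] fun z => f t z * (starRingEnd ℂ) (g t z) * h t z)
    (hg : ∑' j, eLpNorm (mode j (g t)) ⊤ volume ≠ ⊤)
    (hh : ∑' j, eLpNorm (mode j (h t)) ⊤ volume ≠ ⊤) (k : Fin d → ℤ) :
    ‖mode k F‖ₑ ≤ triB I f g h k t := by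
  refine (enorm_mode_trilinear_le hF hg hh k).trans ?_
  refine mul_le_mul_right (ENNReal.tsum_le_tsum fun j => ?_) _
  rw [← ENNReal.tsum_mul_right]
  refine ENNReal.tsum_le_tsum fun l => ?_
  rw [mul_assoc]
  gcongr
  exact le_iSup₂ (f := fun t _ => ‖mode (k - j - l) (f t)‖ₑ) t ht

theorem aemeasurable_triB {f g h : ℝ → L2 d} (hg : AEStronglyMeasurable g (volume.restrict I))
    (hh : AEStronglyMeasurable h (volume.restrict I)) (k : Fin d → ℤ) :
    AEMeasurable (triB I f g h k) (volume.restrict I) :=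
  (AEMeasurable.tsum fun j => AEMeasurable.tsum fun l =>
    ((aemeasurable_eLpNorm_mode hg (-l)).mul (aemeasurable_eLpNorm_mode hh j)).const_mul _).const_mul _

/-- Hölder in time: the first factor has already been frozen at its supremum, and the product of two
L⁴ functions costs |I|^{1/2} in L¹. The double convolution structure in k is untouched. -/
theorem lintegral_triB_le {f g h : ℝ → L2 d}
    (hg : AEStronglyMeasurable g (volume.restrict I))
    (hh : AEStronglyMeasurable h (volume.restrict I)) (k : Fin d → ℤ) :
    ∫⁻ t in I, triB I f g h k t ≤ cst d ^ 2 * volume I ^ (1 / 2 : ℝ) *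
      ∑' j, (∑' l, supN I f (k - j - l) * l4N I g (-l)) * l4N I h j := by
  have hbm : ∀ j l, AEMeasurable (fun t => eLpNorm (mode (-l) (g t)) ⊤ volume *
      eLpNorm (mode j (h t)) ⊤ volume) (volume.restrict I) := fun j l =>
    (aemeasurable_eLpNorm_mode hg _).mul (aemeasurable_eLpNorm_mode hh _)
  unfold triB
  rw [lintegral_const_mul' _ _ (ENNReal.pow_ne_top cst_ne_top), mul_assoc]
  refine mul_le_mul_right ?_ _
  rw [lintegral_tsum fun j => AEMeasurable.tsum fun l => (hbm j l).const_mul _,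
    ← ENNReal.tsum_mul_left]
  refine ENNReal.tsum_le_tsum fun j => ?_
  rw [lintegral_tsum fun l => (hbm j l).const_mul _, ← ENNReal.tsum_mul_right,
    ← ENNReal.tsum_mul_left]
  refine ENNReal.tsum_le_tsum fun l => ?_
  rw [lintegral_const_mul'' _ (hbm j l)]
  calc _ ≤ supN I f (k - j - l) * (volume I ^ (1 / 2 : ℝ) * (l4N I g (-l) * l4N I h j)) :=
        mul_le_mul_right (lintegral_mul_le_four (aemeasurable_eLpNorm_mode hg _)
          (aemeasurable_eLpNorm_mode hh _)) _
    _ = _ := by ring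

theorem ell_comp_neg (α : (Fin d → ℤ) → ℝ≥0∞) : ell s (fun k => α (-k)) = ell s α := by
  unfold ell
  congr 1
  have h := (Equiv.neg (Fin d → ℤ)).tsum_eq fun k => wt s k * α k ^ 2
  rw [← h]
  refine tsum_congr fun k => ?_
  simp [wt, sqAbs_neg]

/-- The constant of the trilinear estimate. -/
def triC (d : ℕ) (s : ℝ) : ℝ≥0∞ :=
  cst d ^ 2 * ((2 * ENNReal.ofReal (4 ^ s) * ∑' k : Fin d → ℤ, wt (-s) k) ^ (1 / 2 : ℝ)) ^ 2

theorem triC_ne_top (hd : 1 ≤ d) (hs : (d : ℝ) / 2 < s) : triC d s ≠ ⊤ := by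
  refine ENNReal.mul_ne_top (ENNReal.pow_ne_top cst_ne_top) ?_
  rw [rpow_half_sq]
  exact ENNReal.mul_ne_top (ENNReal.mul_ne_top (by simp) ENNReal.ofReal_ne_top)
    (tsum_wt_neg_ne_top hd hs)

/-- The trilinear estimate. -/
theorem ell_lintegral_triB_le (hs : 0 ≤ s) {f g h : ℝ → L2 d}
    (hg : AEStronglyMeasurable g (volume.restrict I))
    (hh : AEStronglyMeasurable h (volume.restrict I)) :
    ell s (fun k => ∫⁻ t in I, triB I f g h k t) ≤ triC d s * volume I ^ (1 / 2 : ℝ) *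
      (zN s I f * zN s I g * zN s I h) := by
  refine (ell_mono (lintegral_triB_le hg hh)).trans ?_
  rw [ell_const_mul]
  set c := (2 * ENNReal.ofReal (4 ^ s) * ∑' k : Fin d → ℤ, wt (-s) k) ^ (1 / 2 : ℝ) with hc
  have h1 : ell s (fun k => ∑' j, (∑' l, supN I f (k - j - l) * l4N I g (-l)) * l4N I h j) ≤
      c * (c * (ell s (supN I f) * ell s (l4N I g)) * ell s (l4N I h)) := by
    refine (ell_conv_le hs (fun k => ∑' l, supN I f (k - l) * l4N I g (-l)) (l4N I h)).trans ?_
    refine mul_le_mul_right (mul_le_mul_left ?_ _) _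
    refine (ell_conv_le hs (supN I f) fun l => l4N I g (-l)).trans ?_
    rw [ell_comp_neg]
  have h2 : ∀ u : ℝ → L2 d, ell s (supN I u) ≤ zN s I u := fun u => ell_mono fun k => le_self_add
  have h3 : ∀ u : ℝ → L2 d, ell s (l4N I u) ≤ zN s I u := fun u => ell_mono fun k => le_add_self
  calc _ ≤ cst d ^ 2 * volume I ^ (1 / 2 : ℝ) *
        (c * (c * (zN s I f * zN s I g) * zN s I h)) := by
        refine mul_le_mul_right (h1.trans ?_) _
        gcongr <;> first | exact h2 _ | exact h3 _
    _ = _ := by rw [triC, ← hc]; ring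

end

/-! ### Linear estimates and embeddings for the solution norm -/

section

variable {d : ℕ} {s : ℝ} {I : Set ℝ}

theorem rpow_quarter_le {x y : ℝ≥0∞} (h : x ≤ y ^ 4) : x ^ (1 / 4 : ℝ) ≤ y :=
  (ENNReal.pow_le_pow_left_iff (n := 4) (by norm_num)).1 (by rwa [rpow_quarter_pow])

/-- Translation invariance in time of the Strichartz estimate, with 144 rounded up to 4⁴. -/
theorem lintegral_eLpNorm_evolX_translate_le (f : LX) (τ : ℝ) (J : Set ℝ) :
    (∫⁻ t in J, eLpNorm (evolX (t - τ) f) ⊤ volume ^ 4) ^ (1 / 4 : ℝ) ≤ 4 * ‖f‖ₑ := by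
  refine rpow_quarter_le ((setLIntegral_le_lintegral _ _).trans ?_)
  rw [lintegral_sub_right_eq_self (fun t => eLpNorm (evolX t f) ⊤ volume ^ 4) τ, mul_pow]
  refine (lintegral_eLpNorm_evolX_le f).trans ?_
  gcongr
  norm_num

/-- Mode by mode, unitarity contributes 1 and Strichartz contributes 4. -/
theorem zN_U_le (u₀ : L2 d) : zN s I (fun t => U t u₀) ≤ 5 * hsNorm s u₀ := by
  rw [hsNorm_eq_ell, zN, ← ell_const_mul]
  refine ell_mono fun k => ?_
  have h1 : supN I (fun t => U t u₀) k ≤ ‖mode k u₀‖ₑ :=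
    iSup₂_le fun t _ => (enorm_mode_U t u₀ k).le
  have h2 : l4N I (fun t => U t u₀) k ≤ 4 * ‖mode k u₀‖ₑ := by
    have := lintegral_eLpNorm_evolX_translate_le (mode k u₀) 0 I
    simp only [sub_zero] at this
    simpa only [l4N, mode_U, eLpNorm_top_smul_phase] using this
  calc _ ≤ ‖mode k u₀‖ₑ + 4 * ‖mode k u₀‖ₑ := add_le_add h1 h2
    _ = _ := by ring

theorem uIoc_zero_subset {a b t : ℝ} (ha : a ≤ 0) (hb : 0 ≤ b) (ht : t ∈ Icc a b) :
    uIoc 0 t ⊆ Icc a b := by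
  refine uIoc_subset_uIcc.trans ?_
  rw [← uIcc_of_le (ha.trans hb)]
  refine uIcc_subset_uIcc ?_ ?_
  · rw [uIcc_of_le (ha.trans hb)]; exact ⟨ha, hb⟩
  · rwa [uIcc_of_le (ha.trans hb)]

theorem intervalIntegrable_of_integrableOn {E : Type*} [NormedAddCommGroup E] {F : ℝ → E}
    {a b t : ℝ} (ha : a ≤ 0) (hb : 0 ≤ b) (hF : IntegrableOn F (Icc a b)) (ht : t ∈ Icc a b) :
    IntervalIntegrable F volume 0 t :=
  intervalIntegrable_iff.2 (hF.mono_set (uIoc_zero_subset ha hb ht))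

theorem intervalIntegrable_mode_U {F : ℝ → L2 d} {t : ℝ} (hF : IntervalIntegrable F volume 0 t)
    (k : Fin d → ℤ) :
    IntervalIntegrable (fun τ => phase (t - τ) k • evolX (t - τ) (mode k (F τ))) volume 0 t := by
  have h := intervalIntegrable_U hF (τ := fun τ => t - τ) (by fun_prop)
  have h2 : IntervalIntegrable (fun τ => modeL k (U (t - τ) (F τ))) volume 0 t := by
    rw [intervalIntegrable_iff] at h ⊢
    exact (modeL (d := d) k).integrable_comp h
  simpa only [modeL_apply, mode_U] using h2

/-- The forcing is measured in L¹_t L²_x on each mode, so Minkowski's inequality reduces the Duhamel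
integral to homogeneous evolutions. Enlarging the domain of integration from [0, t] to the whole
interval is free after taking norms, so no Christ–Kiselev argument is required. -/
theorem zN_duh_le {F : ℝ → L2 d} {a b : ℝ} (ha : a ≤ 0) (hb : 0 ≤ b)
    (hF : IntegrableOn F (Icc a b)) :
    zN s (Icc a b) (duh F) ≤ 5 * ell s fun k => ∫⁻ τ in Icc a b, ‖mode k (F τ)‖ₑ := by
  rw [zN, ← ell_const_mul]
  refine ell_mono fun k => ?_
  have hi := fun t (ht : t ∈ Icc a b) => intervalIntegrable_of_integrableOn ha hb hF ht
  have h1 : supN (Icc a b) (duh F) k ≤ ∫⁻ τ in Icc a b, ‖mode k (F τ)‖ₑ := by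
    refine iSup₂_le fun t ht => ?_
    rw [mode_duh (hi t ht), intervalIntegral.intervalIntegral_eq_integral_uIoc]
    calc _ ≤ ‖∫ τ in uIoc 0 t, phase (t - τ) k • evolX (t - τ) (mode k (F τ))‖ₑ := by
          split_ifs <;> simp
      _ ≤ ∫⁻ τ in uIoc 0 t, ‖phase (t - τ) k • evolX (t - τ) (mode k (F τ))‖ₑ :=
          enorm_integral_le_lintegral_enorm _
      _ = ∫⁻ τ in uIoc 0 t, ‖mode k (F τ)‖ₑ := by
          simp only [enorm_smul, enorm_evolX, ← ofReal_norm (phase _ _), norm_phase,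
            ENNReal.ofReal_one, one_mul]
      _ ≤ _ := lintegral_mono_set (uIoc_zero_subset ha hb ht)
  have h2 : l4N (Icc a b) (duh F) k ≤ 4 * ∫⁻ τ in Icc a b, ‖mode k (F τ)‖ₑ := by
    have hm : AEStronglyMeasurable (fun τ => mode k (F τ)) (volume.restrict (Icc a b)) := by
      simpa only [modeL_apply] using ((modeL (d := d) k).integrable_comp hF).1
    -- A strongly measurable representative gives joint measurability in (t, τ), as Minkowski's
    -- inequality demands.
    let G := hm.mk _
    have hG : StronglyMeasurable G := hm.stronglyMeasurable_mk
    have hae := hm.ae_eq_mk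
    have hgm : Measurable (Function.uncurry fun t τ : ℝ => eLpNorm (evolX (t - τ) (G τ)) ⊤ volume) :=
      measurable_eLpNorm_top_comp (μ := (volume : Measure ℝ))
        (F := fun p : ℝ × ℝ => evolX (p.1 - p.2) (G p.2))
        (stronglyMeasurable_evolX_comp (measurable_fst.sub measurable_snd)
          (hG.comp_measurable measurable_snd))
    have hp : ∀ t ∈ Icc a b, eLpNorm (mode k (duh F t)) ⊤ volume ≤
        ∫⁻ τ in Icc a b, eLpNorm (evolX (t - τ) (G τ)) ⊤ volume := fun t ht => by
      rw [mode_duh (hi t ht)]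
      refine (eLpNorm_top_intervalIntegral_le (intervalIntegrable_mode_U (hi t ht) k)).trans ?_
      refine (lintegral_mono_set (uIoc_zero_subset ha hb ht)).trans ?_
      refine lintegral_mono_ae ?_
      filter_upwards [hae] with τ hτ
      rw [eLpNorm_top_smul_phase, hτ]
    calc l4N (Icc a b) (duh F) k ≤ (∫⁻ t in Icc a b, (∫⁻ τ in Icc a b,
          eLpNorm (evolX (t - τ) (G τ)) ⊤ volume) ^ 4) ^ (1 / 4 : ℝ) := by
          refine ENNReal.rpow_le_rpow ?_ (by norm_num)
          exact setLIntegral_mono' measurableSet_Icc fun t ht => pow_le_pow_left₀ zero_le (hp t ht) 4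
      _ ≤ ∫⁻ τ in Icc a b, (∫⁻ t in Icc a b,
          eLpNorm (evolX (t - τ) (G τ)) ⊤ volume ^ 4) ^ (1 / 4 : ℝ) := minkowski_four hgm
      _ ≤ ∫⁻ τ in Icc a b, 4 * ‖G τ‖ₑ :=
          lintegral_mono fun τ => lintegral_eLpNorm_evolX_translate_le _ _ _
      _ = 4 * ∫⁻ τ in Icc a b, ‖mode k (F τ)‖ₑ := by
          rw [lintegral_const_mul' _ _ (by simp)]
          congr 1
          refine lintegral_congr_ae ?_
          filter_upwards [hae] with τ hτ
          rw [hτ]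
  calc _ ≤ (∫⁻ τ in Icc a b, ‖mode k (F τ)‖ₑ) + 4 * ∫⁻ τ in Icc a b, ‖mode k (F τ)‖ₑ :=
        add_le_add h1 h2
    _ = _ := by ring

theorem hsNorm_le_zN {u : ℝ → L2 d} {t : ℝ} (ht : t ∈ I) :
    hsNorm s (u t) ≤ zN s I u := by
  rw [hsNorm_eq_ell]
  refine ell_mono fun k => le_trans ?_ le_self_add
  exact le_iSup₂ (f := fun t _ => ‖mode k (u t)‖ₑ) t ht

theorem zN_congr {u v : ℝ → L2 d} (hI : MeasurableSet I) (h : ∀ t ∈ I, u t = v t) :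
    zN s I u = zN s I v := by
  unfold zN
  congr 1
  funext k
  congr 1
  · unfold supN
    exact biSup_congr fun t ht => by rw [h t ht]
  · unfold l4N
    congr 1
    exact setLIntegral_congr_fun hI fun t ht => by simp only [h t ht]

theorem zN_sub_le {u v : ℝ → L2 d} (hu : AEStronglyMeasurable u (volume.restrict I))
    (hv : AEStronglyMeasurable v (volume.restrict I)) :
    zN s I (fun t => u t - v t) ≤ zN s I u + zN s I v := by
  refine le_trans (ell_mono fun k => ?_) (ell_add_le s _ _)
  have h1 : supN I (fun t => u t - v t) k ≤ supN I u k + supN I v k := by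
    refine iSup₂_le fun t ht => ?_
    rw [mode_sub]
    refine enorm_sub_le.trans (add_le_add ?_ ?_)
    · exact le_iSup₂ (f := fun t _ => ‖mode k (u t)‖ₑ) t ht
    · exact le_iSup₂ (f := fun t _ => ‖mode k (v t)‖ₑ) t ht
  have h2 : l4N I (fun t => u t - v t) k ≤ l4N I u k + l4N I v k := by
    have h := ENNReal.lintegral_Lp_add_le (p := 4) (aemeasurable_eLpNorm_mode hu k)
      (aemeasurable_eLpNorm_mode hv k) (by norm_num)
    simp only [Pi.add_apply, ENNReal.rpow_ofNat] at h
    refine le_trans ?_ h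
    unfold l4N
    gcongr with t
    rw [mode_sub, eLpNorm_congr_ae (Lp.coeFn_sub _ _)]
    exact eLpNorm_sub_le (Lp.aestronglyMeasurable _) (Lp.aestronglyMeasurable _) le_top
  calc _ ≤ (supN I u k + supN I v k) + (l4N I u k + l4N I v k) := add_le_add h1 h2
    _ = _ := by ring

theorem zN_smul {c : ℂ} (hc : ‖c‖ = 1) (u : ℝ → L2 d) : zN s I (fun t => c • u t) = zN s I u := by
  have hc' : ‖c‖ₑ = 1 := by rw [← ofReal_norm, hc, ENNReal.ofReal_one]
  unfold zN supN l4N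
  congr 1
  funext k
  congr 1
  · simp only [mode_smul, enorm_smul, hc', one_mul]
  · have : ∀ t, eLpNorm (mode k (c • u t)) ⊤ volume = eLpNorm (mode k (u t)) ⊤ volume := fun t => by
      rw [mode_smul, eLpNorm_congr_ae (Lp.coeFn_smul _ _), eLpNorm_const_smul, hc', one_mul]
    simp only [this]

/-- A supremum of L²-continuous functions is lower semicontinuous. Thus the Picard limit, obtained
only in L², keeps its L^∞ bounds. -/
theorem eLpNorm_top_le_liminf {α : Type*} [MeasurableSpace α] {μ : Measure α} [SigmaFinite μ]
    [TopologicalSpace.SeparableSpace (Lp ℂ 2 μ)] {f : ℕ → Lp ℂ 2 μ} {g : Lp ℂ 2 μ}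
    (h : Tendsto f atTop (𝓝 g)) :
    eLpNorm g ⊤ μ ≤ liminf (fun n => eLpNorm (f n) ⊤ μ) atTop := by
  obtain ⟨e, -, he⟩ := exists_seq_eLpNorm_top_eq (μ := μ)
  rw [he g]
  refine iSup_le fun m => ?_
  have h1 : Tendsto (fun n => ‖(inner ℂ (e m) (f n) : ℂ)‖ₑ) atTop (𝓝 ‖(inner ℂ (e m) g : ℂ)‖ₑ) :=
    (tendsto_const_nhds.inner h).enorm
  rw [← h1.liminf_eq]
  refine liminf_le_liminf (.of_forall fun n => ?_)
  rw [he (f n)]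
  exact le_iSup (fun m => ‖(inner ℂ (e m) (f n) : ℂ)‖ₑ) m

theorem pow_four_liminf_le (x : ℕ → ℝ≥0∞) :
    (liminf x atTop) ^ 4 = liminf (fun n => x n ^ 4) atTop :=
  Monotone.map_liminf_of_continuousAt (f := fun y : ℝ≥0∞ => y ^ 4)
    (fun a b h => pow_le_pow_left₀ zero_le h 4) x (ENNReal.continuous_pow 4).continuousAt

theorem rpow_quarter_liminf (x : ℕ → ℝ≥0∞) :
    (liminf x atTop) ^ (1 / 4 : ℝ) = liminf (fun n => x n ^ (1 / 4 : ℝ)) atTop :=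
  Monotone.map_liminf_of_continuousAt (f := fun y : ℝ≥0∞ => y ^ (1 / 4 : ℝ))
    (fun a b h => ENNReal.rpow_le_rpow h (by norm_num)) x
    (ENNReal.continuous_rpow_const).continuousAt

theorem liminf_add_liminf_le (x y : ℕ → ℝ≥0∞) :
    liminf x atTop + liminf y atTop ≤ liminf (fun n => x n + y n) atTop := by
  simp only [liminf_eq_iSup_iInf_of_nat]
  rw [ENNReal.iSup_add_iSup_of_monotone]
  · refine iSup_mono fun n => le_iInf₂ fun i hi => add_le_add ?_ ?_ <;> exact iInf₂_le i hi
  · exact fun m n hmn => le_iInf₂ fun i hi => iInf₂_le i (hmn.trans hi)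
  · exact fun m n hmn => le_iInf₂ fun i hi => iInf₂_le i (hmn.trans hi)

/-- Lower semicontinuity of the solution norm. -/
theorem zN_le_of_tendsto (hI : MeasurableSet I) {u : ℕ → ℝ → L2 d} {v : ℝ → L2 d} {C : ℝ≥0∞}
    (hu : ∀ n, AEStronglyMeasurable (u n) (volume.restrict I))
    (h : ∀ t ∈ I, Tendsto (fun n => u n t) atTop (𝓝 (v t)))
    (hC : ∀ᶠ n in atTop, zN s I (u n) ≤ C) : zN s I v ≤ C := by
  refine ell_liminf_le (fun k => ?_) hC
  have hk : ∀ t ∈ I, Tendsto (fun n => mode k (u n t)) atTop (𝓝 (mode k (v t))) := fun t ht => by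
    simpa only [modeL_apply, Function.comp_def] using ((modeL k).continuous.tendsto _).comp (h t ht)
  have h1 : supN I v k ≤ liminf (fun n => supN I (u n) k) atTop := by
    refine iSup₂_le fun t ht => ?_
    rw [← (hk t ht).enorm.liminf_eq]
    exact liminf_le_liminf (.of_forall fun n =>
      le_iSup₂ (f := fun t _ => ‖mode k (u n t)‖ₑ) t ht)
  have h2 : l4N I v k ≤ liminf (fun n => l4N I (u n) k) atTop := by
    unfold l4N
    rw [← rpow_quarter_liminf]
    refine ENNReal.rpow_le_rpow ?_ (by norm_num)
    refine le_trans ?_ (lintegral_liminf_le' fun n => (aemeasurable_eLpNorm_mode (hu n) k).pow_const 4)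
    refine setLIntegral_mono' hI fun t ht => ?_
    rw [← pow_four_liminf_le]
    exact pow_le_pow_left₀ zero_le (eLpNorm_top_le_liminf (hk t ht)) 4
  exact (add_le_add h1 h2).trans (liminf_add_liminf_le _ _)

/-- The constant in the embedding of the solution norm. -/
def embC (d : ℕ) (s : ℝ) : ℝ≥0∞ := cst d * (∑' k : Fin d → ℤ, wt (-s) k) ^ (1 / 2 : ℝ)

theorem embC_ne_top (hd : 1 ≤ d) (hs : (d : ℝ) / 2 < s) : embC d s ≠ ⊤ :=
  ENNReal.mul_ne_top cst_ne_top (ENNReal.rpow_ne_top_of_nonneg (by norm_num)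
    (tsum_wt_neg_ne_top hd hs))

theorem tsum_l4N_le (u : ℝ → L2 d) :
    ∑' k, l4N I u k ≤ (∑' k : Fin d → ℤ, wt (-s) k) ^ (1 / 2 : ℝ) * zN s I u :=
  (tsum_le_ell s _).trans (mul_le_mul_right (ell_mono fun _ => le_add_self) _)

theorem tsum_l4N_ne_top (hd : 1 ≤ d) (hs : (d : ℝ) / 2 < s) {u : ℝ → L2 d}
    (hu : zN s I u ≠ ⊤) : ∑' k, l4N I u k ≠ ⊤ :=
  ne_top_of_le_ne_top (ENNReal.mul_ne_top (ENNReal.rpow_ne_top_of_nonneg (by norm_num)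
    (tsum_wt_neg_ne_top hd hs)) hu) (tsum_l4N_le (s := s) u)

theorem l4LinftyNorm_le_zN {u : ℝ → L2 d} (hu : AEStronglyMeasurable u (volume.restrict I)) :
    l4LinftyNorm I u ≤ embC d s * zN s I u := by
  refine (l4LinftyNorm_le hu).trans ?_
  rw [embC, mul_assoc]
  exact mul_le_mul_right (tsum_l4N_le u) _

theorem xNorm_le_zN {u : ℝ → L2 d} (hu : AEStronglyMeasurable u (volume.restrict I)) :
    xNorm s I u ≤ (1 + embC d s) * zN s I u := by
  rw [xNorm, add_mul, one_mul]
  exact add_le_add (iSup₂_le fun t ht => hsNorm_le_zN ht) (l4LinftyNorm_le_zN hu)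

end

/-! ### The cubic nonlinearity: pointwise differences, time integrability, Lipschitz bound -/

section

variable {d : ℕ} {s : ℝ} {I : Set ℝ}

section Pointwise

theorem cub_sub_cub (a b : ℂ) :
    a * (starRingEnd ℂ) a * a - b * (starRingEnd ℂ) b * b =
      (a - b) * (starRingEnd ℂ) a * a + b * (starRingEnd ℂ) (a - b) * a +
        b * (starRingEnd ℂ) b * (a - b) := by
  rw [map_sub]; ring

theorem enorm_tri_le {a b c : ℂ} {x y z : ℝ≥0∞} (ha : ‖a‖ₑ ≤ x) (hb : ‖b‖ₑ ≤ y) (hc : ‖c‖ₑ ≤ z) :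
    ‖a * (starRingEnd ℂ) b * c‖ₑ ≤ x * y * z := by
  rw [enorm_mul, enorm_mul, RCLike.enorm_conj]
  gcongr

theorem enorm_cub_sub_cub_le {a b : ℂ} {m : ℝ≥0∞} (ha : ‖a‖ₑ ≤ m) (hb : ‖b‖ₑ ≤ m) :
    ‖a * (starRingEnd ℂ) a * a - b * (starRingEnd ℂ) b * b‖ₑ ≤ 3 * m ^ 2 * ‖a - b‖ₑ := by
  rw [cub_sub_cub]
  calc _ ≤ ‖a - b‖ₑ * m * m + m * ‖a - b‖ₑ * m + m * m * ‖a - b‖ₑ :=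
        (enorm_add_le _ _).trans (add_le_add ((enorm_add_le _ _).trans
          (add_le_add (enorm_tri_le le_rfl ha ha) (enorm_tri_le hb le_rfl ha)))
          (enorm_tri_le hb hb le_rfl))
    _ = _ := by ring

/-- Telescope each cubic difference and then compare the two. Three terms carry the full second
difference; six carry b' − b together with one of a − b, a' − b'. In the application primes denote
Galilei transforms, so b' − b is of order h while δ measures the distance of two solutions. -/
theorem enorm_cub_second_diff_le {a a' b b' : ℂ} {m δ : ℝ≥0∞} (ha : ‖a‖ₑ ≤ m) (ha' : ‖a'‖ₑ ≤ m)
    (hb : ‖b‖ₑ ≤ m) (hb' : ‖b'‖ₑ ≤ m) (hδ : ‖a - b‖ₑ ≤ δ) (hδ' : ‖a' - b'‖ₑ ≤ δ) :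
    ‖(a' * (starRingEnd ℂ) a' * a' - a * (starRingEnd ℂ) a * a) -
      (b' * (starRingEnd ℂ) b' * b' - b * (starRingEnd ℂ) b * b)‖ₑ ≤
      3 * m ^ 2 * ‖(a' - a) - (b' - b)‖ₑ + 6 * (m * δ) * ‖b' - b‖ₑ := by
  have e : (a' * (starRingEnd ℂ) a' * a' - a * (starRingEnd ℂ) a * a) -
      (b' * (starRingEnd ℂ) b' * b' - b * (starRingEnd ℂ) b * b) =
      ((a' - a) - (b' - b)) * (starRingEnd ℂ) a' * a' +
      a * (starRingEnd ℂ) ((a' - a) - (b' - b)) * a' +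
      a * (starRingEnd ℂ) a * ((a' - a) - (b' - b)) +
      ((b' - b) * (starRingEnd ℂ) (a' - b') * a' + (b' - b) * (starRingEnd ℂ) b' * (a' - b') +
      ((a - b) * (starRingEnd ℂ) (b' - b) * a' + b * (starRingEnd ℂ) (b' - b) * (a' - b')) +
      ((a - b) * (starRingEnd ℂ) a * (b' - b) + b * (starRingEnd ℂ) (a - b) * (b' - b))) := by
    simp only [map_sub]; ring
  rw [e]
  have add {x y : ℂ} {p q : ℝ≥0∞} (h : ‖x‖ₑ ≤ p) (h' : ‖y‖ₑ ≤ q) : ‖x + y‖ₑ ≤ p + q :=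
    (enorm_add_le _ _).trans (add_le_add h h')
  refine (add (add (add (enorm_tri_le le_rfl ha' ha') (enorm_tri_le ha le_rfl ha'))
    (enorm_tri_le ha ha le_rfl)) (add (add (add (enorm_tri_le le_rfl hδ' ha')
    (enorm_tri_le le_rfl hb' hδ')) (add (enorm_tri_le hδ le_rfl ha')
    (enorm_tri_le hb le_rfl hδ'))) (add (enorm_tri_le hδ ha le_rfl)
    (enorm_tri_le hb hδ le_rfl)))).trans (le_of_eq ?_)
  ring

end Pointwise

section Cubic

theorem enorm_eq_lintegral {α : Type*} [MeasurableSpace α] {μ : Measure α} (f : Lp ℂ 2 μ) :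
    ‖f‖ₑ = (∫⁻ x, ‖f x‖ₑ ^ 2 ∂μ) ^ (1 / 2 : ℝ) := by
  rw [Lp.enorm_def, ← eLpNorm_two_sq, ← ENNReal.rpow_natCast, ← ENNReal.rpow_mul]
  norm_num

theorem enorm_le_of_ae {α : Type*} [MeasurableSpace α] {μ : Measure α} {F f g : Lp ℂ 2 μ}
    {c c' : ℝ≥0∞} (h : ∀ᵐ x ∂μ, ‖F x‖ₑ ≤ c * ‖f x‖ₑ + c' * ‖g x‖ₑ) :
    ‖F‖ₑ ≤ c * ‖f‖ₑ + c' * ‖g‖ₑ := by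
  have hm : ∀ f : Lp ℂ 2 μ, AEMeasurable (fun x => ‖f x‖ₑ) μ := fun f =>
    (Lp.aestronglyMeasurable f).enorm
  have hc : ∀ (c : ℝ≥0∞) (f : Lp ℂ 2 μ), (∫⁻ x, (c * ‖f x‖ₑ) ^ 2 ∂μ) ^ (1 / 2 : ℝ) = c * ‖f‖ₑ := by
    intro c f
    simp only [mul_pow]
    rw [lintegral_const_mul'' _ ((hm f).pow_const 2), ENNReal.mul_rpow_of_nonneg _ _ (by norm_num),
      enorm_eq_lintegral f, ← ENNReal.rpow_natCast, ← ENNReal.rpow_mul]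
    norm_num
  have h2 := ENNReal.lintegral_Lp_add_le (p := 2) ((hm f).const_mul c) ((hm g).const_mul c')
    (by norm_num)
  simp only [Pi.add_apply, ENNReal.rpow_ofNat] at h2
  rw [hc, hc] at h2
  refine le_trans ?_ h2
  rw [enorm_eq_lintegral F]
  refine ENNReal.rpow_le_rpow (lintegral_mono_ae ?_) (by norm_num)
  filter_upwards [h] with x hx
  exact pow_le_pow_left₀ zero_le hx 2

theorem exists_tri (f : L2 d) {g h : L2 d} (hg : eLpNorm g ⊤ volume ≠ ⊤)
    (hh : eLpNorm h ⊤ volume ≠ ⊤) :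
    ∃ F : L2 d, F =ᵐ[volume] fun z => f z * (starRingEnd ℂ) (g z) * h z := by
  have hm : AEStronglyMeasurable (fun z => (starRingEnd ℂ) (g z) * h z) volume :=
    (RCLike.continuous_conj.comp_aestronglyMeasurable (Lp.aestronglyMeasurable g)).mul
      (Lp.aestronglyMeasurable h)
  have hb : eLpNorm (fun z => (starRingEnd ℂ) (g z) * h z) ⊤ volume ≠ ⊤ := by
    refine ne_top_of_le_ne_top (ENNReal.mul_ne_top hg hh) (eLpNorm_top_le_of_ae ?_)
    filter_upwards [ae_enorm_le_eLpNorm_top (μ := volume) g,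
      ae_enorm_le_eLpNorm_top (μ := volume) h] with z h1 h2
    rw [enorm_mul, RCLike.enorm_conj]
    exact mul_le_mul' h1 h2
  refine ⟨(memLp_mul_top f hm hb).toLp, ?_⟩
  filter_upwards [MemLp.coeFn_toLp (memLp_mul_top f hm hb)] with z hz
  rw [hz, mul_assoc]

theorem cub_eq (a : ℂ) : ((‖a‖ ^ 2 : ℝ) : ℂ) * a = a * (starRingEnd ℂ) a * a := by
  rw [Complex.mul_conj, Complex.normSq_eq_norm_sq]

theorem cubic_ae {f : L2 d} (hf : eLpNorm f ⊤ volume ≠ ⊤) :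
    cubic f =ᵐ[volume] fun z => f z * (starRingEnd ℂ) (f z) * f z := by
  obtain ⟨F, hF⟩ := exists_tri f hf hf
  have hm : MemLp (fun z => ((‖f z‖ ^ 2 : ℝ) : ℂ) * f z) 2 (volume : Measure (Space d)) := by
    refine (memLp_congr_ae ?_).1 (Lp.memLp F)
    filter_upwards [hF] with z hz
    rw [hz, cub_eq]
  rw [cubic, dif_pos hm]
  filter_upwards [hm.coeFn_toLp] with z hz
  rw [hz, cub_eq]

theorem cubic_zero : cubic (0 : L2 d) = 0 := by
  have h0 : eLpNorm (0 : L2 d) ⊤ volume ≠ ⊤ := by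
    rw [eLpNorm_congr_ae (Lp.coeFn_zero _ _ _), eLpNorm_zero]; simp
  refine Lp.ext ?_
  filter_upwards [cubic_ae h0, Lp.coeFn_zero ℂ 2 (volume : Measure (Space d))] with z h1 h2
  rw [h1, h2]; simp

theorem enorm_cubic_sub_le {f g : L2 d} {m : ℝ≥0∞} (hm : m ≠ ⊤) (hf : eLpNorm f ⊤ volume ≤ m)
    (hg : eLpNorm g ⊤ volume ≤ m) : ‖cubic f - cubic g‖ₑ ≤ 3 * m ^ 2 * ‖f - g‖ₑ := by
  have h := enorm_le_of_ae (F := cubic f - cubic g) (f := f - g) (g := 0)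
    (c := 3 * m ^ 2) (c' := 0) ?_
  · simpa using h
  filter_upwards [cubic_ae (ne_top_of_le_ne_top hm hf), cubic_ae (ne_top_of_le_ne_top hm hg),
    Lp.coeFn_sub (cubic f) (cubic g), Lp.coeFn_sub f g, ae_enorm_le_eLpNorm_top (μ := volume) f,
    ae_enorm_le_eLpNorm_top (μ := volume) g] with z h1 h2 h3 h4 h5 h6
  rw [h3, h4, Pi.sub_apply, Pi.sub_apply, h1, h2, zero_mul, add_zero]
  exact enorm_cub_sub_cub_le (h5.trans hf) (h6.trans hg)

theorem enorm_cubic_second_diff_le {f f' g g' : L2 d} {m δ : ℝ≥0∞} (hm : m ≠ ⊤)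
    (hf : eLpNorm f ⊤ volume ≤ m) (hf' : eLpNorm f' ⊤ volume ≤ m) (hg : eLpNorm g ⊤ volume ≤ m)
    (hg' : eLpNorm g' ⊤ volume ≤ m) (hδ : eLpNorm (f - g : L2 d) ⊤ volume ≤ δ)
    (hδ' : eLpNorm (f' - g' : L2 d) ⊤ volume ≤ δ) :
    ‖(cubic f' - cubic f) - (cubic g' - cubic g)‖ₑ ≤
      3 * m ^ 2 * ‖(f' - f) - (g' - g)‖ₑ + 6 * (m * δ) * ‖g' - g‖ₑ := by
  refine enorm_le_of_ae ?_
  have nt {x : ℝ≥0∞} (h : x ≤ m) : x ≠ ⊤ := ne_top_of_le_ne_top hm h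
  have B := fun f : L2 d => ae_enorm_le_eLpNorm_top (μ := volume) f
  filter_upwards [cubic_ae (nt hf), cubic_ae (nt hf'), cubic_ae (nt hg), cubic_ae (nt hg'),
    Lp.coeFn_sub (cubic f' - cubic f) (cubic g' - cubic g), Lp.coeFn_sub (cubic f') (cubic f),
    Lp.coeFn_sub (cubic g') (cubic g), Lp.coeFn_sub (f' - f) (g' - g), Lp.coeFn_sub f' f,
    Lp.coeFn_sub g' g, B f, B f', B g, B g', B (f - g), B (f' - g'), Lp.coeFn_sub f g,
    Lp.coeFn_sub f' g'] with z c1 c2 c3 c4 s1 s2 s3 s4 s5 s6 b1 b2 b3 b4 b5 b6 s7 s8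
  rw [s7, Pi.sub_apply] at b5
  rw [s8, Pi.sub_apply] at b6
  rw [s1, s4, Pi.sub_apply, Pi.sub_apply, s2, s3, s5, s6, Pi.sub_apply, Pi.sub_apply,
    Pi.sub_apply, Pi.sub_apply, c1, c2, c3, c4]
  exact enorm_cub_second_diff_le (b1.trans hf) (b2.trans hf') (b3.trans hg) (b4.trans hg')
    (b5.trans hδ) (b6.trans hδ')

end Cubic

section Time

theorem aemeasurable_eLpNorm_top_comp {α X : Type*} [MeasurableSpace α] {μ : Measure α}
    [SigmaFinite μ] [TopologicalSpace.SeparableSpace (Lp ℂ 2 μ)] [MeasurableSpace X]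
    {ν : Measure X} {F : X → Lp ℂ 2 μ} (hF : AEStronglyMeasurable F ν) :
    AEMeasurable (fun x => eLpNorm (F x) ⊤ μ) ν := by
  obtain ⟨G, hG, hFG⟩ := hF
  exact ⟨_, measurable_eLpNorm_top_comp hG, hFG.fun_comp fun f : Lp ℂ 2 μ => eLpNorm f ⊤ μ⟩

theorem aemeasurable_eLpNorm_top {u : ℝ → L2 d} (hu : AEStronglyMeasurable u (volume.restrict I)) :
    AEMeasurable (fun t => eLpNorm (u t) ⊤ volume) (volume.restrict I) :=
  aemeasurable_eLpNorm_top_comp hu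

theorem lintegral_pow_four_ne_top {u : ℝ → L2 d} (h : l4LinftyNorm I u ≠ ⊤) :
    ∫⁻ t in I, eLpNorm (u t) ⊤ volume ^ 4 ≠ ⊤ := by
  intro hc
  rw [l4LinftyNorm, hc] at h
  simp at h

theorem ae_eLpNorm_top_ne_top {u : ℝ → L2 d} (hu : AEStronglyMeasurable u (volume.restrict I))
    (h : l4LinftyNorm I u ≠ ⊤) : ∀ᵐ t ∂volume.restrict I, eLpNorm (u t) ⊤ volume ≠ ⊤ := by
  filter_upwards [ae_lt_top' ((aemeasurable_eLpNorm_top hu).pow_const 4)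
    (lintegral_pow_four_ne_top h)] with t ht hc
  rw [hc] at ht
  simp at ht

theorem continuousOn_cubic (n : ℝ≥0) :
    ContinuousOn cubic {f : L2 d | eLpNorm f ⊤ volume ≤ n} := by
  have : LipschitzOnWith (3 * n ^ 2) cubic {f : L2 d | eLpNorm f ⊤ volume ≤ n} := by
    intro f hf g hg
    rw [edist_eq_enorm_sub, edist_eq_enorm_sub]
    simpa using enorm_cubic_sub_le ENNReal.coe_ne_top hf hg
  exact this.continuousOn

/-- The cubic map is not continuous on L², but it is Lipschitz on each set where the sup norm is at
most n. These sublevel sets exhaust almost all times, and on each of them the curve is a continuous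
composition. -/
theorem aestronglyMeasurable_cubic {a b : ℝ} (hab : a ≤ b) {u : ℝ → L2 d}
    (hu : ContinuousOn u (Icc a b))
    (hf : ∀ᵐ t ∂volume.restrict (Icc a b), eLpNorm (u t) ⊤ volume ≠ ⊤) :
    AEStronglyMeasurable (fun t => cubic (u t)) (volume.restrict (Icc a b)) := by
  -- Extending the curve continuously to the line makes its sup norm Borel measurable, hence the
  -- sublevel sets measurable.
  let v : ℝ → L2 d := IccExtend hab ((Icc a b).domRestrict u)
  have hv : Continuous v := hu.domRestrict.Icc_extend'
  have huv : ∀ t ∈ Icc a b, v t = u t := fun t ht => IccExtend_of_mem hab _ ht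
  have hmeas : Measurable fun t => eLpNorm (v t) ⊤ volume :=
    measurable_eLpNorm_top_comp hv.stronglyMeasurable
  let A : ℕ → Set ℝ := fun n => Icc a b ∩ {t | eLpNorm (v t) ⊤ volume ≤ n}
  have hA : ∀ n, MeasurableSet (A n) := fun n =>
    measurableSet_Icc.inter (hmeas measurableSet_Iic)
  have hU : (⋃ n, A n) =ᵐ[volume] Icc a b := by
    have h1 : ∀ᵐ t, t ∈ Icc a b → eLpNorm (u t) ⊤ volume ≠ ⊤ :=
      (ae_restrict_iff' measurableSet_Icc).1 hf
    filter_upwards [h1] with t ht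
    refine propext ⟨fun h => ?_, fun h => ?_⟩
    · obtain ⟨n, hn⟩ := mem_iUnion.1 h
      exact hn.1
    · obtain ⟨n, hn⟩ := ENNReal.exists_nat_gt (ht h)
      exact mem_iUnion.2 ⟨n, h, by
        change eLpNorm (v t) ⊤ volume ≤ n
        rw [huv t h]; exact hn.le⟩
  rw [← Measure.restrict_congr_set hU, aestronglyMeasurable_iUnion_iff]
  intro n
  refine ContinuousOn.aestronglyMeasurable ?_ (hA n)
  refine (continuousOn_cubic (d := d) n).comp (hu.mono inter_subset_left) fun t ht => ?_
  have := ht.2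
  change eLpNorm (v t) ⊤ volume ≤ n at this
  rw [huv t ht.1] at this
  exact_mod_cast this

theorem lintegral_sq_le (μ : Measure ℝ) {m : ℝ → ℝ≥0∞} (hm : AEMeasurable m μ) :
    ∫⁻ t, m t ^ 2 ∂μ ≤ μ univ ^ (1 / 2 : ℝ) * (∫⁻ t, m t ^ 4 ∂μ) ^ (1 / 2 : ℝ) := by
  have h := lintegral_mul_sq_le (μ := μ) (a := fun _ => 1) (b := fun t => m t ^ 2)
    aemeasurable_const (hm.pow_const 2)
  simpa only [one_mul, one_pow, lintegral_one, ← pow_mul] using h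

/-- Curves in `C([a, b]; L²) ∩ L⁴([a, b]; L^∞)`. -/
structure Adm (a b : ℝ) (u : ℝ → L2 d) : Prop where
  cont : ContinuousOn u (Icc a b)
  l4 : l4LinftyNorm (Icc a b) u ≠ ⊤

variable {a b : ℝ} {u v : ℝ → L2 d}

theorem Adm.meas (hu : Adm a b u) : AEStronglyMeasurable u (volume.restrict (Icc a b)) :=
  hu.cont.aestronglyMeasurable measurableSet_Icc

theorem Adm.ae (hu : Adm a b u) :
    ∀ᵐ t ∂volume.restrict (Icc a b), eLpNorm (u t) ⊤ volume ≠ ⊤ :=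
  ae_eLpNorm_top_ne_top hu.meas hu.l4

/-- The L² norm of the cubic term is at most a constant times ‖u‖_∞² ‖u‖, where ‖u‖ is bounded on
the compact interval and ‖u‖_∞² is integrable because ‖u‖_∞ is in L⁴. Hence the Bochner integral in
Duhamel's formula is never a default value. -/
theorem Adm.integrableOn_cubic (hab : a ≤ b) (hu : Adm a b u) :
    IntegrableOn (fun t => cubic (u t)) (Icc a b) := by
  refine ⟨aestronglyMeasurable_cubic hab hu.cont hu.ae, ?_⟩
  obtain ⟨C, hC⟩ := isCompact_Icc.exists_bound_of_continuousOn hu.cont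
  have h1 : ∀ᵐ t ∂volume.restrict (Icc a b),
      ‖cubic (u t)‖ₑ ≤ ENNReal.ofReal C * (3 * eLpNorm (u t) ⊤ volume ^ 2) := by
    filter_upwards [hu.ae, ae_restrict_mem measurableSet_Icc] with t ht htI
    have h0 : eLpNorm (0 : L2 d) ⊤ volume ≤ eLpNorm (u t) ⊤ volume := by
      rw [eLpNorm_congr_ae (Lp.coeFn_zero _ _ _), eLpNorm_zero]; exact zero_le
    have := enorm_cubic_sub_le ht le_rfl h0
    rw [cubic_zero, sub_zero, sub_zero] at this
    refine this.trans ?_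
    rw [mul_comm]
    gcongr
    rw [← ofReal_norm]
    exact ENNReal.ofReal_le_ofReal (hC t htI)
  refine lt_of_le_of_lt (lintegral_mono_ae h1) ?_
  rw [lintegral_const_mul' _ _ ENNReal.ofReal_ne_top, lintegral_const_mul' _ _ (by simp)]
  refine ENNReal.mul_lt_top ENNReal.ofReal_lt_top (ENNReal.mul_lt_top (by simp) ?_)
  refine lt_of_le_of_lt (lintegral_sq_le _ (aemeasurable_eLpNorm_top hu.meas)) ?_
  refine ENNReal.mul_lt_top ?_ ?_
  · exact ENNReal.rpow_lt_top_of_nonneg (by norm_num) (by simp)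
  · exact ENNReal.rpow_lt_top_of_nonneg (by norm_num) (lintegral_pow_four_ne_top hu.l4)

theorem Adm.intervalIntegrable_cubic (ha : a ≤ 0) (hb : 0 ≤ b) (hu : Adm a b u) {t : ℝ}
    (ht : t ∈ Icc a b) : IntervalIntegrable (fun t => cubic (u t)) volume 0 t :=
  intervalIntegrable_of_integrableOn ha hb (hu.integrableOn_cubic (ha.trans hb)) ht

theorem adm_of_zN (hd : 1 ≤ d) (hs : (d : ℝ) / 2 < s) (hu : ContinuousOn u (Icc a b))
    (hz : zN s (Icc a b) u ≠ ⊤) : Adm a b u :=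
  ⟨hu, ne_top_of_le_ne_top (ENNReal.mul_ne_top (embC_ne_top hd hs) hz)
    (l4LinftyNorm_le_zN (hu.aestronglyMeasurable measurableSet_Icc))⟩

theorem nonneg_of_half_lt (hs : (d : ℝ) / 2 < s) : 0 ≤ s :=
  (div_nonneg (Nat.cast_nonneg d) (by norm_num)).trans hs.le

theorem eLpNorm_top_ne_top_of_tsum {f : L2 d} (hf : ∑' k, eLpNorm (mode k f) ⊤ volume ≠ ⊤) :
    eLpNorm f ⊤ volume ≠ ⊤ :=
  ne_top_of_le_ne_top (ENNReal.mul_ne_top cst_ne_top hf) (eLpNorm_top_le_tsum f)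

theorem cubic_sub_cubic_eq {f g w F₁ F₂ F₃ : L2 d} (hw : w = f - g)
    (hf : eLpNorm f ⊤ volume ≠ ⊤) (hg : eLpNorm g ⊤ volume ≠ ⊤)
    (h₁ : F₁ =ᵐ[volume] fun z => w z * (starRingEnd ℂ) (f z) * f z)
    (h₂ : F₂ =ᵐ[volume] fun z => g z * (starRingEnd ℂ) (w z) * f z)
    (h₃ : F₃ =ᵐ[volume] fun z => g z * (starRingEnd ℂ) (g z) * w z) :
    cubic f - cubic g = F₁ + F₂ + F₃ := by
  refine Lp.ext ?_
  have hw' : w =ᵐ[volume] f - g := by rw [hw]; exact Lp.coeFn_sub f g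
  filter_upwards [h₁, h₂, h₃, cubic_ae hf, cubic_ae hg, Lp.coeFn_sub (cubic f) (cubic g), hw',
    Lp.coeFn_add (F₁ + F₂) F₃, Lp.coeFn_add F₁ F₂] with z e1 e2 e3 e4 e5 e6 e7 e8 e9
  rw [e6, e8, Pi.sub_apply, Pi.add_apply, e9, Pi.add_apply, e1, e2, e3, e4, e5, e7, Pi.sub_apply,
    cub_sub_cub]

theorem enorm_mode_cubic_sub_le {w : ℝ → L2 d} {t : ℝ} (ht : t ∈ I) (hw : w t = u t - v t)
    (hut : ∑' k, eLpNorm (mode k (u t)) ⊤ volume ≠ ⊤)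
    (hvt : ∑' k, eLpNorm (mode k (v t)) ⊤ volume ≠ ⊤)
    (hwt : ∑' k, eLpNorm (mode k (w t)) ⊤ volume ≠ ⊤) (k : Fin d → ℤ) :
    ‖mode k (cubic (u t) - cubic (v t))‖ₑ ≤ triB I w u u k t +
      triB I v w u k t + triB I v v w k t := by
  have hu := eLpNorm_top_ne_top_of_tsum hut
  have hv := eLpNorm_top_ne_top_of_tsum hvt
  have hw' := eLpNorm_top_ne_top_of_tsum hwt
  obtain ⟨F₁, h₁⟩ := exists_tri (w t) hu hu
  obtain ⟨F₂, h₂⟩ := exists_tri (v t) hw' hu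
  obtain ⟨F₃, h₃⟩ := exists_tri (v t) hv hw'
  rw [cubic_sub_cubic_eq hw hu hv h₁ h₂ h₃, mode_add, mode_add]
  refine (enorm_add_le _ _).trans (add_le_add ((enorm_add_le _ _).trans (add_le_add ?_ ?_)) ?_)
  · exact enorm_mode_le_triB ht h₁ hut hut k
  · exact enorm_mode_le_triB ht h₂ hwt hut k
  · exact enorm_mode_le_triB ht h₃ hvt hwt k

/-- The Duhamel term is locally Lipschitz in the solution norm. -/
theorem zN_duh_cubic_sub_le (hd : 1 ≤ d) (hs : (d : ℝ) / 2 < s) (ha : a ≤ 0) (hb : 0 ≤ b)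
    (hu : ContinuousOn u (Icc a b)) (hv : ContinuousOn v (Icc a b)) {ρ : ℝ≥0∞} (hρ : ρ ≠ ⊤)
    (hzu : zN s (Icc a b) u ≤ ρ) (hzv : zN s (Icc a b) v ≤ ρ) :
    zN s (Icc a b) (fun t => duh (fun τ => cubic (u τ)) t - duh (fun τ => cubic (v τ)) t) ≤
      15 * triC d s * volume (Icc a b) ^ (1 / 2 : ℝ) * ρ ^ 2 *
        zN s (Icc a b) (fun t => u t - v t) := by
  have hab := ha.trans hb
  have hu' := adm_of_zN hd hs hu (ne_top_of_le_ne_top hρ hzu)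
  have hv' := adm_of_zN hd hs hv (ne_top_of_le_ne_top hρ hzv)
  have hw : ContinuousOn (fun t => u t - v t) (Icc a b) := hu.sub hv
  have hzw : zN s (Icc a b) (fun t => u t - v t) ≠ ⊤ :=
    ne_top_of_le_ne_top (ENNReal.add_ne_top.2 ⟨hρ, hρ⟩)
      ((zN_sub_le hu'.meas hv'.meas).trans (add_le_add hzu hzv))
  have hwm : AEStronglyMeasurable (fun t => u t - v t) (volume.restrict (Icc a b)) :=
    hw.aestronglyMeasurable measurableSet_Icc
  have e1 := zN_congr (s := s) measurableSet_Icc fun t (ht : t ∈ Icc a b) =>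
    duh_sub (hu'.intervalIntegrable_cubic ha hb ht) (hv'.intervalIntegrable_cubic ha hb ht)
  rw [e1]
  refine (zN_duh_le ha hb ((hu'.integrableOn_cubic hab).sub (hv'.integrableOn_cubic hab))).trans ?_
  set w : ℝ → L2 d := fun t => u t - v t with hwdef
  have h2 : ell s (fun k => ∫⁻ t in Icc a b, ‖mode k (cubic (u t) - cubic (v t))‖ₑ) ≤
      ell s (fun k => ((∫⁻ t in Icc a b, triB (Icc a b) w u u k t) +
        ∫⁻ t in Icc a b, triB (Icc a b) v w u k t) + ∫⁻ t in Icc a b, triB (Icc a b) v v w k t) := by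
    refine ell_mono fun k => ?_
    rw [← lintegral_add_left' (aemeasurable_triB hu'.meas hu'.meas k),
      ← lintegral_add_right' _ (aemeasurable_triB hv'.meas hwm k)]
    refine lintegral_mono_ae ?_
    filter_upwards [ae_tsum_mode_ne_top hu'.meas (tsum_l4N_ne_top hd hs (ne_top_of_le_ne_top hρ hzu)),
      ae_tsum_mode_ne_top hv'.meas (tsum_l4N_ne_top hd hs (ne_top_of_le_ne_top hρ hzv)),
      ae_tsum_mode_ne_top hwm (tsum_l4N_ne_top hd hs hzw),
      ae_restrict_mem measurableSet_Icc] with t h1 h2 h3 ht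
    exact enorm_mode_cubic_sub_le ht rfl h1 h2 h3 k
  have hs0 := nonneg_of_half_lt hs
  -- The constant 15 is 5 from the Duhamel bound times the 3 terms of the difference of cubes, each
  -- with w = u − v in one slot.
  calc _ ≤ 5 * ((triC d s * volume (Icc a b) ^ (1 / 2 : ℝ) *
          (zN s (Icc a b) w * ρ * ρ) + triC d s * volume (Icc a b) ^ (1 / 2 : ℝ) *
          (ρ * zN s (Icc a b) w * ρ)) + triC d s * volume (Icc a b) ^ (1 / 2 : ℝ) *
          (ρ * ρ * zN s (Icc a b) w)) := by
        refine mul_le_mul_right (h2.trans ((ell_add_le _ _ _).trans (add_le_add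
          ((ell_add_le _ _ _).trans (add_le_add ?_ ?_)) ?_))) _
        · refine (ell_lintegral_triB_le hs0 hu'.meas hu'.meas).trans ?_
          gcongr
        · refine (ell_lintegral_triB_le hs0 hwm hu'.meas).trans ?_
          gcongr
        · refine (ell_lintegral_triB_le hs0 hv'.meas hwm).trans ?_
          gcongr
    _ = _ := by ring

end Time

end

/-! ### Gronwall's inequality and uniqueness -/

section

section Gronwall

/-- The constant in Gronwall's inequality. -/
def gronC : ℕ → ℝ≥0
  | 0 => 1
  | n + 1 => 2 * (1 + (n + 1) * gronC n)

theorem uIoc_subset_union {r t : ℝ} : uIoc 0 t ⊆ uIoc 0 r ∪ uIoc r t := by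
  intro x hx
  simp only [mem_union, mem_uIoc] at *
  grind

theorem uIoc_zero_subset_of_mem {r t : ℝ} (h : r ∈ uIcc 0 t) : uIoc 0 r ⊆ uIoc 0 t := by
  intro x hx
  simp only [mem_uIoc, mem_uIcc] at *
  grind

theorem uIoc_subset_of_mem {r t : ℝ} (h : r ∈ uIcc 0 t) : uIoc r t ⊆ uIoc 0 t := by
  intro x hx
  simp only [mem_uIoc, mem_uIcc] at *
  grind

theorem mem_uIcc_of_mem_uIoc {r t : ℝ} (h : r ∈ uIoc 0 t) : r ∈ uIcc 0 t := by
  simp only [mem_uIoc, mem_uIcc] at *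
  grind

/-- The integral of `m` over `[0, t]` takes the value `c` if `c` lies below the integral. -/
theorem exists_lintegral_split {m : ℝ → ℝ≥0∞} {a b t : ℝ} (ha : a ≤ 0) (hb : 0 ≤ b)
    (hm : AEMeasurable m (volume.restrict (Icc a b))) (hfin : ∫⁻ r in Icc a b, m r ≠ ⊤)
    (ht : t ∈ Icc a b) {c e : ℝ} (hc : 0 ≤ c)
    (hct : ENNReal.ofReal c ≤ ∫⁻ r in uIoc 0 t, m r)
    (het : ∫⁻ r in uIoc 0 t, m r ≤ ENNReal.ofReal (c + e)) (he : 0 ≤ e) :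
    ∃ r ∈ uIcc 0 t, ∫⁻ x in uIoc 0 r, m x ≤ ENNReal.ofReal c ∧
      ∫⁻ x in uIoc r t, m x ≤ ENNReal.ofReal e := by
  have hsub := uIoc_zero_subset ha hb ht
  let f : ℝ → ℝ := fun r => (m r).toReal
  have hmt : AEMeasurable m (volume.restrict (uIoc 0 t)) := hm.mono_set hsub
  have hft : ∫⁻ r in uIoc 0 t, m r ≠ ⊤ := ne_top_of_le_ne_top hfin (lintegral_mono_set hsub)
  have hf : IntervalIntegrable f volume 0 t :=
    intervalIntegrable_iff.2 (integrable_toReal_of_lintegral_ne_top hmt hft)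
  have hmf : ∀ p q, p ∈ uIcc 0 t → q ∈ uIcc 0 t →
      ∫⁻ x in uIoc p q, m x = ENNReal.ofReal |∫ x in p..q, f x| := fun p q hp hq => by
    have hs : uIoc p q ⊆ uIoc 0 t := by
      intro x hx
      simp only [mem_uIoc, mem_uIcc] at *
      grind
    rw [intervalIntegral.abs_intervalIntegral_eq, integral_toReal (hmt.mono_set hs)
      (ae_lt_top' (hmt.mono_set hs) (ne_top_of_le_ne_top hft (lintegral_mono_set hs))),
      abs_of_nonneg ENNReal.toReal_nonneg, ENNReal.ofReal_toReal]
    exact ne_top_of_le_ne_top hft (lintegral_mono_set hs)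
  have h0 : (0 : ℝ) ∈ uIcc 0 t := left_mem_uIcc
  have h1 : t ∈ uIcc 0 t := right_mem_uIcc
  let F : ℝ → ℝ := fun r => ∫ x in (0 : ℝ)..r, f x
  have hF : ContinuousOn F (uIcc 0 t) :=
    intervalIntegral.continuousOn_primitive_interval' hf h0
  have hF0 : F 0 = 0 := intervalIntegral.integral_same
  rw [hmf 0 t h0 h1] at hct het
  rw [ENNReal.ofReal_le_ofReal_iff (abs_nonneg _)] at hct
  rw [ENNReal.ofReal_le_ofReal_iff (by positivity)] at het
  change c ≤ |F t| at hct
  change |F t| ≤ c + e at het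
  -- For negative t the primitive is nonpositive, so the intermediate value to be attained is −c.
  have hsplit : ∃ c', |c'| = c ∧ |F t - c'| ≤ e ∧ c' ∈ uIcc (F 0) (F t) := by
    rw [hF0]
    rcases le_total 0 (F t) with h | h
    · rw [abs_of_nonneg h] at hct het
      refine ⟨c, abs_of_nonneg hc, ?_, ?_⟩
      · rw [abs_of_nonneg (by linarith)]; linarith
      · rw [mem_uIcc]; exact Or.inl ⟨hc, hct⟩
    · rw [abs_of_nonpos h] at hct het
      refine ⟨-c, by rw [abs_neg, abs_of_nonneg hc], ?_, ?_⟩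
      · rw [abs_of_nonpos (by linarith)]; linarith
      · rw [mem_uIcc]; exact Or.inr ⟨by linarith, by linarith⟩
  obtain ⟨c', hc1, hc2, hc3⟩ := hsplit
  obtain ⟨r, hr, hrc⟩ := intermediate_value_uIcc hF hc3
  refine ⟨r, hr, ?_, ?_⟩
  · rw [hmf 0 r h0 hr]
    change ENNReal.ofReal |F r| ≤ _
    rw [hrc, hc1]
  · rw [hmf r t hr h1, ← intervalIntegral.integral_interval_sub_left hf
      (hf.mono_set (uIcc_subset_uIcc h0 hr))]
    refine ENNReal.ofReal_le_ofReal ?_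
    change |F t - F r| ≤ e
    rwa [hrc]

/-- Gronwall's inequality with an integrable coefficient, in both time directions. -/
theorem gronwall {m y : ℝ → ℝ≥0∞} {a b : ℝ} (ha : a ≤ 0) (hb : 0 ≤ b)
    (hm : AEMeasurable m (volume.restrict (Icc a b))) {N : ℕ}
    (hN : ∫⁻ r in Icc a b, m r ≤ ENNReal.ofReal (N / 2)) {α B : ℝ≥0∞} (hB : B ≠ ⊤)
    (hyB : ∀ t ∈ Icc a b, y t ≤ B)
    (hy : ∀ t ∈ Icc a b, y t ≤ α + ∫⁻ τ in uIoc 0 t, m τ * y τ) :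
    ∀ t ∈ Icc a b, y t ≤ gronC N * α := by
  have hfin : ∫⁻ r in Icc a b, m r ≠ ⊤ := ne_top_of_le_ne_top ENNReal.ofReal_ne_top hN
  have key : ∀ n : ℕ, ∀ t ∈ Icc a b, ∫⁻ r in uIoc 0 t, m r ≤ ENNReal.ofReal (n / 2) →
      y t ≤ gronC n * α := by
    have hint : ∀ {J : Set ℝ} {c : ℝ≥0∞}, MeasurableSet J → J ⊆ Icc a b → (∀ x ∈ J, y x ≤ c) →
        ∫⁻ τ in J, m τ * y τ ≤ (∫⁻ τ in J, m τ) * c := by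
      intro J c hJ hJs hc
      rw [← lintegral_mul_const'' _ (hm.mono_set hJs)]
      exact setLIntegral_mono' hJ fun x hx => mul_le_mul_right (hc x hx) _
    intro n
    induction n with
    | zero =>
      intro t ht h0
      refine (hy t ht).trans ?_
      have := hint measurableSet_uIoc (uIoc_zero_subset ha hb ht)
        fun x hx => hyB x (uIoc_zero_subset ha hb ht hx)
      simp only [CharP.cast_eq_zero, zero_div, ENNReal.ofReal_zero, nonpos_iff_eq_zero] at h0
      rw [h0, zero_mul, nonpos_iff_eq_zero] at this
      rw [this, gronC]
      simp
    | succ n ih =>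
      -- Induction in steps of mass 1/2 of m. On the last piece the integral term is at most half
      -- the supremum Y over S and can be absorbed; on the earlier pieces the induction hypothesis
      -- holds.
      let S : Set ℝ := {t ∈ Icc a b | ∫⁻ r in uIoc 0 t, m r ≤ ENNReal.ofReal ((n + 1 : ℕ) / 2)}
      let Y : ℝ≥0∞ := ⨆ t ∈ S, y t
      -- The a priori bound B enters only here: without finiteness Y/2 cannot be subtracted.
      have hYB : Y ≠ ⊤ := ne_top_of_le_ne_top hB (iSup₂_le fun t ht => hyB t ht.1)
      have hYS : ∀ t ∈ S, y t ≤ Y := fun t ht => le_iSup₂ (f := fun t _ => y t) t ht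
      have hstep : ∀ t ∈ S, y t ≤ (1 + (n + 1) * gronC n) * α + 2⁻¹ * Y := by
        rintro t ⟨ht, htn⟩
        rcases le_total (∫⁻ r in uIoc 0 t, m r) (ENNReal.ofReal (n / 2)) with h | h
        · refine (ih t ht h).trans (le_trans ?_ le_self_add)
          gcongr
          calc (gronC n : ℝ≥0∞) = 1 * gronC n := (one_mul _).symm
            _ ≤ (n + 1) * gronC n := by gcongr; exact le_add_self
            _ ≤ _ := le_add_self
        · obtain ⟨r, hr, hr1, hr2⟩ := exists_lintegral_split ha hb hm hfin ht
            (c := n / 2) (e := 1 / 2) (by positivity) h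
            (htn.trans (ENNReal.ofReal_le_ofReal (by push_cast; linarith))) (by norm_num)
          have hI : uIcc 0 t ⊆ Icc a b := by
            rw [← uIcc_of_le (ha.trans hb)]
            refine uIcc_subset_uIcc ?_ ?_
            · rw [uIcc_of_le (ha.trans hb)]; exact ⟨ha, hb⟩
            · rwa [uIcc_of_le (ha.trans hb)]
          have b1 : ∫⁻ τ in uIoc 0 r, m τ * y τ ≤ ENNReal.ofReal (n / 2) * (gronC n * α) := by
            refine (hint measurableSet_uIoc
              ((uIoc_zero_subset_of_mem hr).trans (uIoc_zero_subset ha hb ht))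
              fun x hx => ih x (hI (mem_uIcc_of_mem_uIoc (uIoc_zero_subset_of_mem hr hx)))
                ((lintegral_mono_set (uIoc_zero_subset_of_mem (mem_uIcc_of_mem_uIoc hx))).trans
                  hr1)).trans ?_
            gcongr
          have b2 : ∫⁻ τ in uIoc r t, m τ * y τ ≤ ENNReal.ofReal (1 / 2) * Y := by
            refine (hint measurableSet_uIoc
              ((uIoc_subset_of_mem hr).trans (uIoc_zero_subset ha hb ht))
              fun x hx => hYS x ⟨?_, ?_⟩).trans ?_
            · exact hI (mem_uIcc_of_mem_uIoc (uIoc_subset_of_mem hr hx))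
            · exact (lintegral_mono_set (uIoc_zero_subset_of_mem
                (mem_uIcc_of_mem_uIoc (uIoc_subset_of_mem hr hx)))).trans htn
            · gcongr
          have e1 : ENNReal.ofReal (n / 2) ≤ n + 1 := by
            refine (ENNReal.ofReal_le_ofReal (q := n) ?_).trans ?_
            · have : (0 : ℝ) ≤ n := Nat.cast_nonneg n
              linarith
            · rw [ENNReal.ofReal_natCast]; exact le_self_add
          have e2 : ENNReal.ofReal (1 / 2) = 2⁻¹ := by
            rw [one_div, ENNReal.ofReal_inv_of_pos (by norm_num)]; simp
          calc y t ≤ α + ∫⁻ τ in uIoc 0 t, m τ * y τ := hy t ht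
            _ ≤ α + ((∫⁻ τ in uIoc 0 r, m τ * y τ) + ∫⁻ τ in uIoc r t, m τ * y τ) := by
                gcongr
                exact (lintegral_mono_set uIoc_subset_union).trans (lintegral_union_le _ _ _)
            _ ≤ α + (ENNReal.ofReal (n / 2) * (gronC n * α) + ENNReal.ofReal (1 / 2) * Y) := by
                gcongr
            _ ≤ α + ((n + 1) * (gronC n * α) + 2⁻¹ * Y) := by
                rw [e2]; gcongr
            _ = _ := by ring
      have hY : Y ≤ (1 + (n + 1) * gronC n) * α + 2⁻¹ * Y := iSup₂_le hstep
      have hY2 : Y ≤ 2 * ((1 + (n + 1) * gronC n) * α) := by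
        have h2 : 2⁻¹ * Y + 2⁻¹ * Y = Y := by
          rw [← add_mul, ENNReal.inv_two_add_inv_two, one_mul]
        have h3 : 2⁻¹ * Y ≤ (1 + (n + 1) * gronC n) * α := by
          refine (ENNReal.add_le_add_iff_right
            (ENNReal.mul_ne_top (by simp) hYB : 2⁻¹ * Y ≠ ⊤)).1 ?_
          rw [h2]; exact hY
        calc Y = 2 * (2⁻¹ * Y) := by
              rw [← mul_assoc, ENNReal.mul_inv_cancel (by simp) (by simp), one_mul]
          _ ≤ _ := mul_le_mul_right h3 _
      intro t ht htn
      refine (hYS t ⟨ht, htn⟩).trans (hY2.trans (le_of_eq ?_))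
      rw [gronC]
      push_cast
      ring
  intro t ht
  exact key N t ht ((lintegral_mono_set (uIoc_zero_subset ha hb ht)).trans hN)

end Gronwall

/-! ### Mild solutions at the L² level -/

section Sol

variable {d : ℕ} {s a b : ℝ} {u v : ℝ → L2 d} {u₀ v₀ : L2 d}

/-- Mild solutions in `C([a, b]; L²) ∩ L⁴([a, b]; L^∞)`. -/
structure Sol (a b : ℝ) (u₀ : L2 d) (u : ℝ → L2 d) : Prop extends Adm a b u where
  duhamel : ∀ t ∈ Icc a b, u t = U t u₀ - Complex.I • duh (fun τ => cubic (u τ)) t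

theorem IsSolution.continuousOn (hs : 0 ≤ s) (h : IsSolution s a b u₀ u) :
    ContinuousOn u (Icc a b) := by
  intro t ht
  refine tendsto_iff_edist_tendsto_0.2 (tendsto_of_tendsto_of_tendsto_of_le_of_le
    tendsto_const_nhds (h.hs_continuous t ht) (fun _ => zero_le) fun τ => ?_)
  rw [edist_eq_enorm_sub]
  exact enorm_le_hsNorm hs _

/-- Sobolev regularity is discarded here: uniqueness, the Gronwall bounds and the Galilei
transformation all live in C(I; L²) ∩ L⁴(I; L^∞). -/
theorem IsSolution.sol (hs : 0 ≤ s) (h : IsSolution s a b u₀ u) : Sol a b u₀ u :=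
  ⟨⟨h.continuousOn hs, h.l4Linfty_finite.ne⟩, h.duhamel⟩

/-- The larger one of two `L^∞` norms. -/
def mx (u v : ℝ → L2 d) (t : ℝ) : ℝ≥0∞ := max (eLpNorm (u t) ⊤ volume) (eLpNorm (v t) ⊤ volume)

theorem mx_ne_top {t : ℝ} (hu : eLpNorm (u t) ⊤ volume ≠ ⊤) (hv : eLpNorm (v t) ⊤ volume ≠ ⊤) :
    mx u v t ≠ ⊤ := (max_lt hu.lt_top hv.lt_top).ne

theorem aemeasurable_mx (hu : Adm a b u) (hv : Adm a b v) :
    AEMeasurable (mx u v) (volume.restrict (Icc a b)) :=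
  (aemeasurable_eLpNorm_top hu.meas).sup (aemeasurable_eLpNorm_top hv.meas)

theorem lintegral_mx_four_le (hu : Adm a b u) :
    ∫⁻ t in Icc a b, mx u v t ^ 4 ≤
      l4LinftyNorm (Icc a b) u ^ 4 + l4LinftyNorm (Icc a b) v ^ 4 := by
  rw [l4LinftyNorm, l4LinftyNorm, rpow_quarter_pow, rpow_quarter_pow,
    ← lintegral_add_left' ((aemeasurable_eLpNorm_top hu.meas).pow_const 4)]
  refine lintegral_mono fun t => ?_
  rcases max_cases (eLpNorm (u t) ⊤ volume) (eLpNorm (v t) ⊤ volume) with h | h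
  · rw [mx, h.1]; exact le_self_add
  · rw [mx, h.1]; exact le_add_self

theorem lintegral_mx_sq_le (hu : Adm a b u) (hv : Adm a b v) :
    ∫⁻ t in Icc a b, 3 * mx u v t ^ 2 ≤ 3 * (volume (Icc a b) ^ (1 / 2 : ℝ) *
      (l4LinftyNorm (Icc a b) u ^ 4 + l4LinftyNorm (Icc a b) v ^ 4) ^ (1 / 2 : ℝ)) := by
  rw [lintegral_const_mul' _ _ (by simp)]
  refine mul_le_mul_right ((lintegral_sq_le _ (aemeasurable_mx hu hv)).trans ?_) _
  rw [Measure.restrict_apply_univ]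
  gcongr
  exact lintegral_mx_four_le hu

theorem exists_nat_half_ge {x : ℝ≥0∞} (hx : x ≠ ⊤) : ∃ N : ℕ, x ≤ ENNReal.ofReal (N / 2) := by
  obtain ⟨N, hN⟩ := exists_nat_ge (2 * x.toReal)
  refine ⟨N, ?_⟩
  rw [← ENNReal.ofReal_toReal hx]
  exact ENNReal.ofReal_le_ofReal (by linarith)

theorem exists_bound_of_continuousOn {w : ℝ → L2 d} (hw : ContinuousOn w (Icc a b)) :
    ∃ B : ℝ≥0∞, B ≠ ⊤ ∧ ∀ t ∈ Icc a b, ‖w t‖ₑ ≤ B := by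
  obtain ⟨C, hC⟩ := isCompact_Icc.exists_bound_of_continuousOn hw
  refine ⟨ENNReal.ofReal C, ENNReal.ofReal_ne_top, fun t ht => ?_⟩
  rw [← ofReal_norm]
  exact ENNReal.ofReal_le_ofReal (hC t ht)

theorem ae_uIoc {p : ℝ → Prop} (ha : a ≤ 0) (hb : 0 ≤ b) {t : ℝ} (ht : t ∈ Icc a b)
    (h : ∀ᵐ t ∂volume.restrict (Icc a b), p t) : ∀ᵐ t ∂volume.restrict (uIoc 0 t), p t :=
  ae_restrict_of_ae_restrict_of_subset (uIoc_zero_subset ha hb ht) h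

theorem Sol.sub_eq (ha : a ≤ 0) (hb : 0 ≤ b) (hu : Sol a b u₀ u) (hv : Sol a b v₀ v) {t : ℝ}
    (ht : t ∈ Icc a b) :
    u t - v t = U t (u₀ - v₀) - Complex.I • duh (fun τ => cubic (u τ) - cubic (v τ)) t := by
  rw [hu.duhamel t ht, hv.duhamel t ht, U_sub, ← duh_sub (hu.intervalIntegrable_cubic ha hb ht)
    (hv.intervalIntegrable_cubic ha hb ht), smul_sub]
  abel

theorem enorm_sub_I_smul_le (f g : L2 d) : ‖f - Complex.I • g‖ₑ ≤ ‖f‖ₑ + ‖g‖ₑ := by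
  refine enorm_sub_le.trans (le_of_eq ?_)
  rw [enorm_smul, ← ofReal_norm Complex.I, Complex.norm_I]
  simp

/-- Only unitarity on L² and the pointwise bound for the difference of cubes are used; the
coefficient is integrable because the sup norms are in L⁴ on a bounded interval. -/
theorem Sol.enorm_sub_le_integral (ha : a ≤ 0) (hb : 0 ≤ b) (hu : Sol a b u₀ u)
    (hv : Sol a b v₀ v) {t : ℝ} (ht : t ∈ Icc a b) :
    ‖u t - v t‖ₑ ≤ ‖u₀ - v₀‖ₑ + ∫⁻ τ in uIoc 0 t, 3 * mx u v τ ^ 2 * ‖u τ - v τ‖ₑ := by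
  rw [hu.sub_eq ha hb hv ht]
  refine (enorm_sub_I_smul_le _ _).trans ?_
  rw [enorm_U]
  refine add_le_add le_rfl ((enorm_duh_le t).trans (lintegral_mono_ae ?_))
  filter_upwards [ae_uIoc ha hb ht hu.ae, ae_uIoc ha hb ht hv.ae] with τ h1 h2
  exact enorm_cubic_sub_le (mx_ne_top h1 h2) (le_max_left _ _) (le_max_right _ _)

theorem Sol.enorm_sub_le (ha : a ≤ 0) (hb : 0 ≤ b) (hu : Sol a b u₀ u) (hv : Sol a b v₀ v) {N : ℕ}
    (hN : ∫⁻ t in Icc a b, 3 * mx u v t ^ 2 ≤ ENNReal.ofReal (N / 2)) {t : ℝ} (ht : t ∈ Icc a b) :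
    ‖u t - v t‖ₑ ≤ gronC N * ‖u₀ - v₀‖ₑ := by
  obtain ⟨B, hB, hwB⟩ := exists_bound_of_continuousOn (hu.cont.sub hv.cont)
  exact gronwall ha hb (((aemeasurable_mx hu.toAdm hv.toAdm).pow_const 2).const_mul 3) hN hB
    (y := fun t => ‖u t - v t‖ₑ) hwB (fun t ht => hu.enorm_sub_le_integral ha hb hv ht) t ht

theorem exists_nat_mx (hu : Adm a b u) (hv : Adm a b v) :
    ∃ N : ℕ, ∫⁻ t in Icc a b, 3 * mx u v t ^ 2 ≤ ENNReal.ofReal (N / 2) := by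
  have hfin : ∫⁻ t in Icc a b, 3 * mx u v t ^ 2 ≠ ⊤ := by
    refine ne_top_of_le_ne_top ?_ (lintegral_mx_sq_le hu hv)
    refine ENNReal.mul_ne_top (by simp) (ENNReal.mul_ne_top
      (ENNReal.rpow_ne_top_of_nonneg (by norm_num) (by simp)) (ENNReal.rpow_ne_top_of_nonneg
      (by norm_num) (ENNReal.add_ne_top.2 ⟨ENNReal.pow_ne_top hu.l4, ENNReal.pow_ne_top hv.l4⟩)))
  exact exists_nat_half_ge hfin

/-- Uniqueness. -/
theorem Sol.eq (ha : a ≤ 0) (hb : 0 ≤ b) (hu : Sol a b u₀ u) (hv : Sol a b u₀ v) {t : ℝ}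
    (ht : t ∈ Icc a b) : u t = v t := by
  obtain ⟨N, hN⟩ := exists_nat_mx hu.toAdm hv.toAdm
  have h := hu.enorm_sub_le ha hb hv hN ht
  rw [sub_self, enorm_zero, mul_zero, nonpos_iff_eq_zero, enorm_eq_zero] at h
  exact sub_eq_zero.1 h

end Sol

end

/-! ### Picard iteration and Lipschitz dependence -/

section

variable {d : ℕ} {s a b : ℝ} {u v : ℝ → L2 d} {u₀ v₀ : L2 d} {ρ : ℝ≥0∞}

/-- The map whose fixed points are the solutions. -/
def picard (u₀ : L2 d) (u : ℝ → L2 d) (t : ℝ) : L2 d :=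
  U t u₀ - Complex.I • duh (fun τ => cubic (u τ)) t

theorem zN_zero : zN s (Icc a b) (fun _ => (0 : L2 d)) = 0 := by
  have h := zN_U_le (s := s) (I := Icc a b) (0 : L2 d)
  have h0 : ∀ t, U t (0 : L2 d) = 0 := fun t => by
    rw [← UL_apply, map_zero]
  simp only [h0] at h
  have h1 : hsNorm s (0 : L2 d) = 0 := by
    rw [hsNorm_eq_ell]
    have h2 : ∀ k, mode k (0 : L2 d) = 0 := fun k => by rw [← modeL_apply, map_zero]
    simp only [h2, enorm_zero]
    have := ell_const_mul s 0 (fun _ : Fin d → ℤ => 0)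
    simpa using this
  rw [h1, mul_zero] at h
  exact le_antisymm h zero_le

theorem zN_sub_I_smul_le {w z : ℝ → L2 d} (hw : ContinuousOn w (Icc a b))
    (hz : ContinuousOn z (Icc a b)) :
    zN s (Icc a b) (fun t => w t - Complex.I • z t) ≤ zN s (Icc a b) w + zN s (Icc a b) z := by
  refine (zN_sub_le (hw.aestronglyMeasurable measurableSet_Icc)
    ((hz.const_smul Complex.I).aestronglyMeasurable measurableSet_Icc)).trans ?_
  exact add_le_add le_rfl (zN_smul Complex.norm_I z).le

theorem continuousOn_duh_cubic (ha : a ≤ 0) (hb : 0 ≤ b) (hu : Adm a b u) :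
    ContinuousOn (duh fun τ => cubic (u τ)) (Icc a b) :=
  continuousOn_duh ha hb (hu.integrableOn_cubic (ha.trans hb))

theorem continuousOn_picard (ha : a ≤ 0) (hb : 0 ≤ b) (hu : Adm a b u) :
    ContinuousOn (picard u₀ u) (Icc a b) :=
  (continuous_U u₀).continuousOn.sub ((continuousOn_duh_cubic ha hb hu).const_smul Complex.I)

/-- The smallness condition on the time interval. -/
def Small (d : ℕ) (s a b : ℝ) (ρ : ℝ≥0∞) : Prop :=
  15 * triC d s * volume (Icc a b) ^ (1 / 2 : ℝ) * ρ ^ 2 ≤ 2⁻¹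

theorem zN_duh_cubic_sub_le_half (hd : 1 ≤ d) (hs : (d : ℝ) / 2 < s) (ha : a ≤ 0) (hb : 0 ≤ b)
    (hρ : ρ ≠ ⊤) (hS : Small d s a b ρ)
    (hu : ContinuousOn u (Icc a b)) (hv : ContinuousOn v (Icc a b))
    (hzu : zN s (Icc a b) u ≤ ρ) (hzv : zN s (Icc a b) v ≤ ρ) :
    zN s (Icc a b) (fun t => duh (fun τ => cubic (u τ)) t - duh (fun τ => cubic (v τ)) t) ≤
      2⁻¹ * zN s (Icc a b) (fun t => u t - v t) :=
  (zN_duh_cubic_sub_le hd hs ha hb hu hv hρ hzu hzv).trans (mul_le_mul_left hS _)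

/-- The radius is at least ten times the data, so the linear part (constant 5) takes half of the
ball; smallness of the interval, applied with v = 0, keeps the Duhamel part in the other half. -/
theorem zN_picard_le (hd : 1 ≤ d) (hs : (d : ℝ) / 2 < s) (ha : a ≤ 0) (hb : 0 ≤ b)
    (hρ : ρ ≠ ⊤) (hS : Small d s a b ρ)
    (h₀ : 10 * hsNorm s u₀ ≤ ρ) (hu : ContinuousOn u (Icc a b))
    (hzu : zN s (Icc a b) u ≤ ρ) : zN s (Icc a b) (picard u₀ u) ≤ ρ := by
  have hA := adm_of_zN hd hs hu (ne_top_of_le_ne_top hρ hzu)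
  have h1 := zN_duh_cubic_sub_le_half hd hs ha hb hρ hS (v := fun _ => 0) hu continuousOn_const hzu
    (by rw [zN_zero]; exact zero_le)
  have h2 : ∀ t, duh (fun _ => cubic (0 : L2 d)) t = 0 := fun t => by
    simp only [duh, cubic_zero, ← UL_apply, map_zero, intervalIntegral.integral_zero]
  simp only [h2, sub_zero] at h1
  calc zN s (Icc a b) (picard u₀ u) ≤ 5 * hsNorm s u₀ + 2⁻¹ * zN s (Icc a b) u :=
        (zN_sub_I_smul_le (continuous_U u₀).continuousOn
          (continuousOn_duh_cubic ha hb hA)).trans (add_le_add (zN_U_le u₀) h1)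
    _ ≤ 2⁻¹ * ρ + 2⁻¹ * ρ := by
        refine add_le_add ?_ (mul_le_mul_right hzu _)
        refine le_trans (le_of_eq ?_) (mul_le_mul_right h₀ 2⁻¹)
        rw [← mul_assoc]
        congr 1
        rw [show (10 : ℝ≥0∞) = 2 * 5 by norm_num, ← mul_assoc, ENNReal.inv_mul_cancel (by simp)
          (by simp), one_mul]
    _ = ρ := by rw [← add_mul, ENNReal.inv_two_add_inv_two, one_mul]

theorem zN_picard_sub_le (hd : 1 ≤ d) (hs : (d : ℝ) / 2 < s) (ha : a ≤ 0) (hb : 0 ≤ b)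
    (hρ : ρ ≠ ⊤) (hS : Small d s a b ρ)
    (hu : ContinuousOn u (Icc a b)) (hv : ContinuousOn v (Icc a b))
    (hzu : zN s (Icc a b) u ≤ ρ) (hzv : zN s (Icc a b) v ≤ ρ) :
    zN s (Icc a b) (fun t => picard u₀ u t - picard v₀ v t) ≤
      5 * hsNorm s (u₀ - v₀) + 2⁻¹ * zN s (Icc a b) (fun t => u t - v t) := by
  have hu' := adm_of_zN hd hs hu (ne_top_of_le_ne_top hρ hzu)
  have hv' := adm_of_zN hd hs hv (ne_top_of_le_ne_top hρ hzv)
  have e : (fun t => picard u₀ u t - picard v₀ v t) = fun t => U t (u₀ - v₀) - Complex.I •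
      (duh (fun τ => cubic (u τ)) t - duh (fun τ => cubic (v τ)) t) := by
    funext t
    rw [picard, picard, U_sub, smul_sub]
    abel
  rw [e]
  exact (zN_sub_I_smul_le (continuous_U _).continuousOn
    ((continuousOn_duh_cubic ha hb hu').sub (continuousOn_duh_cubic ha hb hv'))).trans
    (add_le_add (zN_U_le _) (zN_duh_cubic_sub_le_half hd hs ha hb hρ hS hu hv hzu hzv))

/-- The difference of two solutions. -/
theorem Sol.zN_sub_le (hd : 1 ≤ d) (hs : (d : ℝ) / 2 < s) (ha : a ≤ 0) (hb : 0 ≤ b)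
    (hρ : ρ ≠ ⊤) (hS : Small d s a b ρ)
    (hu : Sol a b u₀ u) (hv : Sol a b v₀ v)
    (hzu : zN s (Icc a b) u ≤ ρ) (hzv : zN s (Icc a b) v ≤ ρ) :
    zN s (Icc a b) (fun t => u t - v t) ≤ 10 * hsNorm s (u₀ - v₀) := by
  have h := zN_picard_sub_le hd hs ha hb hρ hS (u₀ := u₀) (v₀ := v₀) hu.cont hv.cont hzu hzv
  rw [zN_congr (v := fun t => u t - v t) measurableSet_Icc fun t ht => by
    rw [picard, picard, ← hu.duhamel t ht, ← hv.duhamel t ht]] at h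
  set Y := zN s (Icc a b) fun t => u t - v t with hY
  -- Finiteness permits Y/2 to be absorbed, which doubles the constant 5.
  have hYt : Y ≠ ⊤ := ne_top_of_le_ne_top (ENNReal.add_ne_top.2 ⟨hρ, hρ⟩)
    ((ProductNLS.zN_sub_le hu.meas hv.meas).trans (add_le_add hzu hzv))
  have h2 : 2⁻¹ * Y + 2⁻¹ * Y = Y := by
    rw [← add_mul, ENNReal.inv_two_add_inv_two, one_mul]
  have h3 : 2⁻¹ * Y ≤ 5 * hsNorm s (u₀ - v₀) := by
    refine (ENNReal.add_le_add_iff_right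
      (ENNReal.mul_ne_top (by simp) hYt : 2⁻¹ * Y ≠ ⊤)).1 ?_
    rw [h2]; exact h
  calc Y = 2 * (2⁻¹ * Y) := by
        rw [← mul_assoc, ENNReal.mul_inv_cancel (by simp) (by simp), one_mul]
    _ ≤ 2 * (5 * hsNorm s (u₀ - v₀)) := mul_le_mul_right h3 _
    _ = _ := by ring

/-- Existence of solutions by Picard iteration. -/
theorem exists_sol (hd : 1 ≤ d) (hs : (d : ℝ) / 2 < s) (ha : a ≤ 0) (hb : 0 ≤ b)
    (hρ : ρ ≠ ⊤) (hS : Small d s a b ρ)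
    (h₀ : 10 * hsNorm s u₀ ≤ ρ) :
    ∃ u : ℝ → L2 d, Sol a b u₀ u ∧ zN s (Icc a b) u ≤ ρ := by
  have hs0 := nonneg_of_half_lt hs
  let p : ℕ → ℝ → L2 d := fun n => (picard u₀)^[n] fun t => U t u₀
  have hp : ∀ n, p (n + 1) = picard u₀ (p n) := fun n => Function.iterate_succ_apply' _ _ _
  have hpz : ∀ n, ContinuousOn (p n) (Icc a b) ∧ zN s (Icc a b) (p n) ≤ ρ := by
    intro n
    induction n with
    | zero =>
      refine ⟨(continuous_U u₀).continuousOn, (zN_U_le u₀).trans (le_trans ?_ h₀)⟩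
      gcongr
      norm_num
    | succ n ih =>
      rw [hp]
      exact ⟨continuousOn_picard ha hb (adm_of_zN hd hs ih.1 (ne_top_of_le_ne_top hρ ih.2)),
        zN_picard_le hd hs ha hb hρ hS h₀ ih.1 ih.2⟩
  have hA : ∀ n, Adm a b (p n) := fun n =>
    adm_of_zN hd hs (hpz n).1 (ne_top_of_le_ne_top hρ (hpz n).2)
  -- The geometric decay holds in the strong norm but is used only through the L² distance at each
  -- time. Completeness of L² then replaces completeness of the solution space, and lower
  -- semicontinuity returns the strong bound for the limit.
  have hdiff : ∀ n, zN s (Icc a b) (fun t => p (n + 1) t - p n t) ≤ (ρ + ρ) / 2 ^ n := by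
    intro n
    induction n with
    | zero =>
      simp only [pow_zero, div_one]
      exact (ProductNLS.zN_sub_le (hA _).meas (hA _).meas).trans (add_le_add (hpz _).2 (hpz _).2)
    | succ n ih =>
      have h1 := zN_picard_sub_le hd hs ha hb hρ hS (u₀ := u₀) (v₀ := u₀) (hpz (n + 1)).1 (hpz n).1
        (hpz (n + 1)).2 (hpz n).2
      have h00 : hsNorm s (u₀ - u₀) = 0 := by
        have := hsNorm_le_zN (s := s) (I := Icc a b) (u := fun _ => (0 : L2 d)) ⟨ha, hb⟩
        rw [zN_zero] at this
        rw [sub_self]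
        exact le_antisymm this zero_le
      rw [h00, mul_zero, zero_add, ← hp, ← hp] at h1
      refine h1.trans ((mul_le_mul_right ih _).trans (le_of_eq ?_))
      rw [div_eq_mul_inv, div_eq_mul_inv, pow_succ, ENNReal.mul_inv (by simp) (by simp)]
      ring
  have hed : ∀ t ∈ Icc a b, ∀ n, edist (p n t) (p (n + 1) t) ≤ (ρ + ρ) / 2 ^ n := fun t ht n => by
    rw [edist_comm, edist_eq_enorm_sub]
    exact (enorm_le_hsNorm hs0 _).trans ((hsNorm_le_zN (u := fun t => p (n + 1) t - p n t) ht).trans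
      (hdiff n))
  have hρρ : ρ + ρ ≠ ⊤ := ENNReal.add_ne_top.2 ⟨hρ, hρ⟩
  have hlim : ∀ t, ∃ x, t ∈ Icc a b → Tendsto (fun n => p n t) atTop (𝓝 x) := fun t => by
    by_cases ht : t ∈ Icc a b
    · obtain ⟨x, hx⟩ := cauchySeq_tendsto_of_complete
        (cauchySeq_of_edist_le_geometric_two _ hρρ (hed t ht))
      exact ⟨x, fun _ => hx⟩
    · exact ⟨0, fun h => absurd h ht⟩
  choose u hu using hlim
  have hrate : ∀ t ∈ Icc a b, ∀ n, edist (p n t) (u t) ≤ 2 * (ρ + ρ) / 2 ^ n := fun t ht n =>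
    edist_le_of_edist_le_geometric_two_of_tendsto _ (hed t ht) (hu t ht) n
  have hzero : ∀ C : ℝ≥0∞, C ≠ ⊤ → Tendsto (fun n : ℕ => C / 2 ^ n) atTop (𝓝 0) := fun C hC => by
    have h1 : Tendsto (fun n : ℕ => C * (2⁻¹ : ℝ≥0∞) ^ n) atTop (𝓝 (C * 0)) :=
      ENNReal.Tendsto.const_mul (ENNReal.tendsto_pow_atTop_nhds_zero_of_lt_one
        (by simp)) (Or.inr hC)
    rw [mul_zero] at h1
    refine h1.congr fun n => ?_
    rw [div_eq_mul_inv, ENNReal.inv_pow]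
  have huc : ContinuousOn u (Icc a b) := by
    have : TendstoUniformlyOn p u atTop (Icc a b) := by
      rw [EMetric.tendstoUniformlyOn_iff]
      intro ε hε
      filter_upwards [(tendsto_order.1 (hzero (2 * (ρ + ρ)) (ENNReal.mul_ne_top (by simp) hρρ))).2 ε hε]
        with n hn t ht
      rw [edist_comm]
      exact (hrate t ht n).trans_lt hn
    exact this.continuousOn (.of_forall fun n => (hpz n).1)
  have huz : zN s (Icc a b) u ≤ ρ :=
    zN_le_of_tendsto measurableSet_Icc (fun n => (hA n).meas) (fun t ht => hu t ht)
      (.of_forall fun n => (hpz n).2)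
  have huA := adm_of_zN hd hs huc (ne_top_of_le_ne_top hρ huz)
  refine ⟨u, ⟨huA, fun t ht => ?_⟩, huz⟩
  -- A bound uniform in n on the integrated Lipschitz coefficient lets the Duhamel map pass to the
  -- limit in L², so the limit is a fixed point.
  obtain ⟨K, hK, hKn⟩ : ∃ K : ℝ≥0∞, K ≠ ⊤ ∧ ∀ n, ∫⁻ t in Icc a b, 3 * mx (p n) u t ^ 2 ≤ K := by
    refine ⟨3 * (volume (Icc a b) ^ (1 / 2 : ℝ) * ((embC d s * ρ) ^ 4 + (embC d s * ρ) ^ 4) ^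
      (1 / 2 : ℝ)), ?_, fun n => (lintegral_mx_sq_le (hA n) huA).trans ?_⟩
    · have h1 : (embC d s * ρ) ^ 4 ≠ ⊤ := ENNReal.pow_ne_top (ENNReal.mul_ne_top (embC_ne_top hd hs) hρ)
      exact ENNReal.mul_ne_top (by simp) (ENNReal.mul_ne_top
        (ENNReal.rpow_ne_top_of_nonneg (by norm_num) (by simp)) (ENNReal.rpow_ne_top_of_nonneg
        (by norm_num) (ENNReal.add_ne_top.2 ⟨h1, h1⟩)))
    · gcongr
      · exact (l4LinftyNorm_le_zN (hA n).meas).trans (mul_le_mul_right (hpz n).2 _)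
      · exact (l4LinftyNorm_le_zN huA.meas).trans (mul_le_mul_right huz _)
  have hstep : ∀ n, edist (p (n + 1) t) (picard u₀ u t) ≤ K * (2 * (ρ + ρ)) / 2 ^ n := fun n => by
    have e : p (n + 1) t - picard u₀ u t =
        -(Complex.I • duh (fun τ => cubic (p n τ) - cubic (u τ)) t) := by
      rw [hp, picard, picard, ← duh_sub ((hA n).intervalIntegrable_cubic ha hb ht)
        (huA.intervalIntegrable_cubic ha hb ht), smul_sub]
      abel
    rw [edist_eq_enorm_sub, e, enorm_neg, enorm_smul, ← ofReal_norm Complex.I, Complex.norm_I,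
      ENNReal.ofReal_one, one_mul]
    have h1 : ∀ᵐ τ ∂volume.restrict (Icc a b), ‖cubic (p n τ) - cubic (u τ)‖ₑ ≤
        3 * mx (p n) u τ ^ 2 * (2 * (ρ + ρ) / 2 ^ n) := by
      filter_upwards [(hA n).ae, huA.ae, ae_restrict_mem measurableSet_Icc] with τ h1 h2 h3
      refine (enorm_cubic_sub_le (mx_ne_top h1 h2) (le_max_left _ _) (le_max_right _ _)).trans ?_
      refine mul_le_mul_right ?_ _
      rw [← edist_eq_enorm_sub]; exact hrate τ h3 n
    calc _ ≤ ∫⁻ τ in uIoc 0 t, ‖cubic (p n τ) - cubic (u τ)‖ₑ := enorm_duh_le t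
      _ ≤ ∫⁻ τ in Icc a b, ‖cubic (p n τ) - cubic (u τ)‖ₑ :=
          lintegral_mono_set (uIoc_zero_subset ha hb ht)
      _ ≤ ∫⁻ τ in Icc a b, 3 * mx (p n) u τ ^ 2 * (2 * (ρ + ρ) / 2 ^ n) := lintegral_mono_ae h1
      _ = (∫⁻ τ in Icc a b, 3 * mx (p n) u τ ^ 2) * (2 * (ρ + ρ) / 2 ^ n) :=
          lintegral_mul_const'' _ (((aemeasurable_mx (hA n) huA).pow_const 2).const_mul 3)
      _ ≤ K * (2 * (ρ + ρ) / 2 ^ n) := mul_le_mul_left (hKn n) _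
      _ = _ := by simp only [div_eq_mul_inv, mul_assoc]
  have hT : Tendsto (fun n => p (n + 1) t) atTop (𝓝 (picard u₀ u t)) :=
    tendsto_iff_edist_tendsto_0.2 (tendsto_of_tendsto_of_tendsto_of_le_of_le tendsto_const_nhds
      (hzero _ (ENNReal.mul_ne_top hK (ENNReal.mul_ne_top (by simp) hρρ))) (fun _ => zero_le) hstep)
  exact tendsto_nhds_unique ((tendsto_add_atTop_iff_nat 1).2 (hu t ht)) hT

/-- Dominated convergence over the frequencies. -/
theorem tendsto_ell_zero {ι : Type*} {l : Filter ι} [l.IsCountablyGenerated]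
    {α : ι → (Fin d → ℤ) → ℝ≥0∞} {β : (Fin d → ℤ) → ℝ≥0∞} (hβ : ell s β ≠ ⊤)
    (h : ∀ᶠ i in l, ∀ k, α i k ≤ β k) (hlim : ∀ k, Tendsto (fun i => α i k) l (𝓝 0)) :
    Tendsto (fun i => ell s (α i)) l (𝓝 0) := by
  have h1 : Tendsto (fun i => ∑' k, wt s k * α i k ^ 2) l (𝓝 0) := by
    let _ : MeasurableSpace (Fin d → ℤ) := ⊤
    have : MeasurableSingletonClass (Fin d → ℤ) := ⟨fun _ => trivial⟩
    have h2 := tendsto_lintegral_filter_of_dominated_convergence (μ := Measure.count) (l := l)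
      (F := fun i k => wt s k * α i k ^ 2) (f := fun _ => 0) (fun k => wt s k * β k ^ 2)
      (.of_forall fun i => measurable_from_top) ?_ ?_ ?_
    · simpa only [lintegral_count, lintegral_zero, tsum_zero] using h2
    · filter_upwards [h] with i hi
      exact .of_forall fun k => by gcongr; exact hi k
    · rw [lintegral_count, ← ell_sq]
      exact ENNReal.pow_ne_top hβ
    · refine .of_forall fun k => ?_
      have := ENNReal.Tendsto.const_mul (ENNReal.Tendsto.pow (n := 2) (hlim k))
        (Or.inr (wt_ne_top s k))
      simpa using this
  have h3 := (ENNReal.continuous_rpow_const (y := (1 / 2 : ℝ))).tendsto 0 |>.comp h1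
  rw [ENNReal.zero_rpow_of_pos (by norm_num)] at h3
  refine h3.congr fun i => ?_
  rfl

/-- Continuity in H^s comes for free because the supremum in time is taken inside the sum over k:
twice these suprema dominate the modes of u(τ) − u(t), each of which tends to 0. -/
theorem isSolution_of_zN (hu : Sol a b u₀ u) (hz : zN s (Icc a b) u ≠ ⊤) :
    IsSolution s a b u₀ u where
  hs_finite t ht := lt_of_le_of_lt (hsNorm_le_zN ht) hz.lt_top
  l4Linfty_finite := hu.l4.lt_top
  duhamel := hu.duhamel
  hs_continuous t ht := by
    simp only [hsNorm_eq_ell]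
    refine tendsto_ell_zero (β := fun k => 2 * supN (Icc a b) u k) ?_ ?_ fun k => ?_
    · rw [ell_const_mul]
      exact ENNReal.mul_ne_top (by simp) (ne_top_of_le_ne_top hz (ell_mono fun k => le_self_add))
    · filter_upwards [self_mem_nhdsWithin] with τ hτ k
      rw [mode_sub, two_mul]
      exact enorm_sub_le.trans (add_le_add
        (le_iSup₂ (f := fun t _ => ‖mode k (u t)‖ₑ) τ hτ)
        (le_iSup₂ (f := fun t _ => ‖mode k (u t)‖ₑ) t ht))
    · have h1 : ContinuousWithinAt (fun τ => ‖modeL k (u τ - u t)‖ₑ) (Icc a b) t :=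
        ((modeL k).continuous.comp_continuousOn
          (hu.cont.sub continuousOn_const)).enorm t ht
      have h2 : Tendsto (fun τ => ‖modeL k (u τ - u t)‖ₑ) (𝓝[Icc a b] t)
        (𝓝 ‖modeL k (u t - u t)‖ₑ) := h1
      simpa only [sub_self, map_zero, enorm_zero, modeL_apply] using h2

/-- The interval length enters with the positive power 1/2, so the condition holds for all small T,
with T depending only on d, s and ρ. -/
theorem exists_small (hd : 1 ≤ d) (hs : (d : ℝ) / 2 < s) (hρ : ρ ≠ ⊤) :
    ∃ T : ℝ, 0 < T ∧ T ≤ 1 ∧ Small d s (-T) T ρ := by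
  have hK : 15 * triC d s * ρ ^ 2 ≠ ⊤ := ENNReal.mul_ne_top
    (ENNReal.mul_ne_top (by simp) (triC_ne_top hd hs)) (ENNReal.pow_ne_top hρ)
  have h1 : Tendsto (fun T : ℝ => 15 * triC d s * ρ ^ 2 *
      ENNReal.ofReal (T - -T) ^ (1 / 2 : ℝ)) (𝓝 0) (𝓝 0) := by
    have h2 : Tendsto (fun T : ℝ => ENNReal.ofReal (T - -T) ^ (1 / 2 : ℝ)) (𝓝 0)
        (𝓝 (ENNReal.ofReal (0 - -0) ^ (1 / 2 : ℝ))) :=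
      ((ENNReal.continuous_rpow_const (y := (1 / 2 : ℝ))).comp
        (ENNReal.continuous_ofReal.comp (by fun_prop : Continuous fun T : ℝ => T - -T))).tendsto 0
    have h3 : (ENNReal.ofReal ((0 : ℝ) - -0) ^ (1 / 2 : ℝ)) = 0 := by
      simp
    rw [h3] at h2
    have := ENNReal.Tendsto.const_mul h2 (Or.inr hK)
    rwa [mul_zero] at this
  have h2 : ∀ᶠ T in 𝓝[>] (0 : ℝ), 15 * triC d s * ρ ^ 2 *
      ENNReal.ofReal (T - -T) ^ (1 / 2 : ℝ) < 2⁻¹ :=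
    (h1.mono_left nhdsWithin_le_nhds).eventually (gt_mem_nhds (by simp))
  have h3 : ∀ᶠ T in 𝓝[>] (0 : ℝ), T ∈ Ioc (0 : ℝ) 1 := Ioc_mem_nhdsGT zero_lt_one
  obtain ⟨T, hT1, hT2⟩ := (h2.and h3).exists
  refine ⟨T, hT2.1, hT2.2, ?_⟩
  rw [Small, Real.volume_Icc]
  refine le_trans (le_of_eq ?_) hT1.le
  ring

end

/-! ### Galilei transformations and invariance of the equation -/

section

section WeightedComposition

variable {α : Type*} [MeasurableSpace α] {μ : Measure α}

theorem memLp_wcomp {m : α → ℂ} {φ : α → α} (hm : AEStronglyMeasurable m μ) (h1 : ∀ x, ‖m x‖ = 1)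
    (hφ : MeasurePreserving φ μ μ) (f : Lp ℂ 2 μ) : MemLp (fun x => m x * f (φ x)) 2 μ := by
  have h2 : MemLp (fun x => f (φ x)) 2 μ := (Lp.memLp f).comp_measurePreserving hφ
  refine h2.of_le (hm.mul h2.1) (.of_forall fun x => ?_)
  rw [norm_mul, h1, one_mul]

theorem eLpNorm_wcomp {m : α → ℂ} {φ : α → α} (h1 : ∀ x, ‖m x‖ = 1)
    (hφ : MeasurePreserving φ μ μ) (f : Lp ℂ 2 μ) (p : ℝ≥0∞) :
    eLpNorm (fun x => m x * f (φ x)) p μ = eLpNorm f p μ := by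
  rw [← eLpNorm_comp_measurePreserving (Lp.aestronglyMeasurable f) hφ]
  refine eLpNorm_congr_norm_ae (.of_forall fun x => ?_)
  rw [norm_mul, h1, one_mul, Function.comp_apply]

/-- The isometry `f ↦ m · (f ∘ φ)` of `L²`, for unimodular `m` and measure preserving `φ`. -/
def wcomp (m : α → ℂ) (φ : α → α) (hm : AEStronglyMeasurable m μ) (h1 : ∀ x, ‖m x‖ = 1)
    (hφ : MeasurePreserving φ μ μ) : Lp ℂ 2 μ →ₗᵢ[ℂ] Lp ℂ 2 μ where
  toFun f := (memLp_wcomp hm h1 hφ f).toLp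
  map_add' f g := by
    refine Lp.ext ?_
    filter_upwards [(memLp_wcomp hm h1 hφ (f + g)).coeFn_toLp, (memLp_wcomp hm h1 hφ f).coeFn_toLp,
      (memLp_wcomp hm h1 hφ g).coeFn_toLp, hφ.quasiMeasurePreserving.ae (Lp.coeFn_add f g),
      Lp.coeFn_add (memLp_wcomp hm h1 hφ f).toLp (memLp_wcomp hm h1 hφ g).toLp]
      with x e1 e2 e3 e4 e5
    rw [e1, e5, Pi.add_apply, e2, e3, e4, Pi.add_apply, mul_add]
  map_smul' c f := by
    refine Lp.ext ?_
    filter_upwards [(memLp_wcomp hm h1 hφ (c • f)).coeFn_toLp, (memLp_wcomp hm h1 hφ f).coeFn_toLp,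
      hφ.quasiMeasurePreserving.ae (Lp.coeFn_smul c f),
      Lp.coeFn_smul c (memLp_wcomp hm h1 hφ f).toLp]
      with x e1 e2 e4 e5
    rw [e1, RingHom.id_apply, e5, Pi.smul_apply, e2, e4, Pi.smul_apply, smul_eq_mul, smul_eq_mul,
      mul_left_comm]
  norm_map' f := by
    change ‖(memLp_wcomp hm h1 hφ f).toLp‖ = _
    rw [Lp.norm_toLp, eLpNorm_wcomp h1 hφ, Lp.norm_def]

theorem wcomp_ae {m : α → ℂ} {φ : α → α} (hm : AEStronglyMeasurable m μ) (h1 : ∀ x, ‖m x‖ = 1)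
    (hφ : MeasurePreserving φ μ μ) (f : Lp ℂ 2 μ) :
    wcomp m φ hm h1 hφ f =ᵐ[μ] fun x => m x * f (φ x) :=
  (memLp_wcomp hm h1 hφ f).coeFn_toLp

end WeightedComposition

section Galilei

/-- The phase `e^{i(hx - h²t/2)}` of a Galilei transformation. -/
def galPhase (h t x : ℝ) : ℂ := Complex.exp (Complex.I * (h * x - h ^ 2 * t / 2 : ℝ))

theorem norm_galPhase (h t x : ℝ) : ‖galPhase h t x‖ = 1 := by
  rw [galPhase, mul_comm, Complex.norm_exp_ofReal_mul_I]

theorem continuous_galPhase (h t : ℝ) : Continuous (galPhase h t) := by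
  unfold galPhase; fun_prop

/-- The Galilei transformation on `L²(ℝ)`. -/
def galX (h t : ℝ) : LX →ₗᵢ[ℂ] LX :=
  wcomp (galPhase h t) (fun x => x - h * t) (continuous_galPhase h t).aestronglyMeasurable
    (norm_galPhase h t) (measurePreserving_sub_right volume (h * t))

theorem galX_ae (h t : ℝ) (f : LX) :
    galX h t f =ᵐ[volume] fun x => galPhase h t x * f (x - h * t) := wcomp_ae _ _ _ _

/-- The Fourier side of a Galilei transformation. -/
def galF (h t ξ : ℝ) : ℂ := Complex.exp (Complex.I * (t * (h ^ 2 / 2 - 2 * Real.pi * h * ξ) : ℝ))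

theorem norm_galF (h t ξ : ℝ) : ‖galF h t ξ‖ = 1 := by
  rw [galF, mul_comm, Complex.norm_exp_ofReal_mul_I]

theorem continuous_galF (h t : ℝ) : Continuous (galF h t) := by
  unfold galF; fun_prop

/-- The Galilei transformation on the Fourier side. -/
def galFX (h t : ℝ) : LX →ₗᵢ[ℂ] LX :=
  wcomp (galF h t) (fun ξ => ξ - h / (2 * Real.pi)) (continuous_galF h t).aestronglyMeasurable
    (norm_galF h t) (measurePreserving_sub_right volume _)

theorem galFX_ae (h t : ℝ) (f : LX) :
    galFX h t f =ᵐ[volume] fun ξ => galF h t ξ * f (ξ - h / (2 * Real.pi)) := wcomp_ae _ _ _ _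

/-- Modulation by e^{ihx} shifts ξ by h/(2π), in the normalisation with 2π in the exponent, and
translation by ht becomes a phase. -/
theorem fourier_galPhase_mul (h t : ℝ) (f : ℝ → ℂ) (ξ : ℝ) :
    𝓕 (fun x => galPhase h t x * f (x - h * t)) ξ =
      galF h t ξ * 𝓕 f (ξ - h / (2 * Real.pi)) := by
  rw [Real.fourier_real_eq_integral_exp_smul, Real.fourier_real_eq_integral_exp_smul,
    ← integral_const_mul, ← integral_sub_right_eq_self (fun v => galF h t ξ *
      (Complex.exp (((-2 * Real.pi * v * (ξ - h / (2 * Real.pi)) : ℝ) : ℂ) * Complex.I) • f v))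
      (h * t)]
  refine integral_congr_ae (.of_forall fun x => ?_)
  simp only [smul_eq_mul, galPhase, galF]
  rw [← mul_assoc, ← mul_assoc, ← Complex.exp_add, ← Complex.exp_add]
  congr 2
  have hpi : (Real.pi : ℂ) ≠ 0 := by exact_mod_cast Real.pi_ne_zero
  push_cast
  field_simp
  ring

theorem fourier_galX_of_integrable (h t : ℝ) {f : LX} (hf : Integrable f) :
    (𝓕 (galX h t f) : LX) = galFX h t (𝓕 f : LX) := by
  have hi : Integrable (galX h t f) := by
    refine Integrable.congr ?_ (galX_ae h t f).symm
    refine (hf.comp_sub_right (h * t)).bdd_mul (c := 1)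
      (continuous_galPhase h t).aestronglyMeasurable ?_
    exact .of_forall fun x => (norm_galPhase h t x).le
  have hq := (measurePreserving_sub_right (volume : Measure ℝ)
    (h / (2 * Real.pi))).quasiMeasurePreserving.ae (fourier_ae_eq_of_integrable f hf)
  refine Lp.ext ?_
  filter_upwards [fourier_ae_eq_of_integrable _ hi, galFX_ae h t (𝓕 f : LX), hq] with ξ e1 e2 e3
  rw [e1, e2, e3, ← fourier_galPhase_mul, Real.fourier_real_eq, Real.fourier_real_eq]
  refine integral_congr_ae ?_
  filter_upwards [galX_ae h t f] with x hx
  rw [hx]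

/-- Both sides are isometric in f and agree on Schwartz functions, which are integrable and dense.
-/
theorem fourier_galX (h t : ℝ) (f : LX) : (𝓕 (galX h t f) : LX) = galFX h t (𝓕 f : LX) := by
  have hc1 : Continuous fun f : LX => (𝓕 (galX h t f) : LX) :=
    (Lp.fourierTransformₗᵢ ℝ ℂ).continuous.comp (galX h t).continuous
  have hc2 : Continuous fun f : LX => galFX h t (𝓕 f : LX) :=
    (galFX h t).continuous.comp (Lp.fourierTransformₗᵢ ℝ ℂ).continuous
  have hd : DenseRange (SchwartzMap.toLpCLM ℝ ℂ 2 (volume : Measure ℝ)) :=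
    SchwartzMap.denseRange_toLpCLM ENNReal.ofNat_ne_top
  refine congr_fun (hd.equalizer hc1 hc2 (funext fun g => ?_)) f
  refine fourier_galX_of_integrable h t ?_
  exact g.integrable.congr (SchwartzMap.coeFn_toLp g 2 volume).symm

theorem symbolX_mul_galF (h σ τ ξ : ℝ) :
    symbolX σ ξ * galF h τ ξ = galF h (τ + σ) ξ * symbolX σ (ξ - h / (2 * Real.pi)) := by
  have hpi : (Real.pi : ℂ) ≠ 0 := by exact_mod_cast Real.pi_ne_zero
  unfold symbolX galF
  rw [← Complex.exp_add, ← Complex.exp_add]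
  congr 1
  push_cast
  field_simp
  ring

/-- On the Fourier side this is completing the square: −σ(2πξ)²/2 equals −σ(2πξ − h)²/2 + σ(h²/2 −
2πhξ). The last term advances the time parameter of the transformation from τ to τ + σ. -/
theorem evolX_galX (h σ τ : ℝ) (f : LX) :
    evolX σ (galX h τ f) = galX h (τ + σ) (evolX σ f) := by
  refine fourier_LX_injective ?_
  rw [fourier_galX]
  have hq := (measurePreserving_sub_right (volume : Measure ℝ)
    (h / (2 * Real.pi))).quasiMeasurePreserving.ae (fourier_evolX_ae σ f)
  have e0 := fourier_evolX_ae σ (galX h τ f)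
  rw [fourier_galX] at e0
  refine Lp.ext ?_
  filter_upwards [e0, galFX_ae h τ (𝓕 f : LX),
    galFX_ae h (τ + σ) (𝓕 (evolX σ f) : LX), hq] with ξ e1 e3 e4 e5
  rw [e1, e3, e4, e5, ← mul_assoc, symbolX_mul_galF, mul_assoc]

variable {d : ℕ}

theorem measurePreserving_shift (a : ℝ) :
    MeasurePreserving (fun z : Space d => (z.1 - a, z.2)) volume volume :=
  (measurePreserving_sub_right (volume : Measure ℝ) a).prod
    (MeasurePreserving.id (volume : Measure (Torus d)))

/-- The Galilei transformation `f ↦ e^{i(hx - h²t/2)} f(x - ht, y)` on `L²(ℝ × 𝕋^d)`. -/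
def gal (h t : ℝ) : L2 d →ₗᵢ[ℂ] L2 d :=
  wcomp (fun z => galPhase h t z.1) (fun z => (z.1 - h * t, z.2))
    ((continuous_galPhase h t).comp continuous_fst).aestronglyMeasurable
    (fun z => norm_galPhase h t z.1) (measurePreserving_shift (h * t))

theorem gal_ae (h t : ℝ) (f : L2 d) :
    gal h t f =ᵐ[volume] fun z => galPhase h t z.1 * f (z.1 - h * t, z.2) := wcomp_ae _ _ _ _

theorem eLpNorm_gal (h t : ℝ) (f : L2 d) (p : ℝ≥0∞) :
    eLpNorm (gal h t f) p volume = eLpNorm f p volume := by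
  rw [eLpNorm_congr_ae (gal_ae h t f)]
  exact eLpNorm_wcomp (m := fun z : Space d => galPhase h t z.1) (fun z => norm_galPhase h t z.1)
    (measurePreserving_shift (h * t)) f p

theorem mode_gal (h t : ℝ) (f : L2 d) (k : Fin d → ℤ) :
    mode k (gal h t f) = galX h t (mode k f) := by
  have hq := (measurePreserving_sub_right (volume : Measure ℝ)
    (h * t)).quasiMeasurePreserving.ae (mode_ae k f)
  refine Lp.ext ?_
  filter_upwards [mode_ae_of_ae (gal_ae h t f) k, galX_ae h t (mode k f), hq] with x e1 e2 e3
  rw [e1, e2, e3, modeFun, modeFun]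
  simp only [mul_assoc]
  rw [integral_const_mul, mul_left_comm]

theorem U_gal (h σ τ : ℝ) (f : L2 d) : U σ (gal h τ f) = gal h (τ + σ) (U σ f) := by
  refine ext_mode fun k => ?_
  rw [mode_U, mode_gal, mode_gal, mode_U, evolX_galX, map_smul]

theorem gal_eq (h t : ℝ) (f : L2 d) : gal h t f = U t (gal h 0 (U (-t) f)) := by
  rw [U_gal, zero_add, U_U, add_neg_cancel, U_zero]

/-- Gauge and translation invariance: two of the three unimodular phases cancel. Finiteness of the
sup norm excludes the default value of `cubic`. -/
theorem cubic_gal (h t : ℝ) {f : L2 d} (hf : eLpNorm f ⊤ volume ≠ ⊤) :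
    cubic (gal h t f) = gal h t (cubic f) := by
  have hq := (measurePreserving_shift (d := d) (h * t)).quasiMeasurePreserving.ae (cubic_ae hf)
  refine Lp.ext ?_
  filter_upwards [cubic_ae (f := gal h t f) (by rwa [eLpNorm_gal]), gal_ae h t f,
    gal_ae h t (cubic f), hq] with z e1 e2 e3 e4
  rw [e1, e2, e3, e4, map_mul]
  have : galPhase h t z.1 * (starRingEnd ℂ) (galPhase h t z.1) = 1 := by
    rw [Complex.mul_conj, Complex.normSq_eq_norm_sq, norm_galPhase]; simp
  linear_combination (galPhase h t z.1 * f (z.1 - h * t, z.2) *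
    (starRingEnd ℂ) (f (z.1 - h * t, z.2)) * f (z.1 - h * t, z.2)) * this

theorem continuous_comp_neg_fst {E : Type*} [TopologicalSpace E] {G : ℝ × E → E}
    (hG : Continuous G) : Continuous fun p : ℝ × E => G (-p.1, p.2) :=
  hG.comp ((continuous_fst.neg).prodMk continuous_snd)

theorem continuousOn_U_neg {u : ℝ → L2 d} {S : Set ℝ} (hu : ContinuousOn u S) :
    ContinuousOn (fun t => U (-t) (u t)) S :=
  continuousOn_comp_prodMk (continuous_comp_neg_fst continuous_U_uncurry) hu

/-- The transformation at time t is the one at time 0 conjugated by the group, so its t-dependence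
is handled by joint continuity of U. -/
theorem continuousOn_gal {u : ℝ → L2 d} {S : Set ℝ} (h : ℝ) (hu : ContinuousOn u S) :
    ContinuousOn (fun t => gal h t (u t)) S := by
  have h1 : ContinuousOn (fun t => U (-t) (u t)) S := continuousOn_U_neg hu
  have h2 : ContinuousOn (fun t => gal h 0 (U (-t) (u t))) S :=
    (gal h 0).continuous.comp_continuousOn h1
  have h3 : ContinuousOn (fun t => U t (gal h 0 (U (-t) (u t)))) S :=
    continuousOn_comp_prodMk continuous_U_uncurry h2
  exact h3.congr fun t _ => gal_eq h t (u t)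

theorem l4LinftyNorm_gal (h : ℝ) (u : ℝ → L2 d) (I : Set ℝ) :
    l4LinftyNorm I (fun t => gal h t (u t)) = l4LinftyNorm I u := by
  simp only [l4LinftyNorm, eLpNorm_gal]

/-- Galilei invariance of the equation. -/
theorem Sol.gal {a b : ℝ} {u : ℝ → L2 d} {u₀ : L2 d} (ha : a ≤ 0) (hb : 0 ≤ b)
    (hu : Sol a b u₀ u) (h : ℝ) :
    Sol a b (ProductNLS.gal h 0 u₀) fun t => ProductNLS.gal h t (u t) where
  cont := continuousOn_gal h hu.cont
  l4 := by rw [l4LinftyNorm_gal]; exact hu.l4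
  duhamel t ht := by
    have h1 : duh (fun τ => cubic (ProductNLS.gal h τ (u τ))) t =
        ProductNLS.gal h t (duh (fun τ => cubic (u τ)) t) := by
      have hi := intervalIntegrable_U (hu.intervalIntegrable_cubic ha hb ht)
        (τ := fun τ => t - τ) (by fun_prop)
      have h2 := (ProductNLS.gal (d := d) h t).toContinuousLinearMap.intervalIntegral_comp_comm hi
      rw [duh, duh]
      refine Eq.trans ?_ h2
      refine intervalIntegral.integral_congr_ae ?_
      rw [← ae_restrict_iff' measurableSet_uIoc]
      filter_upwards [ae_uIoc ha hb ht hu.ae] with τ hτ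
      rw [cubic_gal h τ hτ, U_gal, add_sub_cancel]
      rfl
    rw [h1, hu.duhamel t ht, map_sub, map_smul, U_gal, zero_add]

end Galilei

end

/-! ### Weak limits and estimates for Galilei differences -/

section

section WeakLimit

variable {H : Type*} [NormedAddCommGroup H] [InnerProductSpace ℂ H]

theorem norm_le_of_weak_limit {ι : Type*} {l : Filter ι} [l.NeBot] {D : ι → H} {w : H} {C : ℝ≥0∞}
    (hD : ∀ᶠ i in l, ‖D i‖ₑ ≤ C)
    (h : ∀ g, Tendsto (fun i => (inner ℂ (D i) g : ℂ)) l (𝓝 (inner ℂ w g))) : ‖w‖ₑ ≤ C := by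
  by_cases hC : C = ⊤
  · rw [hC]; exact le_top
  lift C to ℝ≥0 using hC
  simp only [enorm_le_coe] at hD ⊢
  rw [← NNReal.coe_le_coe, coe_nnnorm]
  have h1 : ‖(inner ℂ w w : ℂ)‖ ≤ C * ‖w‖ := by
    refine le_of_tendsto (h w).norm ?_
    filter_upwards [hD] with i hi
    refine (norm_inner_le_norm _ _).trans ?_
    gcongr
    exact_mod_cast hi
  rw [inner_self_eq_norm_sq_to_K, norm_pow] at h1
  simp only [Complex.coe_algebraMap, Complex.norm_real, norm_norm] at h1
  rcases (norm_nonneg w).eq_or_lt with h0 | h0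
  · rw [← h0]; exact C.2
  · nlinarith

/-- Banach–Alaoglu combined with the Riesz representation. Working along an ultrafilter avoids
subsequences, so the same one serves for all times and all solutions. -/
theorem exists_weak_limit [CompleteSpace H] {ι : Type*} (l : Ultrafilter ι) {D : ι → H} {C : ℝ≥0∞}
    (hC : C ≠ ⊤) (hD : ∀ᶠ i in (l : Filter ι), ‖D i‖ₑ ≤ C) :
    ∃ w : H, ∀ g, Tendsto (fun i => (inner ℂ (D i) g : ℂ)) l (𝓝 (inner ℂ w g)) := by
  lift C to ℝ≥0 using hC
  have hK := WeakDual.isCompact_closedBall (0 : StrongDual ℂ H) (C : ℝ)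
  let F : ι → WeakDual ℂ H := fun i => StrongDual.toWeakDual (innerSL ℂ (D i))
  have hmem : (l.map F : Filter (WeakDual ℂ H)) ≤
      𝓟 (WeakDual.toStrongDual ⁻¹' Metric.closedBall (0 : StrongDual ℂ H) C) := by
    rw [le_principal_iff]
    change ∀ᶠ i in (l : Filter ι), F i ∈ _
    filter_upwards [hD] with i hi
    rw [enorm_le_coe] at hi
    change innerSL ℂ (D i) ∈ Metric.closedBall (0 : StrongDual ℂ H) C
    rw [mem_closedBall_zero_iff, innerSL_apply_norm]
    exact_mod_cast hi
  obtain ⟨x, -, hx⟩ := isCompact_iff_ultrafilter_le_nhds.1 hK (l.map F) hmem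
  refine ⟨(InnerProductSpace.toDual ℂ H).symm (WeakDual.toStrongDual x), fun g => ?_⟩
  rw [InnerProductSpace.toDual_symm_apply]
  have h1 : Tendsto F l (𝓝 x) := hx
  have h2 := ((WeakDual.eval_continuous g).tendsto x).comp h1
  exact h2

end WeakLimit

section Estimates

variable {d : ℕ} {a b : ℝ} {u v : ℝ → L2 d} {u₀ v₀ : L2 d}

/-- At time 0 the transformation is multiplication by e^{ihx}, and |e^{ihx} − 1| ≤ |h x|. This is
the only place where the weight on the data is used. -/
theorem enorm_gal_zero_sub_le (h : ℝ) (f : L2 d) :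
    ‖gal h 0 f - f‖ₑ ≤ ‖h‖ₑ * weightNorm f := by
  have e : ‖h‖ₑ * weightNorm f =
      eLpNorm (fun z : Space d => (h : ℂ) • ((z.1 : ℂ) * f z)) 2 volume := by
    have := eLpNorm_const_smul (h : ℂ) (fun z : Space d => (z.1 : ℂ) * f z) 2 volume
    rw [weightNorm]
    refine Eq.trans ?_ this.symm
    congr 1
    rw [← ofReal_norm, ← ofReal_norm, Complex.norm_real]
  rw [e, Lp.enorm_def]
  refine eLpNorm_mono_ae ?_
  filter_upwards [Lp.coeFn_sub (gal h 0 f) f, gal_ae h 0 f] with z e1 e2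
  rw [e1, Pi.sub_apply, e2, mul_zero, sub_zero, ← sub_one_mul, norm_mul, smul_eq_mul, ← mul_assoc,
    norm_mul _ (f z)]
  gcongr
  rw [galPhase, mul_zero, zero_div, sub_zero, ← Complex.ofReal_mul, Complex.norm_real]
  exact Real.norm_exp_I_mul_ofReal_sub_one_le

theorem mx_gal_self (h t : ℝ) :
    mx (fun t => gal h t (u t)) u t = mx u u t := by
  simp only [mx, eLpNorm_gal]

theorem mx_self_le (t : ℝ) : mx u u t ≤ mx u v t := by
  rw [mx, max_self]; exact le_max_left _ _

theorem mx_comm (t : ℝ) : mx u v t = mx v u t := max_comm _ _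

/-- The Galilei transform of a solution differs from it by `O(h)`. -/
theorem Sol.enorm_gal_sub_le (ha : a ≤ 0) (hb : 0 ≤ b) (hu : Sol a b u₀ u) {N : ℕ}
    (hN : ∫⁻ t in Icc a b, 3 * mx u u t ^ 2 ≤ ENNReal.ofReal (N / 2)) (h : ℝ) {t : ℝ}
    (ht : t ∈ Icc a b) :
    ‖ProductNLS.gal h t (u t) - u t‖ₑ ≤ gronC N * (‖h‖ₑ * weightNorm u₀) := by
  refine ((hu.gal ha hb h).enorm_sub_le ha hb hu (N := N) ?_ ht).trans ?_
  · simpa only [mx_gal_self] using hN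
  · exact mul_le_mul_right (enorm_gal_zero_sub_le h u₀) _

theorem enorm_second_diff_le (h : ℝ) (f g : L2 d) :
    ‖(gal h 0 f - f) - (gal h 0 g - g)‖ₑ ≤ ‖h‖ₑ * weightNorm (f - g) := by
  have e : (gal h 0 f - f) - (gal h 0 g - g) = gal h 0 (f - g) - (f - g) := by
    rw [map_sub]; abel
  rw [e]
  exact enorm_gal_zero_sub_le h (f - g)

theorem Sol.second_diff_eq (ha : a ≤ 0) (hb : 0 ≤ b) {u' v' : ℝ → L2 d} {u₀' v₀' : L2 d}
    (hu : Sol a b u₀ u) (hv : Sol a b v₀ v) (hu' : Sol a b u₀' u') (hv' : Sol a b v₀' v') {t : ℝ}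
    (ht : t ∈ Icc a b) :
    (u' t - u t) - (v' t - v t) = U t ((u₀' - u₀) - (v₀' - v₀)) -
      Complex.I • duh (fun τ => (cubic (u' τ) - cubic (u τ)) - (cubic (v' τ) - cubic (v τ))) t := by
  rw [hu'.sub_eq ha hb hu ht, hv'.sub_eq ha hb hv ht, U_sub _ (u₀' - u₀),
    ← duh_sub ((hu'.intervalIntegrable_cubic ha hb ht).sub (hu.intervalIntegrable_cubic ha hb ht))
      ((hv'.intervalIntegrable_cubic ha hb ht).sub (hv.intervalIntegrable_cubic ha hb ht)), smul_sub]
  abel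

theorem eLpNorm_gal_sub_gal (h t : ℝ) (f g : L2 d) :
    eLpNorm (gal h t f - gal h t g : L2 d) ⊤ volume = eLpNorm (f - g : L2 d) ⊤ volume := by
  rw [← map_sub, eLpNorm_gal]

/-- The Galilei difference quotients of two solutions. -/
theorem Sol.enorm_gal_sub_sub_le (ha : a ≤ 0) (hb : 0 ≤ b) (hu : Sol a b u₀ u) (hv : Sol a b v₀ v)
    {N : ℕ} (hN : ∫⁻ t in Icc a b, 3 * mx u v t ^ 2 ≤ ENNReal.ofReal (N / 2)) (h : ℝ) {t : ℝ}
    (ht : t ∈ Icc a b) :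
    ‖(ProductNLS.gal h t (u t) - u t) - (ProductNLS.gal h t (v t) - v t)‖ₑ ≤
      gronC N * (‖h‖ₑ * weightNorm (u₀ - v₀) +
        6 * (∫⁻ τ in Icc a b, mx u v τ * eLpNorm (u τ - v τ : L2 d) ⊤ volume) *
          (gronC N * (‖h‖ₑ * weightNorm v₀))) := by
  have hu' := hu.gal ha hb h
  have hv' := hv.gal ha hb h
  obtain ⟨B, hB, hwB⟩ := exists_bound_of_continuousOn
    ((hu'.cont.sub hu.cont).sub (hv'.cont.sub hv.cont))
  have hNv : ∫⁻ t in Icc a b, 3 * mx v v t ^ 2 ≤ ENNReal.ofReal (N / 2) := by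
    refine le_trans (lintegral_mono fun t => ?_) hN
    have : mx v v t ≤ mx u v t := by rw [mx_comm (u := u)]; exact mx_self_le t
    gcongr
  have hm := aemeasurable_mx hu.toAdm hv.toAdm
  have hδ : AEMeasurable (fun τ => eLpNorm (u τ - v τ : L2 d) ⊤ volume)
      (volume.restrict (Icc a b)) := aemeasurable_eLpNorm_top_comp (hu.meas.sub hv.meas)
  refine gronwall ha hb ((hm.pow_const 2).const_mul 3) hN hB
    (y := fun t => ‖(ProductNLS.gal h t (u t) - u t) - (ProductNLS.gal h t (v t) - v t)‖ₑ)
    hwB (fun t ht => ?_) t ht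
  have e := hu.second_diff_eq ha hb hv hu' hv' ht
  change ‖(ProductNLS.gal h t (u t) - u t) - (ProductNLS.gal h t (v t) - v t)‖ₑ ≤ _
  rw [e]
  refine (enorm_sub_I_smul_le _ _).trans ?_
  rw [enorm_U, add_assoc]
  refine add_le_add (enorm_second_diff_le h u₀ v₀) ((enorm_duh_le t).trans ?_)
  -- The second difference of cubes splits into a Gronwall term and a forcing term. In the latter
  -- the Galilei difference of v is already known to be of size |h| ‖x v₀‖, and it multiplies the
  -- sup norm of u − v.
  have hpt : ∀ᵐ τ ∂volume.restrict (uIoc 0 t),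
      ‖(cubic (ProductNLS.gal h τ (u τ)) - cubic (u τ)) -
        (cubic (ProductNLS.gal h τ (v τ)) - cubic (v τ))‖ₑ ≤
      6 * (mx u v τ * eLpNorm (u τ - v τ : L2 d) ⊤ volume) *
        (gronC N * (‖h‖ₑ * weightNorm v₀)) +
      3 * mx u v τ ^ 2 *
        ‖(ProductNLS.gal h τ (u τ) - u τ) - (ProductNLS.gal h τ (v τ) - v τ)‖ₑ := by
    filter_upwards [ae_uIoc ha hb ht hu.ae, ae_uIoc ha hb ht hv.ae,
      ae_restrict_mem measurableSet_uIoc] with τ h1 h2 h3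
    refine (enorm_cubic_second_diff_le (mx_ne_top h1 h2) (le_max_left _ _)
      (by rw [eLpNorm_gal]; exact le_max_left _ _) (le_max_right _ _)
      (by rw [eLpNorm_gal]; exact le_max_right _ _) le_rfl
      (eLpNorm_gal_sub_gal h τ _ _).le).trans ?_
    rw [add_comm]
    gcongr
    · exact hv.enorm_gal_sub_le ha hb hNv h (uIoc_zero_subset ha hb ht h3)
  refine (lintegral_mono_ae hpt).trans ?_
  have hJ := uIoc_zero_subset ha hb ht
  have hmδ : AEMeasurable (fun τ => 6 * (mx u v τ * eLpNorm (u τ - v τ : L2 d) ⊤ volume))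
      (volume.restrict (Icc a b)) := (hm.mul hδ).const_mul 6
  have hA : AEMeasurable (fun τ => 6 * (mx u v τ * eLpNorm (u τ - v τ : L2 d) ⊤ volume) *
      (gronC N * (‖h‖ₑ * weightNorm v₀))) (volume.restrict (uIoc 0 t)) :=
    (hmδ.mul_const _).mono_set hJ
  rw [lintegral_add_left' hA]
  refine add_le_add ?_ le_rfl
  refine (lintegral_mono_set hJ).trans (le_of_eq ?_)
  rw [lintegral_mul_const'' _ hmδ, lintegral_const_mul' _ _ (by simp)]

theorem Sol.U_neg_eq (ha : a ≤ 0) (hb : 0 ≤ b) (hu : Sol a b u₀ u) {t : ℝ} (ht : t ∈ Icc a b) :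
    U (-t) (u t) = u₀ - Complex.I • ∫ τ in (0 : ℝ)..t, U (-τ) (cubic (u τ)) := by
  rw [hu.duhamel t ht, duh_eq_U (hu.intervalIntegrable_cubic ha hb ht), ← U_smul, ← U_sub, U_U,
    neg_add_cancel, U_zero]

/-- Time increments of the Galilei differences in the interaction picture. -/
theorem Sol.enorm_U_neg_gal_sub_le (ha : a ≤ 0) (hb : 0 ≤ b) (hu : Sol a b u₀ u) {N : ℕ}
    (hN : ∫⁻ t in Icc a b, 3 * mx u u t ^ 2 ≤ ENNReal.ofReal (N / 2)) (h : ℝ) {t t' : ℝ}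
    (ht : t ∈ Icc a b) (ht' : t' ∈ Icc a b) :
    ‖U (-t) (ProductNLS.gal h t (u t) - u t) - U (-t') (ProductNLS.gal h t' (u t') - u t')‖ₑ ≤
      (∫⁻ τ in uIoc t' t, 3 * mx u u τ ^ 2) * (gronC N * (‖h‖ₑ * weightNorm u₀)) := by
  have hab := ha.trans hb
  have hu' := hu.gal ha hb h
  have hi : ∀ {w : ℝ → L2 d}, Adm a b w → ∀ t ∈ Icc a b,
      IntervalIntegrable (fun τ => U (-τ) (cubic (w τ))) volume 0 t := fun hw t ht =>
    intervalIntegrable_U (hw.intervalIntegrable_cubic ha hb ht) measurable_neg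
  have hsub : uIoc t' t ⊆ Icc a b := uIoc_subset_uIcc.trans (by
    rw [← uIcc_of_le hab]
    refine uIcc_subset_uIcc ?_ ?_ <;> rwa [uIcc_of_le hab])
  let J : (ℝ → L2 d) → ℝ → L2 d := fun w t => ∫ τ in (0 : ℝ)..t, U (-τ) (cubic (w τ))
  let u' : ℝ → L2 d := fun t => ProductNLS.gal h t (u t)
  have hJ : ∀ {w : ℝ → L2 d}, Adm a b w → J w t - J w t' = ∫ τ in t'..t, U (-τ) (cubic (w τ)) :=
    fun hw => intervalIntegral.integral_interval_sub_left (hi hw t ht) (hi hw t' ht')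
  have hii : ∀ {w : ℝ → L2 d}, Adm a b w →
      IntervalIntegrable (fun τ => U (-τ) (cubic (w τ))) volume t' t := fun hw =>
    (hi hw t' ht').symm.trans (hi hw t ht)
  have e : U (-t) (ProductNLS.gal h t (u t) - u t) - U (-t') (ProductNLS.gal h t' (u t') - u t') =
      -(Complex.I • ∫ τ in t'..t, U (-τ) (cubic (u' τ) - cubic (u τ))) := by
    have e1 : ∀ t ∈ Icc a b, U (-t) (ProductNLS.gal h t (u t) - u t) =
        (ProductNLS.gal h 0 u₀ - u₀) - Complex.I • (J u' t - J u t) := fun t ht => by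
      rw [U_sub, hu'.U_neg_eq ha hb ht, hu.U_neg_eq ha hb ht, smul_sub]
      simp only [J, u']
      abel
    simp only [U_sub]
    rw [intervalIntegral.integral_sub (hii hu'.toAdm) (hii hu.toAdm), ← hJ hu'.toAdm,
      ← hJ hu.toAdm, ← U_sub, ← U_sub, e1 t ht, e1 t' ht']
    simp only [smul_sub]
    abel
  rw [e, enorm_neg, enorm_smul, ← ofReal_norm Complex.I, Complex.norm_I, ENNReal.ofReal_one,
    one_mul, intervalIntegral.intervalIntegral_eq_integral_uIoc]
  have hm : AEMeasurable (fun τ => 3 * mx u u τ ^ 2) (volume.restrict (uIoc t' t)) :=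
    (((aemeasurable_mx hu.toAdm hu.toAdm).pow_const 2).const_mul 3).mono_set hsub
  calc _ ≤ ‖∫ τ in uIoc t' t, U (-τ) (cubic (u' τ) - cubic (u τ))‖ₑ := by
        split_ifs <;> simp
    _ ≤ ∫⁻ τ in uIoc t' t, ‖U (-τ) (cubic (u' τ) - cubic (u τ))‖ₑ :=
        enorm_integral_le_lintegral_enorm _
    _ ≤ ∫⁻ τ in uIoc t' t, 3 * mx u u τ ^ 2 * (gronC N * (‖h‖ₑ * weightNorm u₀)) := by
        refine lintegral_mono_ae ?_
        filter_upwards [ae_restrict_of_ae_restrict_of_subset hsub hu.ae,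
          ae_restrict_mem measurableSet_uIoc] with τ h1 h2
        rw [enorm_U]
        refine (enorm_cubic_sub_le (mx_ne_top h1 h1)
          (by simp only [u', eLpNorm_gal]; exact le_max_left _ _) (le_max_left _ _)).trans ?_
        exact mul_le_mul_right (hu.enorm_gal_sub_le ha hb hN h (hsub h2)) _
    _ = _ := lintegral_mul_const'' _ hm

end Estimates

end

/-! ### Identification of weak limits with L_x in the sense of distributions -/

section

variable {d : ℕ}

section Test

/-- The covering map `ℝ × ℝ^d → ℝ × 𝕋^d`. -/
def cover (d : ℕ) (p : ℝ × (Fin d → ℝ)) : Space d :=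
  (p.1, fun i => (p.2 i : AddCircle (2 * Real.pi)))

theorem isOpenQuotientMap_cover : IsOpenQuotientMap (cover d) :=
  IsOpenQuotientMap.id.prodMap
    (IsOpenQuotientMap.piMap fun _ : Fin d => QuotientAddGroup.isOpenQuotientMap_mk)

variable {φ : Space d → ℂ}

theorem IsTest.contDiff (h : IsTest φ) : ContDiff ℝ ∞ (φ ∘ cover d) := h.1

theorem IsTest.continuous (h : IsTest φ) : Continuous φ :=
  isOpenQuotientMap_cover.continuous_comp_iff.1 h.contDiff.continuous

/-- The derivative in the noncompact direction. -/
def dX (φ : Space d → ℂ) (z : Space d) : ℂ := deriv (fun x : ℝ => φ (x, z.2)) z.1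

theorem IsTest.hasDerivAt_cover (h : IsTest φ) (p : ℝ × (Fin d → ℝ)) :
    HasDerivAt (fun x : ℝ => φ (x, (cover d p).2)) (fderiv ℝ (φ ∘ cover d) p (1, 0)) p.1 := by
  have h1 : HasFDerivAt (φ ∘ cover d) (fderiv ℝ (φ ∘ cover d) p) p :=
    (h.contDiff.differentiable (by simp) p).hasFDerivAt
  have h2 : HasDerivAt (fun x : ℝ => (x, p.2)) ((1 : ℝ), (0 : Fin d → ℝ)) p.1 :=
    (hasDerivAt_id p.1).prodMk (hasDerivAt_const p.1 p.2)
  exact HasFDerivAt.comp_hasDerivAt (f := fun x : ℝ => (x, p.2)) p.1 h1 h2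

theorem IsTest.hasDerivAt (h : IsTest φ) (z : Space d) :
    HasDerivAt (fun x : ℝ => φ (x, z.2)) (dX φ z) z.1 := by
  obtain ⟨p, rfl⟩ := isOpenQuotientMap_cover.surjective z
  exact (h.hasDerivAt_cover p).differentiableAt.hasDerivAt

/-- Smoothness is only available for the lift, so continuity is checked there and descends because
the covering map is an open quotient map. -/
theorem IsTest.continuous_dX (h : IsTest φ) : Continuous (dX φ) := by
  refine isOpenQuotientMap_cover.continuous_comp_iff.1 ?_
  have e : dX φ ∘ cover d = fun p => fderiv ℝ (φ ∘ cover d) p (1, 0) :=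
    funext fun p => (h.hasDerivAt_cover p).deriv
  rw [e]
  exact (h.contDiff.continuous_fderiv (by simp)).clm_apply continuous_const

theorem IsTest.exists_support (h : IsTest φ) : ∃ R : ℝ, ∀ z : Space d, R < |z.1| → φ z = 0 := by
  obtain ⟨R, hR⟩ := (h.2.isCompact.image continuous_fst).isBounded.subset_closedBall (0 : ℝ)
  refine ⟨R, fun z hz => image_eq_zero_of_notMem_tsupport fun hmem => ?_⟩
  have := hR (mem_image_of_mem _ hmem)
  rw [mem_closedBall_zero_iff, Real.norm_eq_abs] at this
  linarith

theorem IsTest.exists_bound (h : IsTest φ) : ∃ A : ℝ, 0 ≤ A ∧ ∀ z, ‖φ z‖ ≤ A := by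
  obtain ⟨A, hA⟩ := h.2.exists_bound_of_continuous h.continuous
  exact ⟨max A 0, le_max_right _ _, fun z => (hA z).trans (le_max_left _ _)⟩

theorem IsTest.exists_bound_dX (h : IsTest φ) : ∃ B : ℝ, 0 ≤ B ∧ ∀ z, ‖dX φ z‖ ≤ B := by
  have hs : HasCompactSupport (dX φ) := by
    refine HasCompactSupport.of_support_subset_isCompact h.2.isCompact fun z hz => ?_
    by_contra hmem
    refine hz ?_
    have h1 : ∀ᶠ w in 𝓝 z, φ w = 0 := by
      filter_upwards [(isClosed_tsupport φ).isOpen_compl.mem_nhds hmem] with w hw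
      exact image_eq_zero_of_notMem_tsupport hw
    have h2 : Tendsto (fun x : ℝ => (x, z.2)) (𝓝 z.1) (𝓝 z) :=
      (Continuous.prodMk_left z.2).tendsto z.1
    have h3 : (fun x : ℝ => φ (x, z.2)) =ᶠ[𝓝 z.1] fun _ => 0 := h2.eventually h1
    rw [dX, h3.deriv_eq, deriv_const]
  obtain ⟨B, hB⟩ := hs.exists_bound_of_continuous h.continuous_dX
  exact ⟨max B 0, le_max_right _ _, fun z => (hB z).trans (le_max_left _ _)⟩

theorem IsTest.memLp (h : IsTest φ) : MemLp φ 2 volume :=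
  h.continuous.memLp_of_hasCompactSupport h.2

end Test

section Quotient

/-- The difference quotient that acts on test functions. -/
def quot (φ : Space d → ℂ) (t h : ℝ) (z : Space d) : ℂ :=
  (Complex.I * h)⁻¹ * (galPhase h t (z.1 + h * t) * φ (z.1 + h * t, z.2) - φ z)

variable {φ : Space d → ℂ}

theorem galPhase_shift (h t x : ℝ) :
    galPhase h t (x + h * t) = Complex.exp (Complex.I * (h * (x + h * t / 2) : ℝ)) := by
  rw [galPhase]; congr 3; ring

theorem IsTest.tendsto_quot (hφ : IsTest φ) (t : ℝ) (z : Space d) :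
    Tendsto (fun h => quot φ t h z) (𝓝[≠] 0) (𝓝 ((z.1 : ℂ) * φ z - Complex.I * t * dX φ z)) := by
  have h1 : HasDerivAt (fun h : ℝ => galPhase h t (z.1 + h * t)) (Complex.I * z.1) 0 := by
    simp only [galPhase_shift]
    have h2 : HasDerivAt (fun h : ℝ => h * (z.1 + h * t / 2)) z.1 0 := by
      refine HasDerivAt.congr_deriv (f' := 1 * (z.1 + 0 * t / 2) + 0 * (1 * t / 2)) ?_ (by simp)
      exact (hasDerivAt_id' (0 : ℝ)).mul
        ((((hasDerivAt_id' (0 : ℝ)).mul_const t).div_const 2).const_add z.1)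
    have h3 := (h2.ofReal_comp.const_mul Complex.I).cexp
    simpa using h3
  have h4 : HasDerivAt (fun h : ℝ => φ (z.1 + h * t, z.2)) (t * dX φ z) 0 := by
    have h5 : HasDerivAt (fun h : ℝ => z.1 + h * t) t 0 := by
      simpa using ((hasDerivAt_id (0 : ℝ)).mul_const t).const_add z.1
    have h6 : HasDerivAt (fun x : ℝ => φ (x, z.2)) (dX φ z) (z.1 + 0 * t) := by
      simpa using hφ.hasDerivAt z
    have := h6.scomp (0 : ℝ) h5
    simpa [Function.comp_def] using this
  have h7 := hasDerivAt_iff_tendsto_slope_zero.1 (h1.mul h4)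
  have h8 := h7.const_mul (Complex.I⁻¹)
  -- The product rule at h = 0 gives ixφ + t∂_xφ; division by i produces xφ − it∂_xφ, the transpose
  -- of L_x.
  have e : Complex.I⁻¹ * (Complex.I * z.1 * φ (z.1 + 0 * t, z.2) +
      galPhase 0 t (z.1 + 0 * t) * (t * dX φ z)) = (z.1 : ℂ) * φ z - Complex.I * t * dX φ z := by
    have : galPhase 0 t (z.1 + 0 * t) = 1 := by simp [galPhase]
    rw [this, zero_mul, add_zero, Complex.inv_I]
    linear_combination (-(z.1 : ℂ) * φ z) * Complex.I_mul_I
  rw [e] at h8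
  refine h8.congr fun h => ?_
  have : galPhase 0 t (z.1 + 0 * t) = 1 := by simp [galPhase]
  simp only [Pi.mul_apply, zero_add, Complex.real_smul]
  rw [this, zero_mul, add_zero, one_mul, quot, mul_inv, Complex.ofReal_inv]
  ring

/-- The mean value inequality bounds the quotient uniformly in h, and for |h| ≤ 1 its support stays
in one strip |x| ≤ |R| + |t|, which has finite measure. This dominates the integrands in the limit h
→ 0. -/
theorem IsTest.exists_quot_bound (hφ : IsTest φ) (t : ℝ) :
    ∃ K R : ℝ, ∀ h : ℝ, h ≠ 0 → |h| ≤ 1 → ∀ z : Space d,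
      ‖quot φ t h z‖ ≤ (Icc (-R) R ×ˢ univ).indicator (fun _ => K) z := by
  obtain ⟨R, hR⟩ := hφ.exists_support
  obtain ⟨A, hA0, hA⟩ := hφ.exists_bound
  obtain ⟨B, hB0, hB⟩ := hφ.exists_bound_dX
  refine ⟨(|R| + |t|) * A + B * |t|, |R| + |t|, fun h h0 h1 z => ?_⟩
  have hht : |h * t| ≤ |t| := by
    rw [abs_mul]
    exact mul_le_of_le_one_left (abs_nonneg t) h1
  by_cases hz : z ∈ Icc (-(|R| + |t|)) (|R| + |t|) ×ˢ (univ : Set (Torus d))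
  · rw [indicator_of_mem hz]
    have b1 : ‖galPhase h t (z.1 + h * t) - 1‖ * ‖φ (z.1 + h * t, z.2)‖ ≤
        |h| * ((|R| + |t|) * A) := by
      by_cases hs : |z.1 + h * t| ≤ R
      · have h2 : ‖galPhase h t (z.1 + h * t) - 1‖ ≤ |h| * (|R| + |t|) := by
          rw [galPhase_shift]
          refine Real.norm_exp_I_mul_ofReal_sub_one_le.trans ?_
          rw [Real.norm_eq_abs, abs_mul]
          refine mul_le_mul_of_nonneg_left ?_ (abs_nonneg h)
          have e : z.1 + h * t / 2 = (z.1 + h * t) - h * t / 2 := by ring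
          rw [e]
          refine (abs_sub _ _).trans (add_le_add (hs.trans (le_abs_self R)) ?_)
          rw [abs_div, abs_two]
          linarith [abs_nonneg t, abs_nonneg (h * t)]
        rw [← mul_assoc]
        exact mul_le_mul h2 (hA _) (norm_nonneg _) (by positivity)
      · rw [hR (z.1 + h * t, z.2) (not_le.1 hs), norm_zero, mul_zero]
        positivity
    have b2 : ‖φ (z.1 + h * t, z.2) - φ z‖ ≤ |h| * (B * |t|) := by
      have := convex_univ.norm_image_sub_le_of_norm_hasDerivWithin_le (𝕜 := ℝ)
        (f := fun x : ℝ => φ (x, z.2)) (f' := fun x => dX φ (x, z.2)) (C := B)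
        (fun x _ => (hφ.hasDerivAt (x, z.2)).hasDerivWithinAt) (fun x _ => hB _)
        (mem_univ z.1) (mem_univ (z.1 + h * t))
      refine this.trans (le_of_eq ?_)
      rw [add_sub_cancel_left, Real.norm_eq_abs, abs_mul]
      ring
    have b3 : ‖galPhase h t (z.1 + h * t) * φ (z.1 + h * t, z.2) - φ z‖ ≤
        |h| * ((|R| + |t|) * A + B * |t|) := by
      have e : galPhase h t (z.1 + h * t) * φ (z.1 + h * t, z.2) - φ z =
          (galPhase h t (z.1 + h * t) - 1) * φ (z.1 + h * t, z.2) +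
            (φ (z.1 + h * t, z.2) - φ z) := by ring
      rw [e, mul_add]
      refine (norm_add_le _ _).trans (add_le_add ?_ b2)
      rw [norm_mul]
      exact b1
    rw [quot, norm_mul, norm_inv, norm_mul, Complex.norm_I, one_mul, Complex.norm_real,
      Real.norm_eq_abs]
    rw [inv_mul_le_iff₀ (abs_pos.2 h0)]
    exact b3
  · rw [indicator_of_notMem hz]
    have hz1 : |R| + |t| < |z.1| := by
      by_contra hc
      exact hz ⟨abs_le.1 (not_lt.1 hc), mem_univ _⟩
    have h2 : R < |z.1| := by linarith [le_abs_self R, abs_nonneg t]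
    have h3 : R < |z.1 + h * t| := by
      have := abs_sub_abs_le_abs_sub z.1 (-(h * t))
      rw [sub_neg_eq_add, abs_neg] at this
      linarith [le_abs_self R]
    rw [quot, hR z h2, hR (z.1 + h * t, z.2) h3]
    simp

theorem IsTest.continuous_quot (hφ : IsTest φ) (t h : ℝ) : Continuous (quot φ t h) := by
  have h1 := hφ.continuous
  have h2 := continuous_galPhase h t
  unfold quot
  fun_prop

theorem integrable_mul_test (f : L2 d) (hφ : IsTest φ) : Integrable fun z => f z * φ z :=
  (Lp.memLp f).integrable_mul hφ.memLp

theorem integral_gal_mul (h t : ℝ) (f : L2 d) (φ : Space d → ℂ) :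
    ∫ z, gal h t f z * φ z =
      ∫ z, f z * (galPhase h t (z.1 + h * t) * φ (z.1 + h * t, z.2)) := by
  let G : Space d → ℂ := fun z => f z * (galPhase h t (z.1 + h * t) * φ (z.1 + h * t, z.2))
  have hemb : MeasurableEmbedding fun z : Space d => (z.1 - h * t, z.2) :=
    ((Homeomorph.subRight (h * t)).prodCongr (Homeomorph.refl (Torus d))).measurableEmbedding
  have := (measurePreserving_shift (d := d) (h * t)).integral_comp hemb G
  rw [← this]
  refine integral_congr_ae ?_
  filter_upwards [gal_ae h t f] with z hz
  rw [hz]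
  simp only [G, sub_add_cancel]
  ring

theorem integral_quot (hφ : IsTest φ) (h t : ℝ) (f : L2 d) :
    ∫ z, ((Complex.I * h)⁻¹ • (gal h t f - f) : L2 d) z * φ z = ∫ z, f z * quot φ t h z := by
  have e1 : ∫ z, ((Complex.I * h)⁻¹ • (gal h t f - f) : L2 d) z * φ z =
      (Complex.I * h)⁻¹ * ((∫ z, gal h t f z * φ z) - ∫ z, f z * φ z) := by
    rw [← integral_sub (integrable_mul_test _ hφ) (integrable_mul_test _ hφ), ← integral_const_mul]
    refine integral_congr_ae ?_
    filter_upwards [Lp.coeFn_smul (Complex.I * h : ℂ)⁻¹ (gal h t f - f),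
      Lp.coeFn_sub (gal h t f) f] with z h1 h2
    rw [h1, Pi.smul_apply, h2, Pi.sub_apply, smul_eq_mul]
    ring
  have hi : Integrable fun z => f z * (galPhase h t (z.1 + h * t) * φ (z.1 + h * t, z.2)) := by
    have hm : MemLp (fun z : Space d => galPhase h t (z.1 + h * t) * φ (z.1 + h * t, z.2)) 2
        volume := by
      have h1 : MemLp (fun z : Space d => φ (z.1 - -(h * t), z.2)) 2 volume :=
        hφ.memLp.comp_measurePreserving (measurePreserving_shift (-(h * t)))
      simp only [sub_neg_eq_add] at h1
      refine h1.of_le ?_ (.of_forall fun z => ?_)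
      · have h2 := hφ.continuous
        have h3 := continuous_galPhase h t
        exact Continuous.aestronglyMeasurable (by fun_prop)
      · rw [norm_mul, norm_galPhase, one_mul]
    exact (Lp.memLp f).integrable_mul hm
  rw [e1, integral_gal_mul, ← integral_sub hi (integrable_mul_test f hφ), ← integral_const_mul]
  refine integral_congr_ae (.of_forall fun z => ?_)
  simp only [quot]
  ring

theorem tendsto_integral_quot (hφ : IsTest φ) (t : ℝ) (f : L2 d) :
    Tendsto (fun h : ℝ => ∫ z, ((Complex.I * h)⁻¹ • (gal h t f - f) : L2 d) z * φ z) (𝓝[≠] 0)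
      (𝓝 (∫ z, f z * ((z.1 : ℂ) * φ z - Complex.I * t * dX φ z))) := by
  simp only [integral_quot hφ]
  obtain ⟨K, R, hK⟩ := hφ.exists_quot_bound t
  have hS : MeasurableSet (Icc (-R) R ×ˢ (univ : Set (Torus d))) :=
    measurableSet_Icc.prod MeasurableSet.univ
  have hfin : volume (Icc (-R) R ×ˢ (univ : Set (Torus d))) ≠ ⊤ := by
    rw [Measure.volume_eq_prod, Measure.prod_prod]
    exact ENNReal.mul_ne_top (by simp) (measure_ne_top _ _)
  refine tendsto_integral_filter_of_dominated_convergence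
    (fun z => ‖f z‖ * (Icc (-R) R ×ˢ univ).indicator (fun _ => K) z) ?_ ?_ ?_ ?_
  · exact .of_forall fun h => (Lp.aestronglyMeasurable f).mul
      (hφ.continuous_quot t h).aestronglyMeasurable
  · have h1 : ∀ᶠ h : ℝ in 𝓝[≠] 0, |h| ≤ 1 := by
      refine mem_nhdsWithin_of_mem_nhds ?_
      filter_upwards [Metric.closedBall_mem_nhds (0 : ℝ) one_pos] with h hh
      simpa using hh
    filter_upwards [h1, self_mem_nhdsWithin] with h hh h0
    refine .of_forall fun z => ?_
    rw [norm_mul]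
    exact mul_le_mul_of_nonneg_left (hK h h0 hh z) (norm_nonneg _)
  · exact (Lp.memLp f).norm.integrable_mul (memLp_indicator_const 2 hS K (Or.inr hfin))
  · exact .of_forall fun z => (hφ.tendsto_quot t z).const_mul (f z)

end Quotient

section Unique

theorem char_cover_contDiff (k : Fin d → ℤ) :
    ContDiff ℝ ∞ fun p : ℝ × (Fin d → ℝ) => char k (cover d p).2 := by
  have e : (fun p : ℝ × (Fin d → ℝ) => char k (cover d p).2) = fun p => ∏ i, Complex.exp
      (2 * Real.pi * Complex.I * k i * ((p.2 i : ℝ) : ℂ) / (2 * Real.pi : ℝ)) := by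
    funext p
    simp only [char, cover]
    exact Finset.prod_congr rfl fun i _ => fourier_coe_apply
  rw [e]
  refine contDiff_prod fun i _ => ?_
  have h1 : ContDiff ℝ ∞ fun p : ℝ × (Fin d → ℝ) => ((p.2 i : ℝ) : ℂ) :=
    Complex.ofRealCLM.contDiff.comp (by fun_prop)
  fun_prop

theorem isTest_tensor {g : ℝ → ℝ} (hg : ContDiff ℝ ∞ g) (hs : HasCompactSupport g)
    (k : Fin d → ℤ) : IsTest fun z : Space d => (g z.1 : ℂ) * char k z.2 := by
  refine ⟨?_, ?_⟩
  · have h1 : ContDiff ℝ ∞ fun p : ℝ × (Fin d → ℝ) => ((g p.1 : ℝ) : ℂ) :=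
      Complex.ofRealCLM.contDiff.comp (hg.comp contDiff_fst)
    exact h1.mul (char_cover_contDiff k)
  · refine HasCompactSupport.of_support_subset_isCompact (hs.isCompact.prod isCompact_univ)
      fun z hz => ⟨subset_tsupport g fun h0 => hz ?_, mem_univ _⟩
    simp [h0]

/-- Test functions g(x) e^{-i⟨k, y⟩} isolate the k-th Fourier coefficient, which then vanishes as a
distribution on the line. -/
theorem eq_zero_of_integral_test {f : L2 d} (h : ∀ φ, IsTest φ → ∫ z, f z * φ z = 0) : f = 0 := by
  refine eq_zero_of_forall_mode fun k => ?_
  have hloc : LocallyIntegrable (mode k f) volume :=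
    (Lp.memLp (mode k f)).locallyIntegrable (by norm_num)
  refine Lp.ext ?_
  have h0 := ae_eq_zero_of_integral_contDiff_smul_eq_zero hloc fun g hg hs => ?_
  · filter_upwards [h0, Lp.coeFn_zero ℂ 2 (volume : Measure ℝ)] with x h1 h2
    rw [h1, h2, Pi.zero_apply]
  have hT := isTest_tensor hg hs (-k)
  have h1 := h _ hT
  rw [integral_space (integrable_mul_test f hT)] at h1
  have h2 : ∫ x, g x • (mode k f : ℝ → ℂ) x = (normConst d : ℂ) *
      ∫ x : ℝ, ∫ y : Torus d, f (x, y) * ((g x : ℂ) * char (-k) y) := by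
    rw [← integral_const_mul]
    refine integral_congr_ae ?_
    filter_upwards [mode_ae k f] with x hx
    rw [hx, modeFun, Complex.real_smul, ← integral_const_mul, ← integral_const_mul,
      ← integral_const_mul]
    refine integral_congr_ae (.of_forall fun y => ?_)
    simp only [char_neg]
    ring
  rw [h2, h1, mul_zero]

theorem IsLx.unique {t : ℝ} {f g g' : L2 d} (h : IsLx t f g) (h' : IsLx t f g') : g = g' := by
  refine sub_eq_zero.1 (eq_zero_of_integral_test fun φ hφ => ?_)
  have e : ∫ z, (g - g' : L2 d) z * φ z = (∫ z, g z * φ z) - ∫ z, g' z * φ z := by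
    rw [← integral_sub (integrable_mul_test _ hφ) (integrable_mul_test _ hφ)]
    refine integral_congr_ae ?_
    filter_upwards [Lp.coeFn_sub g g'] with z hz
    rw [hz, Pi.sub_apply, sub_mul]
  rw [e, h φ hφ, h' φ hφ, sub_self]

/-- A weak limit of the Galilei difference quotients is `L_x f`. -/
theorem isLx_of_weak_limit {l : Filter ℝ} [l.NeBot] (hl : l ≤ 𝓝[≠] 0) {t : ℝ} {f w : L2 d}
    (h : ∀ g, Tendsto (fun h : ℝ => (inner ℂ ((Complex.I * h)⁻¹ • (gal h t f - f) : L2 d) g : ℂ)) l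
      (𝓝 (inner ℂ w g))) : IsLx t f w := by
  intro φ hφ
  have hm : MemLp (fun z => (starRingEnd ℂ) (φ z)) 2 (volume : Measure (Space d)) := hφ.memLp.star
  have e : ∀ D : L2 d, (starRingEnd ℂ) (inner ℂ D hm.toLp : ℂ) = ∫ z, D z * φ z := fun D => by
    rw [inner_conj_symm, L2.inner_def]
    refine integral_congr_ae ?_
    filter_upwards [hm.coeFn_toLp] with z hz
    rw [hz, RCLike.inner_apply, Complex.conj_conj]
  have h1 := (RCLike.continuous_conj (K := ℂ)).tendsto _ |>.comp (h hm.toLp)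
  simp only [Function.comp_def, e] at h1
  exact tendsto_nhds_unique h1 ((tendsto_integral_quot hφ t f).mono_left hl)

end Unique

end

/-! ### Propagation of the weight and the weighted Lipschitz bound -/

section

variable {d : ℕ} {s a b : ℝ} {u v : ℝ → L2 d} {u₀ v₀ : L2 d}

section WeightedData

/-- An ultrafilter along which difference quotients at `0` converge weakly. -/
def ultra : Ultrafilter ℝ := Ultrafilter.of (𝓝[≠] (0 : ℝ))

theorem ultra_le : (ultra : Filter ℝ) ≤ 𝓝[≠] 0 := Ultrafilter.of_le _

/-- The difference quotient of the Galilei transformations. -/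
def galQuot (t : ℝ) (f : L2 d) (h : ℝ) : L2 d := (Complex.I * h : ℂ)⁻¹ • (gal h t f - f)

/-- `w` is the weak limit of the difference quotients of `f`. -/
def IsGalLimit (t : ℝ) (f w : L2 d) : Prop :=
  ∀ g, Tendsto (fun h => (inner ℂ (galQuot t f h) g : ℂ)) ultra (𝓝 (inner ℂ w g))

theorem IsGalLimit.isLx {t : ℝ} {f w : L2 d} (h : IsGalLimit t f w) : IsLx t f w :=
  isLx_of_weak_limit ultra_le h

theorem enorm_inv_smul_le {h : ℝ} (h0 : h ≠ 0) {x : L2 d} {C : ℝ≥0∞} (hx : ‖x‖ₑ ≤ ‖h‖ₑ * C) :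
    ‖(Complex.I * h : ℂ)⁻¹ • x‖ₑ ≤ C := by
  have e : ‖(Complex.I * h : ℂ)⁻¹‖ₑ = ‖h‖ₑ⁻¹ := by
    rw [← enorm_inv h0, ← ofReal_norm, ← ofReal_norm, norm_inv, norm_inv, norm_mul, Complex.norm_I,
      one_mul, Complex.norm_real]
  rw [enorm_smul, e]
  calc _ ≤ ‖h‖ₑ⁻¹ * (‖h‖ₑ * C) := mul_le_mul_right hx _
    _ = C := by
        rw [← mul_assoc, ENNReal.inv_mul_cancel (by simpa using h0) (by simp), one_mul]

theorem eventually_ultra_ne : ∀ᶠ h in (ultra : Filter ℝ), h ≠ 0 :=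
  ultra_le self_mem_nhdsWithin

theorem Sol.exists_isGalLimit (ha : a ≤ 0) (hb : 0 ≤ b) (hu : Sol a b u₀ u)
    (hw : weightNorm u₀ ≠ ⊤) : ∃ w : ℝ → L2 d, ∀ t ∈ Icc a b, IsGalLimit t (u t) (w t) := by
  obtain ⟨N, hN⟩ := exists_nat_mx hu.toAdm hu.toAdm
  have h1 : ∀ t, ∃ x : L2 d, t ∈ Icc a b → IsGalLimit t (u t) x := fun t => by
    by_cases ht : t ∈ Icc a b
    · obtain ⟨x, hx⟩ := exists_weak_limit ultra (D := galQuot t (u t))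
        (ENNReal.mul_ne_top ENNReal.coe_ne_top hw : gronC N * weightNorm u₀ ≠ ⊤) (by
          filter_upwards [eventually_ultra_ne] with h h0
          refine enorm_inv_smul_le h0 ((hu.enorm_gal_sub_le ha hb hN h ht).trans (le_of_eq ?_))
          ring)
      exact ⟨x, fun _ => hx⟩
    · exact ⟨0, fun h => absurd h ht⟩
  choose w hw using h1
  exact ⟨w, hw⟩

theorem tendsto_lintegral_uIoc {m : ℝ → ℝ≥0∞} (hm : ∫⁻ r in Icc a b, m r ≠ ⊤) {t : ℝ}
    (ht : t ∈ Icc a b) :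
    Tendsto (fun t' => ∫⁻ r in uIoc t' t, m r) (𝓝[Icc a b] t) (𝓝 0) := by
  have hab := ht.1.trans ht.2
  have h1 : Tendsto (fun t' => volume.restrict (Icc a b) (uIoc t' t)) (𝓝[Icc a b] t) (𝓝 0) := by
    have h2 : Tendsto (fun t' => ENNReal.ofReal |t - t'|) (𝓝[Icc a b] t) (𝓝 0) := by
      have : Continuous fun t' => ENNReal.ofReal |t - t'| :=
        ENNReal.continuous_ofReal.comp (by fun_prop)
      have h3 := (this.tendsto t).mono_left (nhdsWithin_le_nhds (s := Icc a b))
      simpa using h3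
    refine tendsto_of_tendsto_of_tendsto_of_le_of_le tendsto_const_nhds h2 (fun _ => zero_le)
      fun t' => ?_
    refine (Measure.restrict_apply_le _ _).trans (le_of_eq ?_)
    rw [Real.volume_uIoc]
  have h2 := tendsto_setLIntegral_zero hm h1
  refine h2.congr' ?_
  filter_upwards [self_mem_nhdsWithin] with t' ht'
  rw [Measure.restrict_restrict measurableSet_uIoc, inter_eq_self_of_subset_left]
  refine uIoc_subset_uIcc.trans ?_
  rw [← uIcc_of_le hab]
  refine uIcc_subset_uIcc ?_ ?_ <;> rwa [uIcc_of_le hab]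

/-- In the interaction picture the linear flow drops out, so increments of the difference quotients
are bounded, uniformly in h, by the integral of ‖u‖_∞² over the short time interval. The bound
passes to the weak limit and gives strong continuity, although the limit at each time is only weak.
-/
theorem Sol.continuousOn_of_isGalLimit (ha : a ≤ 0) (hb : 0 ≤ b) (hu : Sol a b u₀ u)
    (hw₀ : weightNorm u₀ ≠ ⊤) {w : ℝ → L2 d} (hw : ∀ t ∈ Icc a b, IsGalLimit t (u t) (w t)) :
    ContinuousOn w (Icc a b) := by
  obtain ⟨N, hN⟩ := exists_nat_mx hu.toAdm hu.toAdm
  have hinc : ∀ t ∈ Icc a b, ∀ t' ∈ Icc a b, ‖U (-t) (w t) - U (-t') (w t')‖ₑ ≤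
      (∫⁻ τ in uIoc t' t, 3 * mx u u τ ^ 2) * (gronC N * weightNorm u₀) := by
    intro t ht t' ht'
    refine norm_le_of_weak_limit (l := (ultra : Filter ℝ))
      (D := fun h => U (-t) (galQuot t (u t) h) - U (-t') (galQuot t' (u t') h)) ?_ fun g => ?_
    · filter_upwards [eventually_ultra_ne] with h h0
      rw [galQuot, galQuot, U_smul, U_smul, ← smul_sub]
      refine enorm_inv_smul_le h0 ((hu.enorm_U_neg_gal_sub_le ha hb hN h ht ht').trans
        (le_of_eq ?_))
      ring
    · simp only [inner_sub_left, inner_U_left]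
      exact (hw t ht _).sub (hw t' ht' _)
  have hfin : ∫⁻ t in Icc a b, 3 * mx u u t ^ 2 ≠ ⊤ := ne_top_of_le_ne_top ENNReal.ofReal_ne_top hN
  have hc : ContinuousOn (fun t => U (-t) (w t)) (Icc a b) := by
    intro t ht
    have h1 := ENNReal.Tendsto.mul_const (tendsto_lintegral_uIoc hfin ht)
      (Or.inr (ENNReal.mul_ne_top ENNReal.coe_ne_top hw₀ : gronC N * weightNorm u₀ ≠ ⊤))
    rw [zero_mul] at h1
    refine tendsto_iff_edist_tendsto_0.2 (tendsto_of_tendsto_of_tendsto_of_le_of_le'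
      tendsto_const_nhds h1 (.of_forall fun _ => zero_le) ?_)
    filter_upwards [self_mem_nhdsWithin] with t' ht'
    rw [edist_comm, edist_eq_enorm_sub]
    exact hinc t ht t' ht'
  refine (continuousOn_comp_prodMk continuous_U_uncurry hc).congr fun t _ => ?_
  change w t = U t (U (-t) (w t))
  rw [U_U, add_neg_cancel, U_zero]

theorem Sol.enorm_isGalLimit_sub_le (ha : a ≤ 0) (hb : 0 ≤ b) (hu : Sol a b u₀ u)
    (hv : Sol a b v₀ v) {N : ℕ}
    (hN : ∫⁻ t in Icc a b, 3 * mx u v t ^ 2 ≤ ENNReal.ofReal (N / 2)) {t : ℝ} (ht : t ∈ Icc a b)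
    {w z : L2 d} (hw : IsGalLimit t (u t) w) (hz : IsGalLimit t (v t) z) :
    ‖w - z‖ₑ ≤ gronC N * (weightNorm (u₀ - v₀) +
        6 * (∫⁻ τ in Icc a b, mx u v τ * eLpNorm (u τ - v τ : L2 d) ⊤ volume) *
          (gronC N * weightNorm v₀)) := by
  refine norm_le_of_weak_limit (l := (ultra : Filter ℝ))
    (D := fun h => galQuot t (u t) h - galQuot t (v t) h) ?_ fun g => ?_
  · filter_upwards [eventually_ultra_ne] with h h0
    rw [galQuot, galQuot, ← smul_sub]
    refine enorm_inv_smul_le h0 ((hu.enorm_gal_sub_sub_le ha hb hv hN h ht).trans (le_of_eq ?_))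
    ring
  · simp only [inner_sub_left]
    exact (hw g).sub (hz g)

theorem lintegral_mx_mul_le (hu : Adm a b u) (hv : Adm a b v) :
    ∫⁻ τ in Icc a b, mx u v τ * eLpNorm (u τ - v τ : L2 d) ⊤ volume ≤
      volume (Icc a b) ^ (1 / 2 : ℝ) * ((l4LinftyNorm (Icc a b) u ^ 4 +
        l4LinftyNorm (Icc a b) v ^ 4) ^ (1 / 4 : ℝ) *
        l4LinftyNorm (Icc a b) fun t => u t - v t) := by
  refine (lintegral_mul_le_four (aemeasurable_mx hu hv)
    (aemeasurable_eLpNorm_top_comp (hu.meas.sub hv.meas))).trans ?_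
  refine mul_le_mul_right (mul_le_mul_left ?_ _) _
  exact ENNReal.rpow_le_rpow (lintegral_mx_four_le hu) (by norm_num)

end WeightedData

/-! ### Uniform constants on the short interval -/

section Local

variable {ρ R : ℝ≥0}

/-- By uniqueness at the L² level any mild solution coincides with the Picard solution. The finer
norm is thereby controlled although it is not part of the definition of a solution. -/
theorem Sol.zN_le (hd : 1 ≤ d) (hs : (d : ℝ) / 2 < s) (ha : a ≤ 0) (hb : 0 ≤ b)
    (hS : Small d s a b ρ) (h₀ : 10 * hsNorm s u₀ ≤ ρ) (hu : Sol a b u₀ u) :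
    zN s (Icc a b) u ≤ ρ := by
  obtain ⟨w, hw, hwz⟩ := exists_sol hd hs ha hb ENNReal.coe_ne_top hS h₀
  rwa [zN_congr measurableSet_Icc fun t ht => hu.eq ha hb hw ht]

theorem exists_lipschitz_const (hd : 1 ≤ d) (hs : (d : ℝ) / 2 < s) (ha : a ≤ 0) (hb : 0 ≤ b)
    (hS : Small d s a b ρ) : ∃ C : ℝ≥0, ∀ (u₀ v₀ : L2 d) (u v : ℝ → L2 d),
      10 * hsNorm s u₀ ≤ ρ → 10 * hsNorm s v₀ ≤ ρ → Sol a b u₀ u → Sol a b v₀ v →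
      xNorm s (Icc a b) (fun t => u t - v t) ≤ C * hsNorm s (u₀ - v₀) := by
  have hK : (1 + embC d s) * 10 ≠ ⊤ := ENNReal.mul_ne_top
    (ENNReal.add_ne_top.2 ⟨by simp, embC_ne_top hd hs⟩) (by simp)
  refine ⟨((1 + embC d s) * 10).toNNReal, fun u₀ v₀ u v hu₀ hv₀ hu hv => ?_⟩
  rw [ENNReal.coe_toNNReal hK, mul_assoc]
  refine (xNorm_le_zN (hu.meas.sub hv.meas)).trans (mul_le_mul_right ?_ _)
  exact Sol.zN_sub_le hd hs ha hb ENNReal.coe_ne_top hS hu hv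
    (hu.zN_le hd hs ha hb hS hu₀) (hv.zN_le hd hs ha hb hS hv₀)

theorem exists_weighted_const (hd : 1 ≤ d) (hs : (d : ℝ) / 2 < s) (ha : a ≤ 0) (hb : 0 ≤ b)
    (hS : Small d s a b ρ) (M : ℝ≥0) : ∃ C : ℝ≥0, ∀ (u₀ v₀ : L2 d) (u v : ℝ → L2 d),
      10 * hsNorm s u₀ ≤ ρ → 10 * hsNorm s v₀ ≤ ρ → weightNorm u₀ ≤ M → weightNorm v₀ ≤ M →
      Sol a b u₀ u → Sol a b v₀ v →
      ∀ t ∈ Icc a b, ∀ g h : L2 d, IsLx t (u t) g → IsLx t (v t) h →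
        ‖g - h‖ₑ ≤ C * (hsNorm s (u₀ - v₀) + weightNorm (u₀ - v₀)) := by
  set V := volume (Icc a b) ^ (1 / 2 : ℝ) with hV
  have hVt : V ≠ ⊤ := ENNReal.rpow_ne_top_of_nonneg (by norm_num) (by simp)
  set Q := (embC d s * ρ) ^ 4 + (embC d s * ρ) ^ 4 with hQ
  have hEt := embC_ne_top hd hs
  have hQt : Q ≠ ⊤ := by
    have : (embC d s * ρ) ^ 4 ≠ ⊤ := ENNReal.pow_ne_top (ENNReal.mul_ne_top hEt ENNReal.coe_ne_top)
    exact ENNReal.add_ne_top.2 ⟨this, this⟩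
  have hQr : ∀ r : ℝ, 0 ≤ r → Q ^ r ≠ ⊤ := fun r hr => ENNReal.rpow_ne_top_of_nonneg hr hQt
  -- The number of Gronwall steps is fixed by ρ and the interval alone, so the constant is uniform
  -- over all data in the ball.
  obtain ⟨N, hN⟩ := exists_nat_half_ge (x := 3 * (V * Q ^ (1 / 2 : ℝ)))
    (ENNReal.mul_ne_top (by simp) (ENNReal.mul_ne_top hVt (hQr _ (by norm_num))))
  -- Here 60 is the 6 of the second difference of cubes times the Lipschitz constant 10 of the flow
  -- in the solution norm.
  set K : ℝ≥0∞ := 60 * V * Q ^ (1 / 4 : ℝ) * embC d s * gronC N * M with hKdef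
  have hK : gronC N * (1 + K) ≠ ⊤ := by
    refine ENNReal.mul_ne_top ENNReal.coe_ne_top (ENNReal.add_ne_top.2 ⟨by simp, ?_⟩)
    exact ENNReal.mul_ne_top (ENNReal.mul_ne_top (ENNReal.mul_ne_top (ENNReal.mul_ne_top
      (ENNReal.mul_ne_top (by simp) hVt) (hQr _ (by norm_num))) hEt) ENNReal.coe_ne_top)
      ENNReal.coe_ne_top
  refine ⟨(gronC N * (1 + K)).toNNReal, ?_⟩
  rw [ENNReal.coe_toNNReal hK]
  intro u₀ v₀ u v hu₀ hv₀ hwu hwv hu hv t ht g h hg hh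
  have hzu := hu.zN_le hd hs ha hb hS hu₀
  have hzv := hv.zN_le hd hs ha hb hS hv₀
  have hl4 : l4LinftyNorm (Icc a b) u ^ 4 + l4LinftyNorm (Icc a b) v ^ 4 ≤ Q := by
    have h1 := (l4LinftyNorm_le_zN (s := s) hu.meas).trans (mul_le_mul_right hzu _)
    have h2 := (l4LinftyNorm_le_zN (s := s) hv.meas).trans (mul_le_mul_right hzv _)
    rw [hQ]
    gcongr
  have hNuv : ∫⁻ t in Icc a b, 3 * mx u v t ^ 2 ≤ ENNReal.ofReal (N / 2) := by
    refine (lintegral_mx_sq_le hu.toAdm hv.toAdm).trans (le_trans ?_ hN)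
    gcongr
  obtain ⟨w, hw⟩ := hu.exists_isGalLimit ha hb (ne_top_of_le_ne_top ENNReal.coe_ne_top hwu)
  obtain ⟨z, hz⟩ := hv.exists_isGalLimit ha hb (ne_top_of_le_ne_top ENNReal.coe_ne_top hwv)
  -- Arbitrary distributional representatives of L_x u and L_x v are replaced by the Galilei limits,
  -- for which the estimate is available.
  rw [hg.unique (hw t ht).isLx, hh.unique (hz t ht).isLx]
  refine (hu.enorm_isGalLimit_sub_le ha hb hv hNuv ht (hw t ht) (hz t ht)).trans ?_
  rw [mul_assoc (gronC N : ℝ≥0∞) (1 + K)]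
  refine mul_le_mul_right ?_ _
  have hJ : ∫⁻ τ in Icc a b, mx u v τ * eLpNorm (u τ - v τ : L2 d) ⊤ volume ≤
      V * (Q ^ (1 / 4 : ℝ) * (embC d s * (10 * hsNorm s (u₀ - v₀)))) := by
    refine (lintegral_mx_mul_le hu.toAdm hv.toAdm).trans ?_
    gcongr
    refine (l4LinftyNorm_le_zN (s := s) (hu.meas.sub hv.meas)).trans (mul_le_mul_right ?_ _)
    exact Sol.zN_sub_le hd hs ha hb ENNReal.coe_ne_top hS hu hv hzu hzv
  calc _ ≤ weightNorm (u₀ - v₀) + 6 * (V * (Q ^ (1 / 4 : ℝ) *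
        (embC d s * (10 * hsNorm s (u₀ - v₀))))) * (gronC N * M) := by gcongr
    _ = weightNorm (u₀ - v₀) + K * hsNorm s (u₀ - v₀) := by rw [hKdef]; ring
    _ ≤ (1 + K) * weightNorm (u₀ - v₀) + (1 + K) * hsNorm s (u₀ - v₀) := by
        gcongr
        · exact le_mul_of_one_le_left zero_le le_self_add
        · exact le_add_self
    _ = _ := by ring

end Local

end

end ProductNLS

end

/-! ### The well-posedness theorem -/

open ProductNLS
theorem mainTheorem7 (d : ℕ) (hd : 1 ≤ d) (s : ℝ) (hs : (d : ℝ) / 2 < s) :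
    -- uniqueness on every compact interval containing the initial time
    (∀ (a b : ℝ), a ≤ 0 → 0 ≤ b → ∀ (u₀ : L2 d) (u v : ℝ → L2 d),
      IsSolution s a b u₀ u → IsSolution s a b u₀ v → ∀ t ∈ Set.Icc a b, u t = v t) ∧
    -- existence on a time interval depending only on the size of the data, and
    -- Lipschitz dependence on the data
    (∀ R : ℝ≥0, ∃ T : ℝ, 0 < T ∧ T ≤ 1 ∧
      (∀ u₀ : L2 d, hsNorm s u₀ ≤ R → ∃ u : ℝ → L2 d, IsSolution s (-T) T u₀ u) ∧
      (∃ C : ℝ≥0, ∀ (u₀ v₀ : L2 d) (u v : ℝ → L2 d), hsNorm s u₀ ≤ R → hsNorm s v₀ ≤ R →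
        IsSolution s (-T) T u₀ u → IsSolution s (-T) T v₀ v →
        xNorm s (Set.Icc (-T) T) (fun t => u t - v t) ≤ C * hsNorm s (u₀ - v₀)) ∧
      (∀ M : ℝ≥0, ∃ C : ℝ≥0, ∀ (u₀ v₀ : L2 d) (u v : ℝ → L2 d),
        hsNorm s u₀ ≤ R → hsNorm s v₀ ≤ R → weightNorm u₀ ≤ M → weightNorm v₀ ≤ M →
        IsSolution s (-T) T u₀ u → IsSolution s (-T) T v₀ v →
        ∀ t ∈ Set.Icc (-T) T, ∀ g h : L2 d, IsLx t (u t) g → IsLx t (v t) h →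
          ‖g - h‖ₑ ≤ C * (hsNorm s (u₀ - v₀) + weightNorm (u₀ - v₀)))) ∧
    -- propagation of the weight: `L_x u` is in `C([a, b]; L²)`
    (∀ (a b : ℝ), a ≤ 0 → 0 ≤ b → ∀ (u₀ : L2 d) (u : ℝ → L2 d),
      IsSolution s a b u₀ u → weightNorm u₀ < ⊤ →
      ∃ w : ℝ → L2 d, (∀ t ∈ Set.Icc a b, IsLx t (u t) (w t)) ∧
        ContinuousOn w (Set.Icc a b)) := by
  have hs0 := nonneg_of_half_lt hs
  refine ⟨fun a b ha hb u₀ u v hu hv t ht => (hu.sol hs0).eq ha hb (hv.sol hs0) ht,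
    fun R => ?_, fun a b ha hb u₀ u hu hw => ?_⟩
  -- The ball of radius 10R accommodates all data of size at most R, so one T serves all three
  -- assertions.
  · obtain ⟨T, hT0, hT1, hS⟩ := exists_small (ρ := ((10 * R : ℝ≥0) : ℝ≥0∞)) hd hs
      ENNReal.coe_ne_top
    have ha : -T ≤ 0 := by linarith
    have hR : ∀ {f : L2 d}, hsNorm s f ≤ R → 10 * hsNorm s f ≤ ((10 * R : ℝ≥0) : ℝ≥0∞) :=
      fun hf => by
        rw [ENNReal.coe_mul]
        exact mul_le_mul_right hf _
    refine ⟨T, hT0, hT1, fun u₀ hu₀ => ?_, ?_, fun M => ?_⟩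
    · obtain ⟨u, hu, hz⟩ := exists_sol hd hs ha hT0.le ENNReal.coe_ne_top hS (hR hu₀)
      exact ⟨u, isSolution_of_zN hu (ne_top_of_le_ne_top ENNReal.coe_ne_top hz)⟩
    · obtain ⟨C, hC⟩ := exists_lipschitz_const hd hs ha hT0.le hS
      exact ⟨C, fun u₀ v₀ u v hu₀ hv₀ hu hv =>
        hC u₀ v₀ u v (hR hu₀) (hR hv₀) (hu.sol hs0) (hv.sol hs0)⟩
    · obtain ⟨C, hC⟩ := exists_weighted_const hd hs ha hT0.le hS M
      exact ⟨C, fun u₀ v₀ u v hu₀ hv₀ hwu hwv hu hv =>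
        hC u₀ v₀ u v (hR hu₀) (hR hv₀) hwu hwv (hu.sol hs0) (hv.sol hs0)⟩
  · obtain ⟨w, hw'⟩ := (hu.sol hs0).exists_isGalLimit ha hb hw.ne
    exact ⟨w, fun t ht => (hw' t ht).isLx,
      (hu.sol hs0).continuousOn_of_isGalLimit ha hb hw.ne hw'⟩
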